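/- Let $\mathcal R=\mathbb Z[A^{\pm1},d^{-1}]$ with $d=-A^2-A^{-2}$ (Laurent polynomials in $A$ with $d$ inverted), and let $n\ge 0$. **Tangles.** The Temperley–Lieb algebra $\tau_m$ is the free $\mathcal R$-module on framed tangle diagrams in $\mathbb R\times[0,1]$ (blackboard framing) with $m$ end points at the top and $m$ at the bottom, up to planar isotopy and the framed Reidemeister moves, modulo the local relations $\bigcirc\cup L=dL$ and $L=A\,L_0+A^{-1}L_\infty$. Here $L_0$ is the smoothing of a crossing that joins the two regions swept out when the upper strand is turned counterclockwise to the lower one, and $L_\infty$ is the other smoothing. The product $DD'$ puts $D$ over $D'$. **Ribbon graphs.** A ribbon $n$-graph diagram is a planar diagram in $\mathbb R\times[0,1]$ with $n$ end points at the top and $n$ at the bottom, made of strands (the cores of ribbons and annuli), crossings and vertices (coupons). Diagrams are considered up to planar isotopy and the extended framed Reidemeister moves: the framed first move, the second and the third move, and passing a strand over or under a vertex. The algebra $\mathcal Y_n$ is the free $\mathcal R$-module on these diagrams, with the same kind of product, modulo the following local relations (the Yamada relations): 1. a crossing equals $A^{4}\,(\text{smoothing } L_0)+A^{-4}\,(\text{smoothing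 }L_\infty)-d\,(\text{four-valent vertex})$; 2. $G=G/e-d^{-1}(G-e)$ for an edge $e$ that joins two different vertices; 3. a loop at a vertex that bounds an empty disc is removed with the factor $d-d^{-1}$; 4. a circle that bounds an empty disc is removed with the factor $d^2-1$; 5. a two-valent vertex may be erased, a diagram with a one-valent vertex is $0$, and an isolated vertex is removed with the factor $d$. **Cabling.** For a ribbon $n$-graph diagram $G$ let $\varphi_n(G)\in\tau_{2n}$ be obtained by replacing each edge, half edge, arc and circle of $G$ by two parallel strands that carry the projector $f_1=1_2-d^{-1}U_1\in\tau_2$, where $U_1$ is the diagram $\cup$ over $\cap$, and each vertex by the crossingless diagram in which the neighbouring strands of any two cyclically consecutive legs are joined around the vertex (an isolated vertex is replaced by a circle). **Theorem 5.1.** The map $\varphi_n$ induces a homomorphism of $\mathcal R$-algebras $\Phi_n:\mathcal Y_n\to\tau_{2n}$, that is, there is an $\mathcal R$-linear multiplicative map $\Phi_n$ with $\Phi_n([G])=\varphi_n(G)$ for every ribbon $n$-graph diagram $G$. (It sends the identity $1_n$ to the idempotent $f_1\otimes\dots\otimes f_1$, which for $n\geq 1$ is not the identity of $\tau_{2n}$.)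 The homomorphism $\Phi_n$ is injective. -/

import Mathlib

noncomputable section

namespace RibbonGraph

/-! ### The ground ring -/

/-- The Laurent polynomial `d = -A ^ 2 - A ^ (-2)`. -/
def loopPoly : LaurentPolynomial ℤ := -LaurentPolynomial.T 2 - LaurentPolynomial.T (-2)

/-- The ring `ℤ[A^{±1}, d⁻¹]`: Laurent polynomials in `A` with `d` inverted. -/
abbrev Coeff : Type := Localization.Away loopPoly

/-- The power `A ^ k`, for `k` an integer. -/
def pA (k : ℤ) : Coeff := algebraMap (LaurentPolynomial ℤ) Coeff (LaurentPolynomial.T k)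

/-- `d = -A ^ 2 - A ^ (-2)`. -/
def d : Coeff := algebraMap (LaurentPolynomial ℤ) Coeff loopPoly

/-- `d⁻¹`. -/
def dInv : Coeff := IsLocalization.Away.invSelf loopPoly

/-! ### Diagrams

A planar diagram in the strip `ℝ × [0, 1]`, in general position with respect to the height
function, is cut by horizontal lines into slices, each of which contains exactly one elementary
piece and otherwise vertical strands. It is recorded as the list of its slices, read from top to
bottom. The strands on a horizontal line are numbered `0, 1, 2, …` from left to right.

The vertices carry a label in a type `V`. With `V = Unit` we get diagrams of ribbon graphs
(a strand is the core of a ribbon or of an annulus, a vertex is a coupon, the framing is the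
blackboard framing); with `V = Empty` there are no vertices, and we get diagrams of framed
tangles. -/

/-- The elementary pieces of a diagram. -/
inductive Piece (V : Type) : Type
  /-- A local maximum `∩`: no strand above it, two strands below it. -/
  | cap : Piece V
  /-- A local minimum `∪`: two strands above it, no strand below it. -/
  | cup : Piece V
  /-- A crossing. If the flag is `true`, the strand from bottom left to top right is the upper
  one; if it is `false`, the strand from top left to bottom right is the upper one. -/
  | crossing (e : Bool) : Piece V
  /-- A vertex with `p` legs that leave upwards and `q` legs that leave downwards. -/
  | vertex (v : V) (p q : ℕ) : Piece V

variable {V : Type}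

/-- The number of strands that meet a piece from above. -/
def Piece.top : Piece V → ℕ
  | cap => 0
  | cup => 2
  | crossing _ => 2
  | vertex _ p _ => p

/-- The number of strands that meet a piece from below. -/
def Piece.bot : Piece V → ℕ
  | cap => 2
  | cup => 0
  | crossing _ => 2
  | vertex _ _ q => q

/-- A slice: a piece with exactly `pos` vertical strands to its left. -/
structure Slice (V : Type) : Type where
  piece : Piece V
  pos : ℕ

/-- Words in slices; the product is juxtaposition, the first word being on top. -/
abbrev Word (V : Type) : Type := FreeMonoid (Slice V)

/-- The one-slice word with piece `x` and `i` strands to its left. -/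
def sl (x : Piece V) (i : ℕ) : Word V := FreeMonoid.of ⟨x, i⟩

/-- The list of slices fits together to a diagram with `a` ends on top and `b` at the bottom. -/
def Fits : ℕ → List (Slice V) → ℕ → Prop
  | a, [], b => a = b
  | a, s :: w, b => s.pos + s.piece.top ≤ a ∧ Fits (a - s.piece.top + s.piece.bot) w b

theorem Fits.append {w w' : List (Slice V)} {a b c : ℕ} (h : Fits a w b) (h' : Fits b w' c) :
    Fits a (w ++ w') c := by
  induction w generalizing a with
  | nil => exact (show a = b from h) ▸ h'
  | cons s w ih => exact ⟨h.1, ih h.2⟩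

/-- Diagrams with `n` ends on top and `n` ends at the bottom. They form a monoid: `D * E` is
`D` put over `E`, and the identity consists of `n` vertical strands. -/
def Diagram (V : Type) (n : ℕ) : Submonoid (Word V) where
  carrier := {w | Fits n w.toList n}
  one_mem' := rfl
  mul_mem' h h' := Fits.append h h'

/-- A strand crosses `k` adjacent strands from left to right (downwards); it starts at position
`i`, and the crossings have flag `e`, so that it passes over all of them or under all of them. -/
def pass (e : Bool) (k i : ℕ) : Word V :=
  ((List.range k).map fun j => sl (.crossing e) (i + j)).prod

/-- The local moves: planar isotopy (`interchange`, `zigzag`, `turnCrossing`, `turnVertex`) and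
the extended Reidemeister moves for framed diagrams. The variants obtained from the listed ones
by turning them, by reading a strand from right to left, or by bending a leg with a `∪` are
consequences of the listed ones. -/
inductive Move : Word V → Word V → Prop
  /-- Two pieces at different places may change their heights. -/
  | interchange (x y : Piece V) (i k : ℕ) :
      Move (sl x i * sl y (i + x.bot + k)) (sl y (i + x.top + k) * sl x i)
  /-- A strand may be straightened. -/
  | zigzag_right (i : ℕ) : Move (sl .cap (i + 1) * sl .cup i) 1
  | zigzag_left (i : ℕ) : Move (sl .cap i * sl .cup (i + 1)) 1
  /-- A crossing may be turned by a quarter turn. -/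
  | turnCrossing (e : Bool) (i : ℕ) :
      Move (sl .cap (i + 1) * sl (.crossing e) i) (sl .cap i * sl (.crossing !e) (i + 1))
  /-- A vertex may be turned: its leftmost upper leg, bent down, is its leftmost lower leg. -/
  | turnVertex_left (v : V) (p q i : ℕ) :
      Move (sl .cap i * sl (.vertex v (p + 1) q) (i + 1)) (sl (.vertex v p (q + 1)) i)
  /-- The same with the rightmost legs. -/
  | turnVertex_right (v : V) (p q i : ℕ) :
      Move (sl .cap (i + p) * sl (.vertex v (p + 1) q) i) (sl (.vertex v p (q + 1)) i)
  /-- The framed version of the first Reidemeister move: the curls to the right and to the left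
  with the same crossing sign agree. -/
  | reidemeister_one (e : Bool) (i : ℕ) :
      Move (sl .cap (i + 1) * sl (.crossing e) i * sl .cup (i + 1))
        (sl .cap i * sl (.crossing e) (i + 1) * sl .cup i)
  /-- The second Reidemeister move. -/
  | reidemeister_two (e : Bool) (i : ℕ) :
      Move (sl (.crossing e) i * sl (.crossing !e) i) 1
  /-- The third Reidemeister move: a strand passes over or under a crossing. -/
  | reidemeister_three (e f : Bool) (i : ℕ) :
      Move (pass e 2 i * sl (.crossing f) i) (sl (.crossing f) (i + 1) * pass e 2 i)
  /-- A strand passes over or under a vertex. -/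
  | slideVertex (e : Bool) (v : V) (p q i : ℕ) :
      Move (sl (.vertex v p q) (i + 1) * pass e q i) (pass e p i * sl (.vertex v p q) i)

/-- Isotopy of diagrams: the congruence generated by the local moves, performed anywhere inside
a diagram. -/
def isotopy (V : Type) (n : ℕ) : Con (Diagram V n) :=
  conGen fun D E => ∃ u v l r : Word V, Move l r ∧ (D : Word V) = u * l * v ∧
    (E : Word V) = u * r * v

/-- The monoid of diagrams with `n` ends on top and at the bottom, up to isotopy. -/
abbrev IsotopyClass (V : Type) (n : ℕ) : Type := (isotopy V n).Quotient

/-! ### Skein algebras -/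

/-- Formal linear combinations of words in slices. -/
abbrev Formal (V : Type) : Type := MonoidAlgebra Coeff (Word V)

/-- A word as a formal linear combination. -/
def word (w : Word V) : Formal V := MonoidAlgebra.single w 1

open Classical in
/-- A formal linear combination of diagrams with `n` ends on top and `n` at the bottom, seen in
the free module on isotopy classes of diagrams. (It is only used for combinations of words that
are such diagrams; other words are sent to `0`.) -/
def linearize (n : ℕ) (x : Formal V) : MonoidAlgebra Coeff (IsotopyClass V n) :=
  x.coeff.sum fun w c =>
    if h : w ∈ Diagram V n then
      MonoidAlgebra.single (((⟨w, h⟩ : Diagram V n) : IsotopyClass V n)) c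
    else 0

/-- The relation `l = r`, for the pairs `(l, r)` in `rel`, applied inside a disc of a diagram with
`n` ends on top and `n` at the bottom, where `u` is above the disc and `v` is below it. -/
def Locally (rel : Word V → Formal V → Prop) (n : ℕ)
    (x y : MonoidAlgebra Coeff (IsotopyClass V n)) : Prop :=
  ∃ (u v l : Word V) (r : Formal V), rel l r ∧ u * l * v ∈ Diagram V n ∧
    x = linearize n (word (u * l * v)) ∧ y = linearize n (word u * r * word v)

/-- The free module on isotopy classes of diagrams, modulo the skein relations `rel` inside any
disc. As the relations are local, the submodule that they span is a two-sided ideal. -/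
abbrev SkeinAlgebra (rel : Word V → Formal V → Prop) (n : ℕ) : Type :=
  RingQuot (Locally rel n)

/-- The class of a formal linear combination of diagrams in the skein algebra. -/
def skeinClass (rel : Word V → Formal V → Prop) (n : ℕ) (x : Formal V) : SkeinAlgebra rel n :=
  RingQuot.mkAlgHom Coeff (Locally rel n) (linearize n x)

/-- The exponent `1` or `-1` of a crossing. -/
def sgn (e : Bool) : ℤ := if e then 1 else -1

/-- The Kauffman bracket relations for framed tangle diagrams. -/
inductive KauffmanRel : Word Empty → Formal Empty → Prop
  /-- `○ ∪ L = d L`. -/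
  | circle (i : ℕ) : KauffmanRel (sl .cap i * sl .cup i) (d • 1)
  /-- `L = A L₀ + A⁻¹ L_∞`; the second flag gives the same relation, turned by a quarter turn. -/
  | crossing (e : Bool) (i : ℕ) :
      KauffmanRel (sl (.crossing e) i)
        (pA (sgn e) • 1 + pA (-sgn e) • word (sl .cup i * sl .cap i))

/-- The Yamada relations for ribbon graph diagrams. -/
inductive YamadaRel : Word Unit → Formal Unit → Prop
  /-- A crossing is `A ^ 4` times one smoothing, plus `A ^ (-4)` times the other one, minus `d`
  times the four-valent vertex. -/
  | crossing (e : Bool) (i : ℕ) :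
      YamadaRel (sl (.crossing e) i)
        (pA (4 * sgn e) • 1 + pA (-(4 * sgn e)) • word (sl .cup i * sl .cap i)
          - d • word (sl (.vertex () 2 2) i))
  /-- Contraction and deletion of an edge that joins two different vertices: `G` is `G / e` minus
  `d⁻¹` times `G - e`. (The edge is drawn vertically, the other legs of the upper vertex
  are drawn upwards and those of the lower vertex downwards.) -/
  | edge (p q i : ℕ) :
      YamadaRel (sl (.vertex () p 1) i * sl (.vertex () 1 q) i)
        (word (sl (.vertex () p q) i)
          - dInv • word (sl (.vertex () p 0) i * sl (.vertex () 0 q) i))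
  /-- A loop at a vertex that bounds an empty disc is removed with the factor `d - d⁻¹`. -/
  | loop (p i : ℕ) :
      YamadaRel (sl (.vertex () p 2) i * sl .cup i)
        ((d - dInv) • word (sl (.vertex () p 0) i))
  /-- A circle that bounds an empty disc is removed with the factor `d ^ 2 - 1`. -/
  | circle (i : ℕ) : YamadaRel (sl .cap i * sl .cup i) ((d ^ 2 - 1) • 1)
  /-- A two-valent vertex may be erased. -/
  | valency_two (i : ℕ) : YamadaRel (sl (.vertex () 1 1) i) 1
  /-- A diagram with a one-valent vertex is zero. -/
  | valency_one (i : ℕ) : YamadaRel (sl (.vertex () 1 0) i) 0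
  /-- An isolated vertex is removed with the factor `d`. -/
  | valency_zero (i : ℕ) : YamadaRel (sl (.vertex () 0 0) i) (d • 1)

/-- The Temperley–Lieb algebra, as the skein algebra of framed tangle diagrams. -/
abbrev TemperleyLieb (n : ℕ) : Type := SkeinAlgebra KauffmanRel n

/-- The graph algebra: the skein algebra of ribbon graph diagrams. -/
abbrev GraphAlgebra (n : ℕ) : Type := SkeinAlgebra YamadaRel n

/-- The class of a ribbon graph diagram in the graph algebra. -/
def graphClass {n : ℕ} (D : Diagram Unit n) : GraphAlgebra n := skeinClass YamadaRel n (word D)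

/-! ### Cabling -/

/-- The projector `f₁ = 1 - d⁻¹ U₁` on the two strands that replace the ribbon number `j`
of a horizontal line. -/
def proj (j : ℕ) : Formal Empty := 1 - dInv • word (sl .cup (2 * j) * sl .cap (2 * j))

/-- The projector `f₁` on each of the `m` ribbons that meet a horizontal line. -/
def projAll (m : ℕ) : Formal Empty := ((List.range m).map proj).prod

/-- A slice with each strand replaced by two parallel strands (number `i` by `2 i` and `2 i + 1`)
and each vertex by the crossingless diagram in which, around the vertex, the neighbouring strands
of any two consecutive legs are joined. (For a vertex with `p, q ≥ 1` these are `p - 1`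
adjacent `∪` at the top, `q - 1` adjacent `∩` at the bottom, and one strand on each side. If
`p = 0` or `q = 0`, the two side strands are joined there.) -/
def double : Slice Unit → Word Empty
  | ⟨.cap, i⟩ => sl .cap (2 * i) * sl .cap (2 * i + 1)
  | ⟨.cup, i⟩ => sl .cup (2 * i + 1) * sl .cup (2 * i)
  | ⟨.crossing e, i⟩ =>
      sl (.crossing e) (2 * i + 1) * (sl (.crossing e) (2 * i) * sl (.crossing e) (2 * i + 2)) *
        sl (.crossing e) (2 * i + 1)
  | ⟨.vertex _ p q, i⟩ =>
      (if p = 0 then sl .cap (2 * i) else sl .cup (2 * i + 1) ^ (p - 1)) *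
        (if q = 0 then sl .cup (2 * i) else sl .cap (2 * i + 1) ^ (q - 1))

/-- The cabling of a list of slices with `m` strands on top. Each edge, half edge, arc and circle
meets at least one of the horizontal lines that separate the slices (the top and the bottom line
included), and carries a projector at each of them; since `f₁` is idempotent and slides along the
two strands, this is the same as one projector for each edge, half edge, arc and circle. -/
def cable : ℕ → List (Slice Unit) → Formal Empty
  | m, [] => projAll m
  | m, s :: w => projAll m * word (double s) * cable (m - s.piece.top + s.piece.bot) w

/-- The value of the cabling map on a ribbon graph diagram. -/
def cabling {n : ℕ} (D : Diagram Unit n) : TemperleyLieb (2 * n) :=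
  skeinClass KauffmanRel (2 * n) (cable n (D : Word Unit).toList)

end RibbonGraph

end

noncomputable section

/-! ### Strands, crossings and doubled crossings in an algebra of cups and caps. -/

namespace RibbonGraph

/-! ### Cups and caps in an algebra -/

section CupCap

variable {R A : Type*} [CommRing R] [Ring A] [Algebra R A] {δ : R}

/-! Cabling is well defined because each defining relation of the graph algebra is an identity of
Temperley–Lieb calculus. Expanding the projector on an edge is contraction–deletion (`vtx_edge`);
the projector kills a cup, so one-valent vertices vanish; resolving the four crossings of two
doubled strands between projectors gives the Yamada crossing relation (`crs_eq`). Once this relation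
is known, the moves in which a crossing is turned, curled or passed over reduce to statements about
cups, caps and vertices. A ribbon slides past a vertex because its strands slide past every cup and
cap of the doubled vertex (`p_mul_vtx_mul_cpass`).

These identities are proved in any algebra with caps `c i` and cups `u i` at all positions
(`CupCap`). The Temperley–Lieb algebra embeds into such an algebra, that of tangles with infinitely
many strands on the right (`exists_stableHom`): two extra strands can be closed up to a circle,
whose value `d` is invertible. Hence the identities hold in the Temperley–Lieb algebra, and cabling
descends to the quotient (`exists_cablingHom`).

Injectivity comes from a second `CupCap`. A bare pair of strands is `f₁ + d⁻¹ U₁`: an edge plus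
`d⁻¹` times a deleted edge. So a Temperley–Lieb diagram, read as the planar graph formed by one
colour class of its regions, should act by a sum over all ways to keep or delete its fat strands,
with weight `d⁻¹` for each deletion. Such sums act on functions from colourings of the strands to
local classes of graphs (`fatLin`). Contraction–deletion shows that these operators compose like fat
vertices (`fatVertices`), and fat vertices supply cups and caps (`FatVertices.cupCap`). In this
representation the projector on a ribbon restricts to the colourings that keep its strand
(`p_apply`). A cabled graph, evaluated at the colouring that keeps exactly the first `n` strands,
therefore acts as left multiplication by the class of the graph (`pp_mul_ribbon_firstTrue`), and the
graph is recovered from its cabling. -/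

theorem mul_reassoc {a b c : A} (h : a * b = c) (z : A) : a * (b * z) = c * z := by
  rw [← mul_assoc, h]

theorem mul_reassoc₂ {a b c e : A} (h : a * (b * c) = e) (z : A) : a * (b * (c * z)) = e * z := by
  rw [← h]; simp only [mul_assoc]

/-- The weights `a`, `b` of the two smoothings of a crossing, and the value `δ` of a circle. -/
structure KauffmanWeights (a b δ : R) : Prop where
  mul : a * b = 1
  loop : δ = -a ^ 2 - b ^ 2

theorem KauffmanWeights.symm {a b δ : R} (h : KauffmanWeights a b δ) : KauffmanWeights b a δ :=
  ⟨by rw [mul_comm, h.mul], by rw [h.loop]; ring⟩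

variable (A δ) in
/-- Cups and caps at all positions of a line with infinitely many strands to the right, subject to
planar isotopy and to the value `δ` of a circle. -/
structure CupCap where
  c : ℕ → A
  u : ℕ → A
  c_succ_u (i : ℕ) : c (i + 1) * u i = 1
  c_u_succ (i : ℕ) : c i * u (i + 1) = 1
  c_u (i : ℕ) : c i * u i = δ • 1
  c_c (i k : ℕ) : c i * c (i + 2 + k) = c (i + k) * c i
  c_u_far (i k : ℕ) : c i * u (i + 2 + k) = u (i + k) * c i
  u_c_far (i k : ℕ) : u i * c (i + k) = c (i + 2 + k) * u i
  u_u (i k : ℕ) : u i * u (i + k) = u (i + 2 + k) * u i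

namespace CupCap

variable (t : CupCap A δ)

/-- `z` has `m` strands on top and `n` strands at the bottom, so that whatever is to the right of
it may be moved past it. -/
def Slides (z : A) (m n : ℕ) : Prop :=
  ∀ k, SemiconjBy z (t.c (n + k)) (t.c (m + k)) ∧ SemiconjBy z (t.u (n + k)) (t.u (m + k))

variable {t}

namespace Slides

variable {z w : A} {m n l : ℕ}

theorem c (h : t.Slides z m n) {x y : ℕ} (k : ℕ) (hx : x = n + k) (hy : y = m + k) :
    SemiconjBy z (t.c x) (t.c y) := by
  subst hx hy; exact (h k).1

theorem u (h : t.Slides z m n) {x y : ℕ} (k : ℕ) (hx : x = n + k) (hy : y = m + k) :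
    SemiconjBy z (t.u x) (t.u y) := by
  subst hx hy; exact (h k).2

theorem one : t.Slides 1 m m := fun _ => ⟨SemiconjBy.one_left _, SemiconjBy.one_left _⟩

theorem mul (h : t.Slides z m n) (h' : t.Slides w n l) : t.Slides (z * w) m l :=
  fun k => ⟨(h k).1.mul_left (h' k).1, (h k).2.mul_left (h' k).2⟩

theorem smul (h : t.Slides z m n) (r : R) : t.Slides (r • z) m n := fun k =>
  ⟨by have := (h k).1; simp only [SemiconjBy, smul_mul_assoc, mul_smul_comm] at *; rw [this],
   by have := (h k).2; simp only [SemiconjBy, smul_mul_assoc, mul_smul_comm] at *; rw [this]⟩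

theorem add (h : t.Slides z m n) (h' : t.Slides w m n) : t.Slides (z + w) m n :=
  fun k => ⟨(h k).1.add_left (h' k).1, (h k).2.add_left (h' k).2⟩

theorem sub (h : t.Slides z m n) (h' : t.Slides w m n) : t.Slides (z - w) m n :=
  fun k => ⟨(h k).1.sub_left (h' k).1, (h k).2.sub_left (h' k).2⟩

theorem widen (h : t.Slides z m n) {m' n' : ℕ} (k : ℕ) (hm : m' = m + k) (hn : n' = n + k) :
    t.Slides z m' n' := by
  subst hm hn
  intro l
  rw [add_assoc, add_assoc]
  exact h (k + l)

end Slides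

theorem SemiconjBy.smul_right' {z x y : A} (h : SemiconjBy z x y) (r : R) :
    SemiconjBy z (r • x) (r • y) := by
  simp only [SemiconjBy, smul_mul_assoc, mul_smul_comm] at *; rw [h]

variable (t)

theorem slides_c (i : ℕ) : t.Slides (t.c i) i (i + 2) := fun k => ⟨t.c_c i k, t.c_u_far i k⟩

theorem slides_u (i : ℕ) : t.Slides (t.u i) (i + 2) i := fun k => ⟨t.u_c_far i k, t.u_u i k⟩

theorem slides_uc (i : ℕ) : t.Slides (t.u i * t.c i) (i + 2) (i + 2) :=
  (t.slides_u i).mul (t.slides_c i)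

/-! #### Crossings -/

/-- The crossing with the smoothings weighted by `a` and `b`. -/
def x (a b : R) (i : ℕ) : A := a • 1 + b • (t.u i * t.c i)

theorem slides_x (a b : R) (i : ℕ) : t.Slides (t.x a b i) (i + 2) (i + 2) :=
  (Slides.one.smul a).add ((t.slides_uc i).smul b)

variable {t} in
theorem Slides.x {z : A} {m n : ℕ} (h : t.Slides z m n) (a b : R) {x y : ℕ} (k : ℕ)
    (hx : x = n + k) (hy : y = m + k) : SemiconjBy z (t.x a b x) (t.x a b y) :=
  (SemiconjBy.smul_right' (SemiconjBy.one_right z) a).add_right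
    (SemiconjBy.smul_right' ((h.u k hx hy).mul_right (h.c k hx hy)) b)

variable {a b : R}

/-- The coefficient of the cup–cap term is `a² + b² + a b δ`, which vanishes because `a b = 1` and
`δ = -a² - b²`. -/
theorem x_mul_x (hw : KauffmanWeights a b δ) (i : ℕ) : t.x a b i * t.x b a i = 1 := by
  have h : t.u i * t.c i * (t.u i * t.c i) = δ • (t.u i * t.c i) := by
    rw [mul_assoc, mul_reassoc (t.c_u i)]; simp
  simp only [x, add_mul, mul_add, smul_mul_smul_comm, h, one_mul, mul_one, smul_smul]
  match_scalars
  · linear_combination hw.mul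
  · linear_combination b * a * hw.loop + (-a ^ 2 - b ^ 2) * hw.mul

/-- A strand slides past a cap. The same cancellation of `a² + b² + a b δ` occurs in this lemma and
in its three variants; all later slides of doubled strands are built from these four. -/
theorem c_succ_x_x (hw : KauffmanWeights a b δ) (i : ℕ) :
    t.c (i + 1) * (t.x a b i * t.x a b (i + 1)) = t.c i := by
  simp only [x, add_mul, mul_add, mul_smul_comm, one_mul, mul_one, mul_assoc,
    mul_reassoc (t.c_u _), mul_reassoc (t.c_succ_u _), mul_reassoc (t.c_u_succ _), smul_mul_assoc,
    smul_smul]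
  match_scalars
  · linear_combination a * b * hw.loop + (-a ^ 2 - b ^ 2) * hw.mul
  · linear_combination hw.mul

theorem c_x_succ_x (hw : KauffmanWeights a b δ) (i : ℕ) :
    t.c i * (t.x a b (i + 1) * t.x a b i) = t.c (i + 1) := by
  simp only [x, add_mul, mul_add, mul_smul_comm, one_mul, mul_one, mul_assoc,
    mul_reassoc (t.c_u _), mul_reassoc (t.c_succ_u _), mul_reassoc (t.c_u_succ _), smul_mul_assoc,
    smul_smul]
  match_scalars
  · linear_combination a * b * hw.loop + (-a ^ 2 - b ^ 2) * hw.mul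
  · linear_combination hw.mul

theorem x_x_succ_u (hw : KauffmanWeights a b δ) (i : ℕ) :
    t.x a b i * (t.x a b (i + 1) * t.u i) = t.u (i + 1) := by
  simp only [x, add_mul, mul_add, mul_smul_comm, one_mul, mul_one, mul_assoc,
    t.c_u, t.c_succ_u, t.c_u_succ, smul_mul_assoc,
    smul_smul]
  match_scalars
  · linear_combination a * b * hw.loop + (-a ^ 2 - b ^ 2) * hw.mul
  · linear_combination hw.mul

theorem x_succ_x_u (hw : KauffmanWeights a b δ) (i : ℕ) :
    t.x a b (i + 1) * (t.x a b i * t.u (i + 1)) = t.u i := by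
  simp only [x, add_mul, mul_add, mul_smul_comm, one_mul, mul_one, mul_assoc,
    t.c_u, t.c_succ_u, t.c_u_succ, smul_mul_assoc,
    smul_smul]
  match_scalars
  · linear_combination a * b * hw.loop + (-a ^ 2 - b ^ 2) * hw.mul
  · linear_combination hw.mul

/-! #### The crossing of two pairs of parallel strands -/

/-- The pair of strands at `j`, `j + 1` crosses the pair at `j + 2`, `j + 3`. -/
def xx (a b : R) (j : ℕ) : A :=
  t.x a b (j + 1) * (t.x a b j * t.x a b (j + 2)) * t.x a b (j + 1)

theorem slides_xx (a b : R) (j : ℕ) : t.Slides (t.xx a b j) (j + 4) (j + 4) :=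
  ((((t.slides_x a b (j + 1)).widen 1 rfl rfl).mul
    (((t.slides_x a b j).widen 2 rfl rfl).mul (t.slides_x a b (j + 2)))).mul
      ((t.slides_x a b (j + 1)).widen 1 rfl rfl))

variable {t} in
theorem Slides.xx {z : A} {m n : ℕ} (h : t.Slides z m n) (a b : R) {x y : ℕ} (k : ℕ)
    (hx : x = n + k) (hy : y = m + k) : SemiconjBy z (t.xx a b x) (t.xx a b y) :=
  ((h.x a b (k + 1) (by omega) (by omega)).mul_right
    ((h.x a b k hx hy).mul_right (h.x a b (k + 2) (by omega) (by omega)))).mul_right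
      (h.x a b (k + 1) (by omega) (by omega))

theorem x_comm (a b a' b' : R) {i j : ℕ} (h : i + 2 ≤ j) :
    t.x a b i * t.x a' b' j = t.x a' b' j * t.x a b i :=
  ((t.slides_x a b i).x a' b' (j - (i + 2)) (by omega) (by omega)).eq

theorem xx_mul_xx (hw : KauffmanWeights a b δ) (j : ℕ) : t.xx a b j * t.xx b a j = 1 := by
  have h := t.x_mul_x hw
  simp only [xx, mul_assoc]
  rw [mul_reassoc (h _), one_mul, mul_reassoc (t.x_comm b a b a (le_refl (j + 2))), mul_assoc,
    mul_reassoc (h _), one_mul, mul_reassoc (h _), one_mul, h]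

theorem c_add_two_xx (hw : KauffmanWeights a b δ) (j : ℕ) : t.c (j + 2) * t.xx a b j = t.c j := by
  simp only [xx, mul_assoc]
  rw [mul_reassoc (t.x_comm a b a b (le_refl (j + 2))), mul_assoc, ← mul_assoc (t.x a b (j + 1)),
    mul_reassoc (t.c_succ_x_x hw (j + 1)), t.c_succ_x_x hw]

theorem c_xx (hw : KauffmanWeights a b δ) (j : ℕ) : t.c j * t.xx a b j = t.c (j + 2) := by
  simp only [xx, mul_assoc]
  rw [← mul_assoc (t.x a b (j + 1)),
    mul_reassoc (t.c_x_succ_x hw j), t.c_x_succ_x hw (j + 1)]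

theorem xx_u (hw : KauffmanWeights a b δ) (j : ℕ) : t.xx a b j * t.u j = t.u (j + 2) := by
  simp only [xx, mul_assoc]
  rw [mul_reassoc (t.x_comm a b a b (le_refl (j + 2))), mul_assoc,
    t.x_x_succ_u hw, t.x_x_succ_u hw (j + 1)]

theorem xx_u_add_two (hw : KauffmanWeights a b δ) (j : ℕ) : t.xx a b j * t.u (j + 2) = t.u j := by
  simp only [xx, mul_assoc]
  rw [t.x_succ_x_u hw (j + 1), t.x_succ_x_u hw]

/-- Commuting distant crossings regroups the eight crossings by strand of the passing pair: each of
the two strands crosses four others in one run. In this form the single-strand slides apply twice.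
-/
theorem xx_eq_pass (a b : R) (j : ℕ) : t.xx a b j * t.xx a b (j + 2) =
    t.x a b (j + 1) * (t.x a b (j + 2) * (t.x a b (j + 3) * (t.x a b (j + 4) *
      (t.x a b j * (t.x a b (j + 1) * (t.x a b (j + 2) * t.x a b (j + 3))))))) := by
  have e1 : t.xx a b j = t.x a b (j + 1) * (t.x a b (j + 2) * (t.x a b j * t.x a b (j + 1))) := by
    simp only [xx, mul_assoc]
    rw [mul_reassoc (t.x_comm a b a b (le_refl (j + 2))), mul_assoc]
  have e2 : t.xx a b (j + 2) =
      t.x a b (j + 3) * (t.x a b (j + 4) * (t.x a b (j + 2) * t.x a b (j + 3))) := by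
    simp only [xx, mul_assoc]
    rw [mul_reassoc (t.x_comm a b a b (le_refl (j + 2 + 2))), mul_assoc]
  have f (i k : ℕ) (h : i + 2 ≤ k) (z : A) :
      t.x a b i * (t.x a b k * z) = t.x a b k * (t.x a b i * z) := by
    rw [mul_reassoc (t.x_comm a b a b h), mul_assoc]
  rw [e1, e2]
  simp only [mul_assoc]
  rw [f (j + 1) (j + 3) (by omega), f j (j + 3) (by omega), f (j + 1) (j + 4) (by omega),
    f j (j + 4) (by omega)]

theorem xx_xx_u (hw : KauffmanWeights a b δ) (j : ℕ) :
    t.xx a b j * t.xx a b (j + 2) * t.u (j + 1) = t.u (j + 3) * t.xx a b j := by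
  have f (i k m : ℕ) (h : i + 2 ≤ k) (hm : m + 2 = k) :
      t.x a b k * t.u i = t.u i * t.x a b m :=
    ((t.slides_u i).x a b (k - (i + 2)) (by omega) (by omega)).eq.symm
  have g (i k : ℕ) (h : i + 2 ≤ k) : t.x a b i * t.u k = t.u k * t.x a b i :=
    ((t.slides_x a b i).u (k - (i + 2)) (by omega) (by omega)).eq
  rw [t.xx_eq_pass]
  simp only [mul_assoc]
  rw [f (j + 1) (j + 3) (j + 1) (by omega) rfl,
    mul_reassoc₂ (t.x_x_succ_u hw (j + 1)), mul_reassoc (g j (j + 2) le_rfl), mul_assoc,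
    mul_reassoc (f (j + 2) (j + 4) (j + 2) (by omega) rfl), mul_assoc,
    mul_reassoc₂ (t.x_x_succ_u hw (j + 2)), mul_reassoc (g (j + 1) (j + 3) le_rfl),
    mul_assoc, xx, mul_assoc, mul_assoc, mul_reassoc (t.x_comm a b a b (le_refl (j + 2))),
    mul_assoc]

theorem c_xx_xx (hw : KauffmanWeights a b δ) (j : ℕ) :
    t.c (j + 3) * (t.xx a b j * t.xx a b (j + 2)) = t.xx a b j * t.c (j + 1) := by
  have f (i k m : ℕ) (h : i + 2 ≤ k) (hm : m + 2 = k) :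
      t.c i * t.x a b k = t.x a b m * t.c i :=
    ((t.slides_c i).x a b (k - (i + 2)) (by omega) (by omega)).eq
  have g (i k : ℕ) (h : i + 2 ≤ k) : t.c k * t.x a b i = t.x a b i * t.c k :=
    ((t.slides_x a b i).c (k - (i + 2)) (by omega) (by omega)).eq.symm
  rw [t.xx_eq_pass]
  rw [mul_reassoc (g (j + 1) (j + 3) le_rfl), mul_assoc,
    mul_reassoc₂ (t.c_succ_x_x hw (j + 2)),
    mul_reassoc (f (j + 2) (j + 4) (j + 2) le_rfl rfl), mul_assoc,
    mul_reassoc (g j (j + 2) le_rfl), mul_assoc,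
    mul_reassoc₂ (t.c_succ_x_x hw (j + 1)), f (j + 1) (j + 3) (j + 1) le_rfl rfl]
  simp only [xx, mul_assoc]
  rw [mul_reassoc (t.x_comm a b a b (le_refl (j + 2))), mul_assoc]

end CupCap
end CupCap
end RibbonGraph

/-! ### Projectors, doubled vertices and the Yamada relations. -/

namespace RibbonGraph

section CupCap

variable {R A : Type*} [CommRing R] [Ring A] [Algebra R A] {δ : R}

namespace CupCap

variable (t : CupCap A δ) (ε : R)

/-! #### Projectors -/

/-- The projector on the two strands that replace the ribbon number `i`. -/
def p (i : ℕ) : A := 1 - ε • (t.u (2 * i) * t.c (2 * i))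

/-- The projectors on the `k` ribbons that start at number `i`. -/
def pp (i : ℕ) : ℕ → A
  | 0 => 1
  | k + 1 => pp i k * t.p ε (i + k)

theorem slides_p (i : ℕ) : t.Slides (t.p ε i) (2 * i + 2) (2 * i + 2) :=
  Slides.one.sub ((t.slides_uc _).smul ε)

variable {t} in
theorem Slides.p {z : A} {m n : ℕ} (h : t.Slides z m n) {x y : ℕ} (k : ℕ)
    (hx : 2 * x = n + k) (hy : 2 * y = m + k) : SemiconjBy z (t.p ε x) (t.p ε y) :=
  (SemiconjBy.one_right z).sub_right
    (SemiconjBy.smul_right' ((h.u k hx hy).mul_right (h.c k hx hy)) ε)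

variable {t} in
theorem Slides.pp {z : A} {m n : ℕ} (h : t.Slides z m n) {x y : ℕ} (k : ℕ)
    (hx : 2 * x = n + k) (hy : 2 * y = m + k) (l : ℕ) :
    SemiconjBy z (t.pp ε x l) (t.pp ε y l) := by
  induction l with
  | zero => exact SemiconjBy.one_right z
  | succ l ih => exact ih.mul_right (h.p ε (k + 2 * l) (by omega) (by omega))

theorem p_comm (i j : ℕ) : Commute (t.p ε i) (t.p ε j) := by
  rcases lt_trichotomy i j with h | h | h
  · exact (t.slides_p ε i).p ε (2 * (j - (i + 1))) (by omega) (by omega)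
  · rw [h]
  · exact ((t.slides_p ε j).p ε (2 * (i - (j + 1))) (by omega) (by omega)).symm

theorem p_comm_pp (i j k : ℕ) : Commute (t.p ε i) (t.pp ε j k) := by
  induction k with
  | zero => exact Commute.one_right _
  | succ k ih => exact ih.mul_right (t.p_comm ε _ _)

theorem pp_comm (i k j l : ℕ) : Commute (t.pp ε i k) (t.pp ε j l) := by
  induction k with
  | zero => exact Commute.one_left _
  | succ k ih => exact ih.mul_left (t.p_comm_pp ε _ _ _)

@[simp] theorem pp_zero (i : ℕ) : t.pp ε i 0 = 1 := rfl

theorem pp_succ (i k : ℕ) : t.pp ε i (k + 1) = t.pp ε i k * t.p ε (i + k) := rfl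

@[simp] theorem pp_one (i : ℕ) : t.pp ε i 1 = t.p ε i := one_mul _

theorem pp_two (i : ℕ) : t.pp ε i 2 = t.p ε i * t.p ε (i + 1) := by
  rw [pp_succ, pp_one]

theorem pp_add (i k l : ℕ) : t.pp ε i (k + l) = t.pp ε i k * t.pp ε (i + k) l := by
  induction l with
  | zero => simp
  | succ l ih => rw [← add_assoc, pp_succ, ih, pp_succ, mul_assoc, add_assoc]

theorem pp_succ' (i k : ℕ) : t.pp ε i (k + 1) = t.p ε i * t.pp ε (i + 1) k := by
  rw [add_comm, pp_add, pp_one]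

theorem slides_pp (i k : ℕ) : t.Slides (t.pp ε i k) (2 * (i + k)) (2 * (i + k)) := by
  induction k with
  | zero => exact Slides.one
  | succ k ih => exact 
      (Slides.widen ih (m' := 2 * (i + (k + 1))) (n' := 2 * (i + (k + 1))) 2 (by omega)
        (by omega)).mul ((t.slides_p ε (i + k)).widen 0 (by omega) (by omega))

section Idempotent

variable {t ε}

/-- The coefficient is `1 - ε δ`. This is the source of the vanishing of one-valent vertices, and it
makes a crossing of the two strands of one ribbon a scalar next to a projector. -/
theorem p_u (hε : ε * δ = 1) (i : ℕ) : t.p ε i * t.u (2 * i) = 0 := by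
  rw [p, sub_mul, one_mul, smul_mul_assoc, mul_assoc, t.c_u, mul_smul_comm, mul_one, smul_smul, hε,
    one_smul, sub_self]

theorem c_p (hε : ε * δ = 1) (i : ℕ) : t.c (2 * i) * t.p ε i = 0 := by
  rw [p, mul_sub, mul_one, mul_smul_comm, ← mul_assoc, t.c_u, smul_mul_assoc, one_mul, smul_smul,
    hε,
    one_smul, sub_self]

theorem p_mul_p (hε : ε * δ = 1) (i : ℕ) : t.p ε i * t.p ε i = t.p ε i := by
  conv_lhs => rw [p.eq_1 t ε i, sub_mul, one_mul, smul_mul_assoc, mul_assoc]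
  rw [← p, c_p hε, mul_zero, smul_zero, sub_zero]

theorem pp_mul_pp (hε : ε * δ = 1) (i k : ℕ) : t.pp ε i k * t.pp ε i k = t.pp ε i k := by
  induction k with
  | zero => simp
  | succ k ih =>
    rw [pp_succ, mul_assoc, ← mul_assoc (t.p ε _), (t.p_comm_pp ε (i + k) i k).eq,
      mul_assoc (t.pp ε i k) (t.p ε _), p_mul_p hε, ← mul_assoc, ih]

theorem pp_mul_p (hε : ε * δ = 1) {i k m : ℕ} (h : i ≤ m) (h' : m < i + k) :
    t.pp ε i k * t.p ε m = t.pp ε i k := by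
  obtain ⟨l, rfl⟩ := Nat.exists_eq_add_of_le h
  obtain ⟨r, rfl⟩ := Nat.exists_eq_add_of_lt (Nat.lt_of_add_lt_add_left h')
  rw [add_assoc, pp_add, pp_succ', mul_assoc, mul_assoc, (t.p_comm_pp ε _ _ _).symm.eq,
    mul_reassoc (p_mul_p hε _)]

theorem pp_mul_pp_of_le (hε : ε * δ = 1) {i k j l : ℕ} (h : i ≤ j) (h' : j + l ≤ i + k) :
    t.pp ε i k * t.pp ε j l = t.pp ε i k := by
  induction l with
  | zero => simp
  | succ l ih => rw [pp_succ, ← mul_assoc, ih (by omega), pp_mul_p hε (by omega) (by omega)]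

theorem pp_mul_pp_of_ge (hε : ε * δ = 1) {i k j l : ℕ} (h : i ≤ j) (h' : j + l ≤ i + k) :
    t.pp ε j l * t.pp ε i k = t.pp ε i k := by
  rw [(t.pp_comm ε _ _ _ _).eq, pp_mul_pp_of_le hε h h']

end Idempotent

/-! #### Doubled vertices -/

/-- The upper half of a doubled vertex with `k` upper legs; two strands leave it downwards. -/
def upper (j : ℕ) : ℕ → A
  | 0 => t.c j
  | k + 1 => upper j k * t.u (j + 1)

/-- The lower half of a doubled vertex with `k` lower legs; two strands leave it upwards. -/
def lower (j : ℕ) : ℕ → A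
  | 0 => t.u j
  | k + 1 => t.c (j + 1) * lower j k

theorem upper_zero (j : ℕ) : t.upper j 0 = t.c j := rfl
theorem upper_succ (j k : ℕ) : t.upper j (k + 1) = t.upper j k * t.u (j + 1) := rfl
theorem lower_zero (j : ℕ) : t.lower j 0 = t.u j := rfl
theorem lower_succ (j k : ℕ) : t.lower j (k + 1) = t.c (j + 1) * t.lower j k := rfl

@[simp] theorem upper_one (j : ℕ) : t.upper j 1 = 1 := t.c_u_succ j
@[simp] theorem lower_one (j : ℕ) : t.lower j 1 = 1 := t.c_succ_u j
@[simp] theorem upper_two (j : ℕ) : t.upper j 2 = t.u (j + 1) := by rw [upper_succ]; simp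
@[simp] theorem lower_two (j : ℕ) : t.lower j 2 = t.c (j + 1) := by rw [lower_succ]; simp

theorem slides_upper (j k : ℕ) : t.Slides (t.upper j k) (j + 2 * k) (j + 2) := by
  induction k with
  | zero => exact t.slides_c j
  | succ k ih => exact (ih.widen 2 (by omega) rfl).mul ((t.slides_u (j + 1)).widen 1 rfl rfl)

theorem slides_lower (j k : ℕ) : t.Slides (t.lower j k) (j + 2) (j + 2 * k) := by
  induction k with
  | zero => exact t.slides_u j
  | succ k ih => exact ((t.slides_c (j + 1)).widen 1 rfl rfl).mul (ih.widen 2 rfl (by omega))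

variable {t} in
theorem Slides.upper {z : A} {m n : ℕ} (h : t.Slides z m n) {x y : ℕ} (k : ℕ)
    (hx : x = n + k) (hy : y = m + k) (l : ℕ) :
    SemiconjBy z (t.upper x l) (t.upper y l) := by
  induction l with
  | zero => exact h.c k hx hy
  | succ l ih => exact ih.mul_right (h.u (k + 1) (by omega) (by omega))

variable {t} in
theorem Slides.lower {z : A} {m n : ℕ} (h : t.Slides z m n) {x y : ℕ} (k : ℕ)
    (hx : x = n + k) (hy : y = m + k) (l : ℕ) :
    SemiconjBy z (t.lower x l) (t.lower y l) := by
  induction l with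
  | zero => exact h.u k hx hy
  | succ l ih => exact (h.c (k + 1) (by omega) (by omega)).mul_right ih

/-- The doubled vertex. -/
def dv (j k l : ℕ) : A := t.upper j k * t.lower j l

theorem slides_dv (j k l : ℕ) : t.Slides (t.dv j k l) (j + 2 * k) (j + 2 * l) :=
  (t.slides_upper j k).mul (t.slides_lower j l)

variable {t} in
theorem Slides.dv {z : A} {m n : ℕ} (h : t.Slides z m n) {x y : ℕ} (k : ℕ)
    (hx : x = n + k) (hy : y = m + k) (a b : ℕ) :
    SemiconjBy z (t.dv x a b) (t.dv y a b) :=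
  (h.upper k hx hy a).mul_right (h.lower k hx hy b)

theorem c_lower_add_two (j l : ℕ) : t.c (j + 1) * t.lower (j + 2) l = t.lower j (l + 1) := by
  induction l with
  | zero => rw [lower_zero, t.c_u_succ, lower_one]
  | succ l ih =>
    rw [lower_succ, ← mul_assoc, t.c_c (j + 1) 0, mul_assoc, add_zero, ih]; rfl

theorem c_c_upper (j k : ℕ) :
    t.c j * t.c (j + 1) * t.upper (j + 2) (k + 1) = t.upper j k * t.c (j + 1) := by
  induction k with
  | zero => rw [upper_one, mul_one, upper_zero]
  | succ k ih =>
    rw [upper_succ, ← mul_assoc, ih, mul_assoc, t.c_u_far (j + 1) 0, ← mul_assoc]; rfl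

theorem c_c_dv_left (j k l : ℕ) :
    t.c j * t.c (j + 1) * t.dv (j + 2) (k + 1) l = t.dv j k (l + 1) := by
  rw [dv, ← mul_assoc, c_c_upper, mul_assoc, c_lower_add_two]; rfl

theorem c_c_dv_right (j k l : ℕ) :
    t.c (j + 2 * k) * t.c (j + 2 * k + 1) * t.dv j (k + 1) l = t.dv j k (l + 1) := by
  have h := t.slides_upper j k
  rw [dv, upper_succ, mul_assoc, mul_assoc, ← mul_assoc _ (t.upper j k),
    ← (h.c 1 rfl rfl).eq, mul_assoc (t.upper j k), ← mul_assoc _ (t.u (j + 1)),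
    ← t.u_c_far (j + 1) 0, ← mul_assoc, ← (h.c 0 rfl (add_zero _).symm).eq, mul_assoc, mul_assoc,
      add_zero,
    add_zero, mul_reassoc (t.c_succ_u (j + 1)), one_mul]
  rfl

/-! #### Vertices with projectors -/

/-- The doubled vertex with projectors on all legs. -/
def vtx (i k l : ℕ) : A := t.pp ε i k * t.dv (2 * i) k l * t.pp ε i l

theorem slides_vtx (i k l : ℕ) : t.Slides (t.vtx ε i k l) (2 * (i + k)) (2 * (i + l)) :=
  ((t.slides_pp ε i k).mul ((t.slides_dv _ k l).widen 0 (by omega) rfl)).mul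
    ((t.slides_pp ε i l).widen 0 (by omega) (by omega))

variable {t} in
theorem Slides.vtx {z : A} {m n : ℕ} (h : t.Slides z m n) {x y : ℕ} (k : ℕ)
    (hx : 2 * x = n + k) (hy : 2 * y = m + k) (a b : ℕ) :
    SemiconjBy z (t.vtx ε x a b) (t.vtx ε y a b) :=
  ((h.pp ε k hx hy a).mul_right (h.dv k hx hy a b)).mul_right (h.pp ε k hx hy b)

theorem p_comm_vtx {i j : ℕ} (h : i < j) (k l : ℕ) : Commute (t.p ε i) (t.vtx ε j k l) :=
  (t.slides_p ε i).vtx ε (2 * (j - (i + 1))) (by omega) (by omega) k l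

section Relations

variable {t ε}

/-- The projector slides along the doubled arc: on either leg, its second term cuts the nested caps
into the same two caps side by side. -/
theorem c_c_p (j : ℕ) :
    t.c (2 * j) * t.c (2 * j + 1) * t.p ε (j + 1) = t.c (2 * j) * t.c (2 * j + 1) * t.p ε j := by
  have h : t.c (2 * j) * t.c (2 * j + 2) = t.c (2 * j) * t.c (2 * j) := t.c_c (2 * j) 0
  simp only [p, mul_sub, mul_one, mul_smul_comm, mul_assoc]
  rw [mul_reassoc (t.c_succ_u (2 * j)), mul_add, mul_reassoc (t.c_u_succ (2 * j + 1)), one_mul,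
    one_mul, mul_one, h]

theorem p_u_u (j : ℕ) :
    t.p ε (j + 1) * (t.u (2 * j + 1) * t.u (2 * j)) =
      t.p ε j * (t.u (2 * j + 1) * t.u (2 * j)) := by
  have h : t.u (2 * j) * t.u (2 * j) = t.u (2 * j + 2) * t.u (2 * j) := t.u_u (2 * j) 0
  simp only [p, sub_mul, one_mul, smul_mul_assoc, mul_assoc]
  rw [mul_reassoc (t.c_u_succ (2 * j)), mul_add, mul_reassoc (t.c_succ_u (2 * j + 1)), one_mul,
    mul_one, h]

theorem vtx_zero_two (hε : ε * δ = 1) (i : ℕ) :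
    t.vtx ε i 0 2 = t.c (2 * i) * t.c (2 * i + 1) * t.p ε i := by
  rw [vtx, dv, lower_two, upper_zero, pp_zero, one_mul, pp_two, (t.p_comm ε _ _).eq, ← mul_assoc,
    c_c_p, mul_assoc, p_mul_p hε]

theorem vtx_zero_two' (hε : ε * δ = 1) (i : ℕ) :
    t.vtx ε i 0 2 = t.c (2 * i) * t.c (2 * i + 1) * t.p ε (i + 1) := by
  rw [vtx_zero_two hε, c_c_p]

/-- The projector on the leg that is bent slides around the doubled cap and becomes the projector on
the new lower leg; for the bare diagrams this is `c_c_dv_left`. -/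
theorem vtx_turn_left (hε : ε * δ = 1) (i k l : ℕ) :
    t.vtx ε i 0 2 * t.vtx ε (i + 1) (k + 1) l = t.vtx ε i k (l + 1) := by
  have hc : t.Slides (t.c (2 * i) * t.c (2 * i + 1)) (2 * i) (2 * i + 4) :=
    (t.slides_c (2 * i)).mul ((t.slides_c (2 * i + 1)).widen 1 rfl rfl)
  have hp : t.c (2 * i) * t.c (2 * i + 1) * t.p ε i * t.pp ε (i + 1) (k + 1) =
      t.pp ε i k * (t.c (2 * i) * t.c (2 * i + 1)) * t.p ε i := by
    rw [pp_succ', ← mul_assoc, mul_assoc _ (t.p ε i), (t.p_comm ε _ _).eq,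
      ← mul_assoc _ _ (t.p ε i),
      c_c_p, mul_assoc _ _ (t.p ε i), p_mul_p hε, mul_assoc, (t.p_comm_pp ε _ _ _).eq, ← mul_assoc,
      (hc.pp ε (y := i) 0 (by omega) (by omega) k).eq]
  have hd := (t.slides_p ε i).dv (x := 2 * i + 2) (y := 2 * i + 2) 0 rfl rfl (k + 1) l
  rw [vtx_zero_two hε, vtx, vtx, ← mul_assoc, ← mul_assoc, hp, mul_assoc _ (t.p ε i), mul_add,
    hd.eq,
    mul_assoc, mul_assoc, mul_assoc (t.dv _ _ _), ← pp_succ', ← mul_assoc, mul_assoc (t.pp ε i k),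
      mul_assoc (t.pp ε i k), ← mul_assoc (_ * _) (t.dv _ _ _),
    c_c_dv_left]

theorem vtx_turn_right (hε : ε * δ = 1) (i k l : ℕ) :
    t.vtx ε (i + k) 0 2 * t.vtx ε i (k + 1) l = t.vtx ε i k (l + 1) := by
  have hk := t.slides_pp ε i k
  have hc : t.c (2 * (i + k)) * t.c (2 * (i + k) + 1) * t.p ε (i + k + 1) *
      t.pp ε i (k + 1) = t.pp ε i k * (t.c (2 * (i + k)) * t.c (2 * (i + k) + 1)) *
        t.p ε (i + k + 1) := by
    rw [pp_succ, mul_assoc, ((t.p_comm_pp ε _ _ _).mul_right (t.p_comm ε _ _)).eq,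
      (t.p_comm_pp ε _ _ _).symm.eq, ← mul_assoc, ← mul_assoc, ← c_c_p, mul_assoc _ (t.p ε _),
      (t.p_comm_pp ε _ _ _).eq, ← mul_assoc,
      ← ((hk.c (x := 2 * (i + k)) (y := 2 * (i + k)) 0 rfl rfl).mul_right
        (hk.c (x := 2 * (i + k) + 1) 1 rfl rfl)).eq, mul_assoc _ (t.p ε _), p_mul_p hε]
  have hd := (t.slides_dv (2 * i) (k + 1) l).p ε (x := i + l) (y := i + k + 1) 0
    (by omega) (by omega)
  rw [vtx_zero_two' hε, vtx, vtx, ← mul_assoc, ← mul_assoc, hc, mul_assoc _ (t.p ε (i + k + 1)),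
    ← hd.eq, mul_assoc, mul_assoc, mul_assoc (t.dv _ _ _), (t.p_comm_pp ε _ _ _).eq, ← pp_succ,
      ← mul_assoc,
    mul_assoc (t.pp ε i k), mul_add, mul_assoc (t.pp ε i k),
    ← mul_assoc (_ * _) (t.dv _ _ _), c_c_dv_right]

@[simp] theorem vtx_one_one (hε : ε * δ = 1) (i : ℕ) : t.vtx ε i 1 1 = t.p ε i := by
  simp [vtx, dv, p_mul_p hε]

theorem vtx_one_zero (hε : ε * δ = 1) (i : ℕ) : t.vtx ε i 1 0 = 0 := by
  simp [vtx, dv, lower_zero, p_u hε]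

theorem vtx_zero_zero (i : ℕ) : t.vtx ε i 0 0 = δ • 1 := by
  simp [vtx, dv, lower_zero, upper_zero, t.c_u]

/-- The two projectors on the loop slide together and merge into one. Its term `1` closes off a
circle, worth `δ`; its cup–cap term straightens out and contributes `-ε`. -/
theorem vtx_loop (hε : ε * δ = 1) (i k : ℕ) :
    t.vtx ε i k 2 * t.vtx ε i 2 0 = (δ - ε) • t.vtx ε i k 0 := by
  have h : t.c (2 * i + 1) * (t.pp ε i 2 * (t.u (2 * i + 1) * t.u (2 * i))) =
      (δ - ε) • t.u (2 * i) := by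
    rw [pp_two, mul_assoc, p_u_u, mul_reassoc (p_mul_p hε i), p, sub_mul, mul_sub, one_mul,
      mul_reassoc (t.c_u _), smul_mul_assoc, smul_mul_assoc, mul_smul_comm, mul_assoc,
      mul_reassoc (t.c_u_succ _), one_mul, mul_reassoc (t.c_succ_u _), sub_smul, one_mul]
  have hp := pp_mul_pp (t := t) hε i 2
  rw [vtx, vtx, dv, dv, lower_two, upper_two, lower_zero, pp_zero, mul_one, vtx, pp_zero, mul_one,
    mul_assoc, mul_reassoc hp, mul_assoc, mul_assoc, h, dv, lower_zero,
    mul_smul_comm, mul_smul_comm]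

/-- Contraction–deletion is the expansion of the projector on the connecting edge: `1` merges the
two doubled vertices and the cup–cap term separates them. -/
theorem vtx_edge (hε : ε * δ = 1) (i k l : ℕ) :
    t.vtx ε i k 1 * t.vtx ε i 1 l = t.vtx ε i k l - ε • (t.vtx ε i k 0 * t.vtx ε i 0 l) := by
  simp only [vtx, dv, lower_one, upper_one, pp_one, pp_zero, mul_one, one_mul, lower_zero,
    upper_zero]
  rw [mul_assoc _ (t.p ε i), ← mul_assoc (t.p ε i), ← mul_assoc (t.p ε i), p_mul_p hε, p, sub_mul,
    sub_mul, mul_sub]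
  simp only [one_mul, mul_assoc, smul_mul_assoc, mul_smul_comm]

theorem vtx_zig_right (hε : ε * δ = 1) (i : ℕ) :
    t.vtx ε (i + 1) 0 2 * t.vtx ε i 2 0 = t.p ε i := by
  rw [vtx_turn_right hε i 1 0, vtx_one_one hε]

theorem vtx_zig_left (hε : ε * δ = 1) (i : ℕ) :
    t.vtx ε i 0 2 * t.vtx ε (i + 1) 2 0 = t.p ε i := by
  rw [vtx_turn_left hε i 1 0, vtx_one_one hε]

/-- A circle is a loop at a vertex without other legs, so its value is `(δ - ε) δ`. -/
theorem vtx_circle (hε : ε * δ = 1) (i : ℕ) :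
    t.vtx ε i 0 2 * t.vtx ε i 2 0 = (δ ^ 2 - 1) • 1 := by
  rw [vtx_loop hε, vtx_zero_zero, smul_smul, sub_mul, hε, sq]

end Relations

/-! #### Crossings of ribbons -/

/-- The crossing of two ribbons, with projectors. -/
def crs (a b : R) (i : ℕ) : A := t.pp ε i 2 * t.xx a b (2 * i) * t.pp ε i 2

section Crossing

variable {t ε} {a b : R}

theorem pp_two_mul_x (hε : ε * δ = 1) (i : ℕ) : t.pp ε i 2 * t.x a b (2 * i) = a • t.pp ε i 2 := by
  rw [pp_two, (t.p_comm ε _ _).eq, x, mul_add, mul_smul_comm, mul_one, mul_smul_comm, mul_assoc,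
    mul_reassoc (p_u hε i)]
  simp

theorem pp_two_mul_x_add_two (hε : ε * δ = 1) (i : ℕ) :
    t.pp ε i 2 * t.x a b (2 * i + 2) = a • t.pp ε i 2 := by
  rw [pp_two, x, mul_add, mul_smul_comm, mul_one, mul_smul_comm, mul_assoc,
    mul_reassoc (show t.p ε (i + 1) * t.u (2 * i + 2) = 0 from p_u hε (i + 1))]
  simp

theorem x_mul_pp_two (hε : ε * δ = 1) (i : ℕ) : t.x a b (2 * i) * t.pp ε i 2 = a • t.pp ε i 2 := by
  rw [pp_two, x, add_mul, smul_mul_assoc, one_mul, smul_mul_assoc, mul_assoc,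
    mul_reassoc (c_p hε i)]
  simp

theorem x_add_two_mul_pp_two (hε : ε * δ = 1) (i : ℕ) :
    t.x a b (2 * i + 2) * t.pp ε i 2 = a • t.pp ε i 2 := by
  rw [pp_two, (t.p_comm ε _ _).eq, x, add_mul, smul_mul_assoc, one_mul, smul_mul_assoc, mul_assoc,
    mul_reassoc (show t.c (2 * i + 2) * t.p ε (i + 1) = 0 from c_p hε (i + 1))]
  simp

theorem uc_x_x_uc (j : ℕ) :
    t.u (j + 1) * t.c (j + 1) * (t.x a b j * t.x a b (j + 2)) * (t.u (j + 1) * t.c (j + 1)) =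
      (a ^ 2 * δ + 2 * (a * b)) • (t.u (j + 1) * t.c (j + 1)) +
        b ^ 2 • (t.u (j + 1) * t.u j * (t.c j * t.c (j + 1))) := by
  have e3 : t.c j * t.u (j + 2) = t.u j * t.c j := t.c_u_far j 0
  simp only [x, add_mul, mul_add, mul_smul_comm, one_mul, mul_one, mul_assoc,
    mul_reassoc (t.c_u _), mul_reassoc (t.c_succ_u _), mul_reassoc (t.c_u_succ _), smul_mul_assoc,
    mul_reassoc e3, smul_smul]
  match_scalars <;> ring

/-- Only the first and the last of the four crossings need resolving. When one of these becomes the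
identity, the projectors next to the two middle crossings turn each of these into the scalar `a`;
the remaining term, with a cup–cap on both sides, is `uc_x_x_uc`. -/
theorem crs_eq (hw : KauffmanWeights a b δ) (hε : ε * δ = 1) (i : ℕ) :
    t.crs ε a b i = a ^ 4 • t.pp ε i 2 + b ^ 4 • (t.vtx ε i 2 0 * t.vtx ε i 0 2) -
      δ • t.vtx ε i 2 2 := by
  set e := t.pp ε i 2 with he
  set U := t.u (2 * i + 1) * t.c (2 * i + 1) with hU
  set Y := t.x a b (2 * i) * t.x a b (2 * i + 2) with hY
  set W := t.u (2 * i + 1) * t.u (2 * i) * (t.c (2 * i) * t.c (2 * i + 1)) with hW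
  have hee : e * e = e := pp_mul_pp hε i 2
  have h1 : e * Y = a ^ 2 • e := by
    rw [hY, ← mul_assoc, pp_two_mul_x hε, smul_mul_assoc, pp_two_mul_x_add_two hε, smul_smul, sq]
  have h2 : Y * e = a ^ 2 • e := by
    rw [hY, mul_assoc, x_add_two_mul_pp_two hε, mul_smul_comm, x_mul_pp_two hε, smul_smul, sq]
  have h3 : U * Y * U = (a ^ 2 * δ + 2 * (a * b)) • U + b ^ 2 • W := t.uc_x_x_uc _
  have h4 : t.vtx ε i 2 0 * t.vtx ε i 0 2 = e * (W * e) := by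
    simp [vtx, dv, upper_zero, lower_zero, mul_assoc, hW, ← he]
  have h5 : t.vtx ε i 2 2 = e * (U * e) := by
    simp [vtx, dv, mul_assoc, hU, ← he]
  have h6 : t.crs ε a b i = (a ^ 2) • (e * Y * e) + (a * b) • (e * Y * (U * e)) +
      (a * b) • (e * (U * (Y * e))) + b ^ 2 • (e * (U * Y * U) * e) := by
    rw [crs, xx, ← hY, x, ← hU, ← he]
    simp only [add_mul, mul_add, smul_mul_assoc, mul_smul_comm, one_mul, mul_one, mul_assoc,
      smul_smul, smul_add]
    module
  rw [h6, h1, h2, h3, h4, h5]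
  simp only [add_mul, mul_add, smul_mul_assoc, mul_smul_comm, hee, mul_assoc, smul_smul]
  match_scalars
  · ring
  -- With `a b = 1` the coefficient of the four-valent vertex is `2 a² + 2 b² + δ`, and this is
  -- `-δ`.
  · linear_combination (2 * a ^ 2 + a * b * δ + 2 * b ^ 2 + δ) * hw.mul + 2 * hw.loop
  · ring

end Crossing

end CupCap
end CupCap
end RibbonGraph

/-! ### Sliding ribbons past vertices, and the Reidemeister moves for ribbons. -/

namespace RibbonGraph

section CupCap

variable {R A : Type*} [CommRing R] [Ring A] [Algebra R A] {δ : R}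

namespace CupCap

variable (t : CupCap A δ) (ε : R)

/-! #### A ribbon passes over or under other ribbons -/

/-- A pair of strands crosses `k` pairs from left to right. -/
def xpass (a b : R) (j : ℕ) : ℕ → A
  | 0 => 1
  | k + 1 => xpass a b j k * t.xx a b (j + 2 * k)

/-- A ribbon crosses `k` ribbons from left to right. -/
def cpass (a b : R) (i : ℕ) : ℕ → A
  | 0 => 1
  | k + 1 => cpass a b i k * t.crs ε a b (i + k)

theorem slides_xpass (a b : R) (j k : ℕ) :
    t.Slides (t.xpass a b j k) (j + 2 * k + 2) (j + 2 * k + 2) := by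
  induction k with
  | zero => exact Slides.one
  | succ k ih => exact (ih.widen (m' := j + 2 * (k + 1) + 2) (n' := j + 2 * (k + 1) + 2) 2
      (by omega) (by omega)).mul ((t.slides_xx a b (j + 2 * k)).widen 0 rfl rfl)

variable {t ε} {a b : R}

/-- Induction on the legs: each new cup of the doubled vertex is slid through the passing pair by
`xx_xx_u`. -/
theorem upper_mul_xx (hw : KauffmanWeights a b δ) (j k : ℕ) :
    t.upper (j + 2) k * t.xx a b j = t.xpass a b j k * t.upper j k := by
  induction k with
  | zero => simp [upper_zero, xpass, t.c_add_two_xx hw]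
  | succ k ih =>
    have h := (t.slides_upper j k).xx a b (x := j + 2) 0 rfl rfl
    rw [upper_succ, mul_assoc, ← t.xx_xx_u hw, ← mul_assoc, ← mul_assoc, ih,
      mul_assoc _ _ (t.xx _ _ _),
      h.eq, xpass, upper_succ]
    simp only [mul_assoc, add_zero]

theorem lower_mul_xpass (hw : KauffmanWeights a b δ) (j k : ℕ) :
    t.lower (j + 2) k * t.xpass a b j k = t.xx a b j * t.lower j k := by
  induction k with
  | zero => simp [lower_zero, xpass, t.xx_u hw]
  | succ k ih =>
    have h := (t.slides_lower j k).xx a b (x := j + 2 * k) (y := j + 2) 0 rfl rfl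
    rw [lower_succ, xpass, mul_assoc, mul_reassoc ih, mul_assoc, h.eq, ← mul_assoc (t.xx a b j),
      ← mul_assoc, t.c_xx_xx hw, mul_assoc, lower_succ]

theorem dv_mul_xpass (hw : KauffmanWeights a b δ) (j k l : ℕ) :
    t.dv (j + 2) k l * t.xpass a b j l = t.xpass a b j k * t.dv j k l := by
  rw [dv, mul_assoc, lower_mul_xpass hw, ← mul_assoc, upper_mul_xx hw, mul_assoc, dv]

/-- The cup and the cap inside the projector travel through the crossing along their ribbon, which
changes place from `i` to `i + 1`. -/
theorem p_mul_xx (hw : KauffmanWeights a b δ) (i : ℕ) :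
    t.p ε i * t.xx a b (2 * i) = t.xx a b (2 * i) * t.p ε (i + 1) := by
  have h : t.xx a b (2 * i) * (t.u (2 * i + 2) * t.c (2 * i + 2)) =
      t.u (2 * i) * t.c (2 * i) * t.xx a b (2 * i) := by
    rw [mul_assoc, t.c_xx hw, mul_reassoc (t.xx_u_add_two hw _)]
  rw [p, p, sub_mul, mul_sub, one_mul, mul_one, smul_mul_assoc, mul_smul_comm, ← h, mul_add]

theorem p_succ_mul_xx (hw : KauffmanWeights a b δ) (i : ℕ) :
    t.p ε (i + 1) * t.xx a b (2 * i) = t.xx a b (2 * i) * t.p ε i := by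
  have h : t.xx a b (2 * i) * (t.u (2 * i) * t.c (2 * i)) =
      t.u (2 * i + 2) * t.c (2 * i + 2) * t.xx a b (2 * i) := by
    rw [mul_assoc, t.c_add_two_xx hw, mul_reassoc (t.xx_u hw _)]
  rw [p, p, sub_mul, mul_sub, one_mul, mul_one, smul_mul_assoc, mul_smul_comm, h, mul_add]

theorem pp_two_comm_xx (hw : KauffmanWeights a b δ) (i : ℕ) :
    Commute (t.pp ε i 2) (t.xx a b (2 * i)) := by
  rw [pp_two, Commute, SemiconjBy, mul_assoc, p_succ_mul_xx hw, ← mul_assoc, p_mul_xx hw, mul_assoc,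
    (t.p_comm ε _ _).eq]

theorem crs_eq_xx_mul (hw : KauffmanWeights a b δ) (hε : ε * δ = 1) (i : ℕ) :
    t.crs ε a b i = t.xx a b (2 * i) * t.pp ε i 2 := by
  rw [crs, (pp_two_comm_xx hw i).eq, mul_assoc, pp_mul_pp hε]

theorem pp_mul_xpass (hw : KauffmanWeights a b δ) (i k : ℕ) :
    t.pp ε (i + 1) k * t.xpass a b (2 * i) k = t.xpass a b (2 * i) k * t.pp ε i k := by
  induction k with
  | zero => simp [xpass]
  | succ k ih =>
    have h1 := (t.slides_xpass a b (2 * i) k).p ε (x := i + 1 + k) (y := i + 1 + k) 0 (by omega)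
      (by omega)
    have h2 := (t.slides_pp ε i k).xx a b (x := 2 * (i + k)) (y := 2 * (i + k)) 0 rfl rfl
    rw [pp_succ, xpass, mul_assoc, ← mul_assoc (t.p ε _), ← h1.eq, mul_assoc, ← mul_add,
      add_right_comm, p_succ_mul_xx hw, ← mul_assoc, ih, mul_assoc, mul_reassoc h2.eq, mul_assoc,
      mul_assoc, pp_succ]

/-- All projectors slide down their ribbons and merge at the bottom. The projector on the left is
needed for `k = 0`, where the pass is empty and carries none. -/
theorem p_mul_cpass (hw : KauffmanWeights a b δ) (hε : ε * δ = 1) (i k : ℕ) :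
    t.p ε i * t.cpass ε a b i k = t.xpass a b (2 * i) k * t.pp ε i (k + 1) := by
  induction k with
  | zero => simp [xpass, cpass]
  | succ k ih =>
    have h2 := (t.slides_pp ε i k).xx a b (x := 2 * (i + k)) (y := 2 * (i + k)) 0 rfl rfl
    rw [cpass, ← mul_assoc, ih, crs, mul_assoc, ← mul_assoc (t.pp ε i _), ← mul_assoc (t.pp ε i _),
      add_assoc k 1 1, pp_succ, pp_two, mul_assoc (t.pp ε i k), mul_reassoc (p_mul_p hε _),
        ← pp_two,
      mul_assoc (t.pp ε i k), (pp_two_comm_xx hw _).eq, mul_assoc, mul_assoc, pp_mul_pp hε, pp_add,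
      mul_reassoc h2.eq, xpass, mul_add, mul_assoc, mul_assoc]

/-- With the projectors collected away from the crossings, the bare strands slide past the bare
vertex by `dv_mul_xpass`; then the projectors are redistributed. The extra projector on the left
accounts for a side without legs, where the passing ribbon meets no crossing and hence no projector.
-/
theorem p_mul_vtx_mul_cpass (hw : KauffmanWeights a b δ) (hε : ε * δ = 1) (i k l : ℕ) :
    t.p ε i * (t.vtx ε (i + 1) k l * t.cpass ε a b i l) =
      t.p ε i * (t.cpass ε a b i k * t.vtx ε i k l) := by
  have hd := (t.slides_dv (2 * i) k l).p ε (x := i + l) (y := i + k) 0 (by omega) (by omega)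
  have h : t.dv (2 * (i + 1)) k l * t.xpass a b (2 * i) l =
    t.xpass a b (2 * i) k * t.dv (2 * i) k l := dv_mul_xpass hw _ _ _
  calc t.p ε i * (t.vtx ε (i + 1) k l * t.cpass ε a b i l)
      = t.vtx ε (i + 1) k l * (t.p ε i * t.cpass ε a b i l) := by
        rw [mul_reassoc (t.p_comm_vtx ε (Nat.lt_succ_self i) k l).eq, mul_assoc]
    _ = t.pp ε (i + 1) k * (t.dv (2 * (i + 1)) k l *
          (t.pp ε (i + 1) l * t.xpass a b (2 * i) l)) * t.pp ε i (l + 1) := by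
        rw [p_mul_cpass hw hε, vtx]; simp only [mul_assoc]
    _ = t.pp ε (i + 1) k * t.xpass a b (2 * i) k * t.dv (2 * i) k l *
          (t.pp ε i l * t.pp ε i (l + 1)) := by
        rw [pp_mul_xpass hw, mul_reassoc h]; simp only [mul_assoc]
    _ = t.xpass a b (2 * i) k * t.pp ε i k * (t.dv (2 * i) k l * t.p ε (i + l)) * t.pp ε i l := by
        rw [pp_mul_xpass hw, pp_mul_pp_of_ge hε le_rfl (by omega), pp_succ,
          (t.p_comm_pp ε _ _ _).symm.eq]
        simp only [mul_assoc]
    _ = t.p ε i * t.cpass ε a b i k * t.vtx ε i k l := by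
        have e : t.pp ε i (k + 1) * t.pp ε i k = t.pp ε i k * t.p ε (i + k) := by
          rw [pp_mul_pp_of_le hε le_rfl (by omega), pp_succ]
        rw [hd.eq, p_mul_cpass hw hε, vtx]
        simp only [mul_assoc]
        rw [mul_reassoc e, mul_assoc]
    _ = _ := mul_assoc _ _ _

/-! #### Reidemeister moves for ribbons -/

theorem crs_mul_crs (hw : KauffmanWeights a b δ) (hε : ε * δ = 1) (i : ℕ) :
    t.crs ε a b i * t.crs ε b a i = t.pp ε i 2 := by
  rw [crs_eq_xx_mul hw hε, crs, mul_assoc, ← mul_assoc (t.pp ε i 2), ← mul_assoc (t.pp ε i 2),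
    pp_mul_pp hε, (pp_two_comm_xx hw.symm i).eq, mul_assoc, pp_mul_pp hε,
    mul_reassoc (t.xx_mul_xx hw _), one_mul]

theorem vtx_zero_two_mul_p (hε : ε * δ = 1) (i : ℕ) :
    t.vtx ε i 0 2 * t.p ε i = t.vtx ε i 0 2 ∧ t.vtx ε i 0 2 * t.p ε (i + 1) = t.vtx ε i 0 2 := by
  constructor <;> rw [vtx, mul_assoc, pp_mul_p hε (by omega) (by omega)]

theorem vtx_succ_mul_pp (hε : ε * δ = 1) (i : ℕ) :
    t.vtx ε (i + 1) 0 2 * t.pp ε i 2 = t.p ε i * t.vtx ε (i + 1) 0 2 := by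
  rw [pp_two, (t.p_comm ε _ _).eq, ← mul_assoc, (vtx_zero_two_mul_p hε _).1,
    (t.p_comm_vtx ε (Nat.lt_succ_self i) _ _).eq]

theorem vtx_mul_pp_succ (hε : ε * δ = 1) (i : ℕ) :
    t.vtx ε i 0 2 * t.pp ε (i + 1) 2 = t.p ε i * t.vtx ε i 0 2 := by
  rw [pp_two, ← mul_assoc, (vtx_zero_two_mul_p hε _).2,
    ((t.slides_vtx ε i 0 2).p ε (x := i + 1 + 1) (y := i) 0 (by omega) (by omega)).eq]

/-- By `crs_eq`, a quarter turn exchanges the two smoothings with their weights and leaves the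
four-valent vertex in place. -/
theorem vtx_mul_crs (hw : KauffmanWeights a b δ) (hε : ε * δ = 1) (i : ℕ) :
    t.vtx ε (i + 1) 0 2 * t.crs ε a b i = t.vtx ε i 0 2 * t.crs ε b a (i + 1) := by
  rw [crs_eq hw hε, crs_eq hw.symm hε]
  simp only [mul_sub, mul_add, mul_smul_comm]
  rw [vtx_succ_mul_pp hε, vtx_mul_pp_succ hε, mul_reassoc (vtx_zig_right hε i),
    mul_reassoc (vtx_zig_left hε i), vtx_turn_left hε i 1 2, vtx_turn_right hε i 1 2]
  abel

/-- Under `crs_eq` both curls become the same combination of a strand with a circle, a plain strand,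
and a strand with a looped vertex. -/
theorem curl_eq (hw : KauffmanWeights a b δ) (hε : ε * δ = 1) (i : ℕ) :
    t.vtx ε (i + 1) 0 2 * t.crs ε a b i * t.vtx ε (i + 1) 2 0 =
      t.vtx ε i 0 2 * t.crs ε a b (i + 1) * t.vtx ε i 2 0 := by
  have h1 : t.vtx ε i 0 2 * t.vtx ε (i + 1) 2 2 = t.vtx ε i 1 3 := vtx_turn_left hε i 1 2
  have h2 : t.vtx ε (i + 1) 0 2 * t.vtx ε i 2 2 = t.vtx ε i 1 3 := vtx_turn_right hε i 1 2
  rw [crs_eq hw hε, crs_eq hw hε]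
  simp only [mul_sub, mul_add, mul_smul_comm, sub_mul, add_mul, smul_mul_assoc]
  rw [vtx_succ_mul_pp hε, vtx_mul_pp_succ hε, mul_reassoc (vtx_zig_right hε i),
    mul_reassoc (vtx_zig_left hε i), mul_assoc (t.p ε i), mul_assoc (t.p ε i), mul_assoc (t.p ε i),
    mul_assoc (t.p ε i), vtx_zig_left hε, vtx_zig_right hε, vtx_circle hε, vtx_circle hε,
    h2, ← h1, mul_assoc, vtx_loop hε, mul_smul_comm, mul_smul_comm,
    vtx_zig_left hε, h1, ← h2, mul_assoc, vtx_loop hε, mul_smul_comm, vtx_zig_right hε]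

/-- The crossing that is passed is expanded by `crs_eq` into pieces that are all vertices, and the
ribbon slides past each of them. -/
theorem p_mul_cpass_mul_crs {a' b' : R} (hw : KauffmanWeights a b δ) (hw' : KauffmanWeights a' b' δ)
    (hε : ε * δ = 1) (i : ℕ) :
    t.p ε i * (t.cpass ε a b i 2 * t.crs ε a' b' i) =
      t.p ε i * (t.crs ε a' b' (i + 1) * t.cpass ε a b i 2) := by
  have h (k l : ℕ) := p_mul_vtx_mul_cpass (t := t) hw hε i k l
  have c (k l : ℕ) := t.p_comm_vtx ε (Nat.lt_succ_self i) k l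
  have h2 : t.p ε i * (t.cpass ε a b i 2 * t.pp ε i 2) =
      t.p ε i * (t.pp ε (i + 1) 2 * t.cpass ε a b i 2) := by
    rw [← mul_assoc, p_mul_cpass hw hε, mul_assoc, pp_mul_pp_of_le hε le_rfl (by omega),
      ← mul_assoc,
      (t.p_comm_pp ε _ _ _).eq, mul_assoc, p_mul_cpass hw hε, ← mul_assoc, pp_mul_xpass hw,
        mul_assoc,
      pp_mul_pp_of_ge hε le_rfl (by omega)]
  have h3 : t.p ε i * (t.cpass ε a b i 2 * (t.vtx ε i 2 0 * t.vtx ε i 0 2)) =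
      t.p ε i * (t.vtx ε (i + 1) 2 0 * t.vtx ε (i + 1) 0 2 * t.cpass ε a b i 2) := by
    rw [← mul_assoc (t.cpass _ _ _ _ _), ← mul_assoc, ← h, cpass, mul_one, (c 2 0).eq, mul_assoc,
      mul_assoc (t.vtx _ _ _ _), ← mul_assoc _ (t.vtx _ _ _ _), (c 2 0).eq, mul_assoc, h 0 2, cpass,
      one_mul]
  rw [crs_eq hw' hε, crs_eq hw' hε]
  simp only [mul_sub, mul_add, mul_smul_comm, sub_mul, add_mul, smul_mul_assoc]
  rw [h2, h3, h 2 2]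

end CupCap
end CupCap
end RibbonGraph

/-! ### Words of slices, local equality in a skein algebra, and maps out of it. -/

namespace RibbonGraph

variable {V : Type}

/-! ### Words and their ends -/

namespace Piece

@[simp] theorem top_cap : (cap : Piece V).top = 0 := rfl
@[simp] theorem bot_cap : (cap : Piece V).bot = 2 := rfl
@[simp] theorem top_cup : (cup : Piece V).top = 2 := rfl
@[simp] theorem bot_cup : (cup : Piece V).bot = 0 := rfl
@[simp] theorem top_crossing (e : Bool) : (crossing e : Piece V).top = 2 := rfl
@[simp] theorem bot_crossing (e : Bool) : (crossing e : Piece V).bot = 2 := rfl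
@[simp] theorem top_vertex (v : V) (p q : ℕ) : (vertex v p q).top = p := rfl
@[simp] theorem bot_vertex (v : V) (p q : ℕ) : (vertex v p q).bot = q := rfl

end Piece

theorem fits_nil {a b : ℕ} : Fits (V := V) a [] b ↔ a = b := Iff.rfl

theorem Fits.unique {w : List (Slice V)} {a b c : ℕ} (h : Fits a w b) (h' : Fits a w c) :
    b = c := by
  induction w generalizing a with
  | nil => exact (fits_nil.1 h).symm.trans (fits_nil.1 h')
  | cons s w ih => exact ih h.2 h'.2

theorem fits_append {w w' : List (Slice V)} {a c : ℕ} :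
    Fits a (w ++ w') c ↔ ∃ b, Fits a w b ∧ Fits b w' c := by
  refine ⟨fun h => ?_, fun ⟨b, h, h'⟩ => h.append h'⟩
  induction w generalizing a with
  | nil => exact ⟨a, rfl, h⟩
  | cons s w ih =>
    obtain ⟨b, hb, hb'⟩ := ih h.2
    exact ⟨b, ⟨h.1, hb⟩, hb'⟩

/-- The word `w` has `a` ends on top and `b` at the bottom. -/
def WFits (a : ℕ) (w : Word V) (b : ℕ) : Prop := Fits a w.toList b

theorem wfits_one {a b : ℕ} : WFits a (1 : Word V) b ↔ a = b := Iff.rfl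

theorem wfits_mul {a c : ℕ} {w w' : Word V} :
    WFits a (w * w') c ↔ ∃ b, WFits a w b ∧ WFits b w' c := by
  rw [WFits, FreeMonoid.toList_mul, fits_append]; rfl

theorem WFits.mul {a b c : ℕ} {w w' : Word V} (h : WFits a w b) (h' : WFits b w' c) :
    WFits a (w * w') c := wfits_mul.2 ⟨b, h, h'⟩

theorem WFits.unique {a b c : ℕ} {w : Word V} (h : WFits a w b) (h' : WFits a w c) : b = c :=
  Fits.unique h h'

theorem wfits_sl {a b : ℕ} {x : Piece V} {i : ℕ} :
    WFits a (sl x i) b ↔ i + x.top ≤ a ∧ a - x.top + x.bot = b := Iff.rfl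

theorem wfits_sl_mul {a b : ℕ} {x : Piece V} {i : ℕ} {w : Word V} :
    WFits a (sl x i * w) b ↔ i + x.top ≤ a ∧ WFits (a - x.top + x.bot) w b := Iff.rfl

theorem WFits.mul_right_iff {a b c : ℕ} {w w' : Word V} (h : WFits a w b) :
    WFits a (w * w') c ↔ WFits b w' c := by
  rw [wfits_mul]
  exact ⟨fun ⟨b', h1, h2⟩ => h.unique h1 ▸ h2, fun h' => ⟨b, h, h'⟩⟩

theorem mem_diagram {n : ℕ} {w : Word V} : w ∈ Diagram V n ↔ WFits n w n := Iff.rfl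

@[elab_as_elim]
theorem Word.induction {motive : Word V → Prop} (w : Word V) (one : motive 1)
    (mul : ∀ x i w, motive w → motive (sl x i * w)) : motive w := by
  induction w using FreeMonoid.inductionOn' with
  | one => exact one
  | of_mul s w ih => exact mul s.piece s.pos w ih

/-- Every word fits once there are enough strands on top, and then leaves as many strands below as
desired. This allows arbitrary words to be multiplied in the stable algebra. -/
theorem exists_wfits (w : Word V) (K : ℕ) : ∃ K', ∀ a, K' ≤ a → ∃ b, K ≤ b ∧ WFits a w b := by
  induction w using Word.induction with
  | one => exact ⟨K, fun a h => ⟨a, h, rfl⟩⟩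
  | mul x i w ih =>
    obtain ⟨K', h⟩ := ih
    refine ⟨i + x.top + K', fun a ha => ?_⟩
    obtain ⟨b, hb, hw⟩ := h (a - x.top + x.bot) (by omega)
    exact ⟨b, hb, show i + x.top ≤ a by omega, hw⟩

/-! ### Formal linear combinations -/

@[simp] theorem word_one : word (1 : Word V) = 1 := rfl

@[simp] theorem word_mul (u v : Word V) : word (u * v) = word u * word v := by
  simp [word, MonoidAlgebra.single_mul_single]

@[elab_as_elim]
theorem Formal.induction {motive : Formal V → Prop} (x : Formal V) (word : ∀ w, motive (word w))
    (add : ∀ x y, motive x → motive y → motive (x + y))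
    (smul : ∀ (r : Coeff) x, motive x → motive (r • x)) : motive x := by
  induction x using MonoidAlgebra.induction_linear with
  | zero => simpa using smul 0 _ (word 1)
  | add x y hx hy => exact add x y hx hy
  | single w r =>
    have : (MonoidAlgebra.single w r : Formal V) = r • RibbonGraph.word w := by
      rw [RibbonGraph.word, MonoidAlgebra.smul_single', mul_one]
    rw [this]
    exact smul r _ (word w)

theorem linearize_add (n : ℕ) (x y : Formal V) :
    linearize n (x + y) = linearize n x + linearize n y := by
  classical
  unfold linearize
  rw [MonoidAlgebra.coeff_add, Finsupp.sum_add_index']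
  · intro w; split <;> simp
  · intro w r s; split <;> simp [MonoidAlgebra.single_add]

theorem linearize_smul (n : ℕ) (r : Coeff) (x : Formal V) :
    linearize n (r • x) = r • linearize n x := by
  classical
  unfold linearize
  rw [MonoidAlgebra.coeff_smul, Finsupp.sum_smul_index', Finsupp.smul_sum]
  · refine Finsupp.sum_congr fun w _ => ?_
    split
    · rw [MonoidAlgebra.smul_single]
    · simp
  · intro w; split <;> simp

theorem linearize_word {n : ℕ} {w : Word V} (h : w ∈ Diagram V n) :
    linearize n (word w) =
      MonoidAlgebra.single (((⟨w, h⟩ : Diagram V n) : IsotopyClass V n)) 1 := by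
  unfold linearize word
  rw [MonoidAlgebra.coeff_single, Finsupp.sum_single_index]
  · rw [dif_pos h]
  · split <;> simp

theorem linearize_word_of_notMem {n : ℕ} {w : Word V} (h : w ∉ Diagram V n) :
    linearize n (word w) = 0 := by
  unfold linearize word
  rw [MonoidAlgebra.coeff_single, Finsupp.sum_single_index]
  · rw [dif_neg h]
  · split <;> simp

variable (rel : Word V → Formal V → Prop)

/-- `skeinClass` as a linear map. -/
def skeinLin (n : ℕ) : Formal V →ₗ[Coeff] SkeinAlgebra rel n where
  toFun := skeinClass rel n
  map_add' x y := by rw [skeinClass, linearize_add, map_add]; rfl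
  map_smul' r x := by rw [skeinClass, linearize_smul, map_smul]; rfl

theorem skeinLin_apply (n : ℕ) (x : Formal V) : skeinLin rel n x = skeinClass rel n x := rfl

/-- The combinations of words with `a` ends on top and `b` at the bottom. -/
def Hom (V : Type) (a b : ℕ) : Submodule Coeff (Formal V) :=
  Submodule.span Coeff {x | ∃ w : Word V, WFits a w b ∧ x = word w}

theorem word_mem_hom {a b : ℕ} {w : Word V} (h : WFits a w b) : word w ∈ Hom V a b :=
  Submodule.subset_span ⟨w, h, rfl⟩

theorem one_mem_hom (a : ℕ) : (1 : Formal V) ∈ Hom V a a := word_mem_hom (w := 1) rfl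

@[elab_as_elim]
theorem Hom.induction {a b : ℕ} {motive : (x : Formal V) → x ∈ Hom V a b → Prop}
    (word : ∀ w h, motive (word w) (word_mem_hom h)) (zero : motive 0 (zero_mem _))
    (add : ∀ x y hx hy, motive x hx → motive y hy → motive (x + y) (add_mem hx hy))
    (smul : ∀ (r : Coeff) x hx, motive x hx → motive (r • x) (Submodule.smul_mem _ r hx))
    {x : Formal V} (hx : x ∈ Hom V a b) : motive x hx := by
  induction hx using Submodule.span_induction with
  | mem x h => obtain ⟨w, hw, rfl⟩ := h; exact word w hw
  | zero => exact zero
  | add x y hx hy h h' => exact add x y hx hy h h'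
  | smul r x hx h => exact smul r x hx h

theorem mul_mem_hom {a b c : ℕ} {x y : Formal V} (hx : x ∈ Hom V a b) (hy : y ∈ Hom V b c) :
    x * y ∈ Hom V a c := by
  induction hx using Hom.induction with
  | zero => rw [zero_mul]; exact zero_mem _
  | add x x' _ _ h h' => rw [add_mul]; exact add_mem h h'
  | smul r x _ h => rw [smul_mul_assoc]; exact Submodule.smul_mem _ _ h
  | word w hw =>
    induction hy using Hom.induction with
    | zero => rw [mul_zero]; exact zero_mem _
    | add x x' _ _ h h' => rw [mul_add]; exact add_mem h h'
    | smul r x _ h => rw [mul_smul_comm]; exact Submodule.smul_mem _ _ h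
    | word w' hw' => rw [← word_mul]; exact word_mem_hom (hw.mul hw')

variable {rel}

theorem skeinLin_word_of_not_wfits {n : ℕ} {w : Word V} (h : ¬ WFits n w n) :
    skeinLin rel n (word w) = 0 := by
  rw [skeinLin_apply, skeinClass, linearize_word_of_notMem h, map_zero]

/-- Membership in `Hom V n n` matters: `linearize` discards words that are not diagrams, although a
product of two such words can be a diagram. -/
theorem skeinLin_mul {n : ℕ} {x y : Formal V} (hx : x ∈ Hom V n n) (hy : y ∈ Hom V n n) :
    skeinLin rel n (x * y) = skeinLin rel n x * skeinLin rel n y := by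
  induction hx using Hom.induction with
  | zero => simp
  | add x x' _ _ h h' => rw [add_mul, map_add, h, h', map_add, add_mul]
  | smul r x _ h => rw [smul_mul_assoc, map_smul, h, map_smul, smul_mul_assoc]
  | word w hw =>
    induction hy using Hom.induction with
    | zero => simp
    | add x x' _ _ h h' => rw [mul_add, map_add, h, h', map_add, mul_add]
    | smul r x _ h => rw [mul_smul_comm, map_smul, h, map_smul, mul_smul_comm]
    | word w' hw' =>
      rw [← word_mul]
      simp only [skeinLin_apply, skeinClass]
      rw [linearize_word (mem_diagram.2 hw), linearize_word (mem_diagram.2 hw'),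
        linearize_word (mem_diagram.2 (hw.mul hw')), ← map_mul, MonoidAlgebra.single_mul_single,
        mul_one]
      rfl

theorem skeinLin_move {n : ℕ} {u v l r : Word V} (h : Move l r) (hl : WFits n (u * l * v) n)
    (hr : WFits n (u * r * v) n) :
    skeinLin rel n (word (u * l * v)) = skeinLin rel n (word (u * r * v)) := by
  simp only [skeinLin_apply, skeinClass]
  rw [linearize_word (mem_diagram.2 hl), linearize_word (mem_diagram.2 hr)]
  congr 2
  exact (Con.eq _).2 (ConGen.Rel.of _ _ ⟨u, v, l, r, h, rfl, rfl⟩)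

theorem skeinLin_rel {n : ℕ} {u v l : Word V} {r : Formal V} (h : rel l r)
    (hl : WFits n (u * l * v) n) :
    skeinLin rel n (word (u * l * v)) = skeinLin rel n (word u * r * word v) :=
  RingQuot.mkAlgHom_rel Coeff ⟨u, v, l, r, h, mem_diagram.2 hl, rfl, rfl⟩

theorem exists_skeinLin {n : ℕ} (z : SkeinAlgebra rel n) :
    ∃ x ∈ Hom V n n, skeinLin rel n x = z := by
  obtain ⟨y, rfl⟩ := RingQuot.mkAlgHom_surjective Coeff _ z
  induction y using MonoidAlgebra.induction_linear with
  | zero => exact ⟨0, zero_mem _, by rw [map_zero, map_zero]⟩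
  | add y y' h h' =>
    obtain ⟨x, hx, e⟩ := h
    obtain ⟨x', hx', e'⟩ := h'
    exact ⟨x + x', add_mem hx hx', by rw [map_add, map_add, e, e']⟩
  | single D c =>
    induction D using Con.induction_on with
    | H D =>
      refine ⟨c • word D, Submodule.smul_mem _ _ (word_mem_hom (mem_diagram.1 D.2)), ?_⟩
      rw [map_smul, skeinLin_apply, skeinClass, linearize_word D.2, ← map_smul,
        MonoidAlgebra.smul_single', mul_one]

/-! ### Local equality -/

variable (rel) in
/-- The combinations of words with `a` ends on top that vanish in the skein algebra of diagrams
with `n` ends whatever is put above and below them. -/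
def locKer (n a : ℕ) : Submodule Coeff (Formal V) where
  carrier := {x | ∀ u v : Word V, WFits n u a → skeinLin rel n (word u * x * word v) = 0}
  zero_mem' u v _ := by simp
  add_mem' hx hy u v h := by rw [mul_add, add_mul, map_add, hx u v h, hy u v h, add_zero]
  smul_mem' r x hx u v h := by
    rw [mul_smul_comm, smul_mul_assoc, map_smul, hx u v h, smul_zero]

variable {n a b : ℕ}

/-- The word below is unrestricted in `locKer`, so any right factor is absorbed into it. A left
factor, by contrast, must have matching ends. -/
theorem mul_mem_locKer {x : Formal V} (hx : x ∈ locKer rel n a) (z : Formal V) :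
    x * z ∈ locKer rel n a := by
  induction z using Formal.induction with
  | word w => intro u v h; rw [← mul_assoc, mul_assoc, ← word_mul]; exact hx u _ h
  | add z z' h h' => rw [mul_add]; exact add_mem h h'
  | smul r z h => rw [mul_smul_comm]; exact Submodule.smul_mem _ _ h

theorem word_mul_mem_locKer {w : Word V} {x : Formal V} (hw : WFits b w a)
    (hx : x ∈ locKer rel n a) : word w * x ∈ locKer rel n b := fun u v h => by
  rw [← mul_assoc, ← word_mul]; exact hx _ v (h.mul hw)

theorem skeinLin_eq_zero {x : Formal V} (hx : x ∈ locKer rel n n) : skeinLin rel n x = 0 := by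
  simpa using hx 1 1 rfl

theorem skeinLin_eq_of_sub {x y : Formal V} (h : skeinLin rel n (x - y) = 0) :
    skeinLin rel n x = skeinLin rel n y := by
  rwa [map_sub, sub_eq_zero] at h

theorem mem_locKer_of_not_wfits {w : Word V} (h : ∀ b, ¬ WFits a w b) :
    word w ∈ locKer rel n a := fun u v hu => by
  rw [← word_mul, ← word_mul]
  refine skeinLin_word_of_not_wfits fun h' => ?_
  obtain ⟨b, h1, h2⟩ := wfits_mul.1 (mul_assoc u w v ▸ h')
  obtain ⟨c, h3, -⟩ := wfits_mul.1 (hu.unique h1 ▸ h2)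
  exact h c h3

theorem skeinLin_sandwich_of_not_wfits {u v : Word V} {x : Formal V} (hx : x ∈ Hom V a b)
    (hu : WFits n u a) (hv : ¬ WFits b v n) : skeinLin rel n (word u * x * word v) = 0 := by
  induction hx using Hom.induction with
  | word w hw =>
    rw [← word_mul, ← word_mul]
    refine skeinLin_word_of_not_wfits fun h => hv ?_
    exact (hu.mul hw).mul_right_iff.1 h
  | zero => simp
  | add x y _ _ h h' => rw [mul_add, add_mul, map_add, h, h', add_zero]
  | smul r x _ h => rw [mul_smul_comm, smul_mul_assoc, map_smul, h, smul_zero]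

theorem move_mem_locKer {l r : Word V} (h : Move l r) (hl : WFits a l b) (hr : WFits a r b) :
    word l - word r ∈ locKer rel n a := fun u v hu => by
  rw [mul_sub, sub_mul, map_sub, sub_eq_zero]
  by_cases hv : WFits b v n
  · simpa using skeinLin_move (rel := rel) h ((hu.mul hl).mul hv) ((hu.mul hr).mul hv)
  · rw [skeinLin_sandwich_of_not_wfits (word_mem_hom hl) hu hv,
      skeinLin_sandwich_of_not_wfits (word_mem_hom hr) hu hv]

theorem rel_mem_locKer {l : Word V} {r : Formal V} (h : rel l r) (hl : WFits a l b)
    (hr : r ∈ Hom V a b) : word l - r ∈ locKer rel n a := fun u v hu => by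
  rw [mul_sub, sub_mul, map_sub, sub_eq_zero]
  by_cases hv : WFits b v n
  · simpa using skeinLin_rel h ((hu.mul hl).mul hv)
  · rw [skeinLin_sandwich_of_not_wfits (word_mem_hom hl) hu hv,
      skeinLin_sandwich_of_not_wfits hr hu hv]

/-- A strand turning around on the right of a word may be moved below it. -/
theorem cap_mul_word_mem_locKer {w : Word V} (hw : WFits a w b) :
    word (sl .cap a * w) - word (w * sl .cap b) ∈ locKer rel n a := by
  induction w using Word.induction generalizing a with
  | one => rw [wfits_one.1 hw]; simp
  | mul x i w ih =>
    obtain ⟨h, hw⟩ := wfits_sl_mul.1 hw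
    have e : word (sl .cap a * (sl x i * w)) - word (sl x i * w * sl .cap b) =
        word (sl x i) * (word (sl .cap (a - x.top + x.bot) * w) - word (w * sl .cap b)) -
        (word (sl x i * sl .cap (a - x.top + x.bot)) - word (sl .cap a * sl x i)) * word w := by
      simp only [word_mul, mul_sub, sub_mul, mul_assoc]; abel
    rw [e]
    refine sub_mem (word_mul_mem_locKer ⟨h, rfl⟩ (ih hw)) (mul_mem_locKer ?_ _)
    have m := Move.interchange x .cap i (a - (i + x.top))
    rw [show i + x.bot + (a - (i + x.top)) = a - x.top + x.bot by omega,
      show i + x.top + (a - (i + x.top)) = a by omega] at m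
    refine move_mem_locKer (b := a - x.top + x.bot + 2) m ?_ ?_
    · rw [wfits_sl_mul, wfits_sl, Piece.top_cap, Piece.bot_cap]; omega
    · rw [wfits_sl_mul, wfits_sl, Piece.top_cap, Piece.bot_cap]; omega

/-! ### Homomorphisms out of a skein algebra -/

section Lift

variable {A : Type*} [Ring A] [Algebra Coeff A]

/-- The linear extension of a multiplicative map on words. -/
def evalWord (g : Word V →* A) : Formal V →ₐ[Coeff] A := MonoidAlgebra.lift Coeff A (Word V) g

@[simp] theorem evalWord_word (g : Word V →* A) (w : Word V) : evalWord g (word w) = g w := by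
  simp [evalWord, word]

/-- All relations in `rel` are between combinations of words with the same ends. -/
def Homogeneous (rel : Word V → Formal V → Prop) : Prop :=
  ∀ l r, rel l r → ∀ a b, WFits a l b → r ∈ Hom V a b

/-- The universal property: since moves and relations are local, a multiplicative map on words needs
to respect only the bare moves and relations. Homogeneity ensures that a substituted combination
still consists of diagrams. -/
theorem exists_skeinLift (hrel : Homogeneous rel) (g : Word V →* A)
    (hm : ∀ l r, Move l r → g l = g r) (hr : ∀ l r, rel l r → g l = evalWord g r) (n : ℕ) :
    ∃ f : SkeinAlgebra rel n →ₐ[Coeff] A, ∀ x ∈ Hom V n n, f (skeinLin rel n x) = evalWord g x := by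
  let f₁ : IsotopyClass V n →* A := (isotopy V n).lift (g.comp (Diagram V n).subtype)
    (Con.conGen_le.2 fun D E ⟨u, v, l, r, h, hD, hE⟩ => by
      rw [Con.ker_rel]
      simp [hD, hE, hm l r h])
  let f₂ : MonoidAlgebra Coeff (IsotopyClass V n) →ₐ[Coeff] A := MonoidAlgebra.lift _ _ _ f₁
  have h₂ (x) (hx : x ∈ Hom V n n) : f₂ (linearize n x) = evalWord g x := by
    induction hx using Hom.induction with
    | word w hw =>
      rw [linearize_word (mem_diagram.2 hw), MonoidAlgebra.lift_single, one_smul, evalWord_word]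
      rfl
    | zero => rw [show linearize n (0 : Formal V) = 0 by simp [linearize], map_zero, map_zero]
    | add x y _ _ h h' => rw [linearize_add, map_add, h, h', map_add]
    | smul r x _ h => rw [linearize_smul, map_smul, h, map_smul]
  refine ⟨RingQuot.liftAlgHom Coeff ⟨f₂, ?_⟩, fun x hx => ?_⟩
  · rintro _ _ ⟨u, v, l, r, h, hl, rfl, rfl⟩
    obtain ⟨c, huc, hvc⟩ := wfits_mul.1 (mem_diagram.1 hl)
    obtain ⟨b, hu, hl'⟩ := wfits_mul.1 huc
    rw [h₂ _ (word_mem_hom hl), h₂ _ (mul_mem_hom (mul_mem_hom (word_mem_hom hu)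
      (hrel l r h _ _ hl')) (word_mem_hom hvc))]
    simp [hr l r h]
  · rw [skeinLin_apply, skeinClass, RingQuot.liftAlgHom_mkAlgHom_apply, h₂ x hx]

end Lift

end RibbonGraph

/-! ### Evaluation of tangles and ribbon graphs on cups and caps, and its invariance. -/

namespace RibbonGraph

/-! ### Coefficients -/

theorem pA_mul (k l : ℤ) : pA k * pA l = pA (k + l) := by
  rw [pA, pA, pA, ← map_mul, ← LaurentPolynomial.T_add]

@[simp] theorem pA_zero : pA 0 = 1 := by rw [pA, LaurentPolynomial.T_zero, map_one]

theorem pA_pow (k : ℤ) (m : ℕ) : pA k ^ m = pA (m * k) := by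
  rw [pA, pA, ← map_pow, LaurentPolynomial.T_pow]

theorem dInv_mul_d : dInv * d = 1 := by
  rw [mul_comm]; exact IsLocalization.Away.mul_invSelf loopPoly

theorem d_eq : d = -pA 2 - pA (-2) := by simp only [d, loopPoly, pA, map_sub, map_neg]

theorem kauffmanWeights (e : Bool) : KauffmanWeights (pA (sgn e)) (pA (-sgn e)) d where
  mul := by rw [pA_mul, add_neg_cancel, pA_zero]
  loop := by
    rw [pA_pow, pA_pow, d_eq]
    cases e <;> simp [sgn]
    ring

theorem sgn_not (e : Bool) : sgn (!e) = -sgn e := by cases e <;> rfl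

section

variable {A : Type*} [Ring A] [Algebra Coeff A]

namespace CupCap

variable (t : CupCap A d)

/-! ### Tangles and ribbon graphs in an algebra with cups and caps -/

/-- The value of a slice of a tangle diagram. -/
def slice : Slice Empty → A
  | ⟨.cap, i⟩ => t.c i
  | ⟨.cup, i⟩ => t.u i
  | ⟨.crossing e, i⟩ => t.x (pA (sgn e)) (pA (-sgn e)) i
  | ⟨.vertex v _ _, _⟩ => v.elim

/-- The value of a tangle diagram. -/
def tangle : Word Empty →* A := FreeMonoid.lift t.slice

@[simp] theorem tangle_cap (i : ℕ) : t.tangle (sl .cap i) = t.c i := rfl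
@[simp] theorem tangle_cup (i : ℕ) : t.tangle (sl .cup i) = t.u i := rfl
@[simp] theorem tangle_crossing (e : Bool) (i : ℕ) :
    t.tangle (sl (.crossing e) i) = t.x (pA (sgn e)) (pA (-sgn e)) i := rfl

theorem slides_slice (x : Piece Empty) (i : ℕ) :
    t.Slides (t.tangle (sl x i)) (i + x.top) (i + x.bot) := by
  cases x with
  | cap => exact t.slides_c i
  | cup => exact t.slides_u i
  | crossing e => exact t.slides_x _ _ i
  | vertex v => exact v.elim

theorem tangle_move {l r : Word Empty} (h : Move l r) : t.tangle l = t.tangle r := by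
  induction h with
  | interchange x y i k =>
    have h := t.slides_slice x i
    simp only [map_mul]
    cases y with
    | cap => exact (h.c k rfl rfl).eq
    | cup => exact (h.u k rfl rfl).eq
    | crossing e => exact (h.x _ _ k rfl rfl).eq
    | vertex v => exact v.elim
  | zigzag_right i => exact t.c_succ_u i
  | zigzag_left i => exact t.c_u_succ i
  | turnCrossing e i =>
    simp only [map_mul, tangle_cap, tangle_crossing, sgn_not, neg_neg, x, mul_add, mul_smul_comm,
      mul_one, mul_reassoc (t.c_succ_u _), mul_reassoc (t.c_u_succ _), one_mul]
    rw [add_comm]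
  | reidemeister_one e i =>
    simp only [map_mul, tangle_cap, tangle_cup, tangle_crossing, x, mul_add, mul_smul_comm, add_mul,
      smul_mul_assoc, mul_one, mul_reassoc (t.c_succ_u _), mul_reassoc (t.c_u_succ _), one_mul,
      t.c_u, t.c_succ_u, t.c_u_succ]
  | reidemeister_two e i =>
    simp only [map_mul, tangle_crossing, sgn_not, neg_neg]
    exact t.x_mul_x (kauffmanWeights e) i
  | reidemeister_three e f i =>
    have hw := kauffmanWeights e
    simp only [pass, map_mul, List.range_succ, List.range_zero,
      List.map_append, List.prod_append, List.map_cons, List.map_nil, List.nil_append,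
      List.prod_cons, List.prod_nil, mul_one, add_zero, tangle_crossing]
    generalize pA (sgn e) = a, pA (-sgn e) = b at hw
    generalize pA (sgn f) = a', pA (-sgn f) = b'
    -- It suffices to slide the strand past each smoothing of the crossing that it passes; the only
    -- nontrivial one is a cup followed by a cap.
    have h : t.x a b i * t.x a b (i + 1) * (t.u i * t.c i) =
        t.u (i + 1) * t.c (i + 1) * (t.x a b i * t.x a b (i + 1)) := by
      rw [mul_assoc (t.u _), t.c_succ_x_x hw, ← mul_assoc, mul_assoc (t.x a b i), t.x_x_succ_u hw]
    rw [x.eq_1 t a' b' i, x.eq_1 t a' b' (i + 1), mul_add, add_mul, mul_smul_comm, mul_smul_comm, h]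
    simp
  | turnVertex_left v => exact v.elim
  | turnVertex_right v => exact v.elim
  | slideVertex e v => exact v.elim

theorem tangle_kauffmanRel {l : Word Empty} {r : Formal Empty} (h : KauffmanRel l r) :
    t.tangle l = evalWord t.tangle r := by
  cases h with
  | circle i => simpa using t.c_u i
  | crossing e i => simp [x]

/-- The value of a doubled slice of a ribbon graph diagram. -/
def core : Slice Unit → A
  | ⟨.cap, i⟩ => t.dv (2 * i) 0 2
  | ⟨.cup, i⟩ => t.dv (2 * i) 2 0
  | ⟨.crossing e, i⟩ => t.xx (pA (sgn e)) (pA (-sgn e)) (2 * i)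
  | ⟨.vertex _ p q, i⟩ => t.dv (2 * i) p q

/-- The value of a doubled slice of a ribbon graph diagram, with projectors on its ends. -/
def loc : Slice Unit → A
  | ⟨.cap, i⟩ => t.vtx dInv i 0 2
  | ⟨.cup, i⟩ => t.vtx dInv i 2 0
  | ⟨.crossing e, i⟩ => t.crs dInv (pA (sgn e)) (pA (-sgn e)) i
  | ⟨.vertex _ p q, i⟩ => t.vtx dInv i p q

/-- The value of a ribbon graph diagram, with projectors. -/
def ribbon : Word Unit →* A := FreeMonoid.lift t.loc

@[simp] theorem ribbon_cap (i : ℕ) : t.ribbon (sl .cap i) = t.vtx dInv i 0 2 := rfl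
@[simp] theorem ribbon_cup (i : ℕ) : t.ribbon (sl .cup i) = t.vtx dInv i 2 0 := rfl
@[simp] theorem ribbon_crossing (e : Bool) (i : ℕ) :
    t.ribbon (sl (.crossing e) i) = t.crs dInv (pA (sgn e)) (pA (-sgn e)) i := rfl
@[simp] theorem ribbon_vertex (v : Unit) (p q i : ℕ) :
    t.ribbon (sl (.vertex v p q) i) = t.vtx dInv i p q := rfl

theorem ribbon_sl (x : Piece Unit) (i : ℕ) : t.ribbon (sl x i) = t.loc ⟨x, i⟩ := rfl

theorem loc_eq (x : Piece Unit) (i : ℕ) :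
    t.loc ⟨x, i⟩ = t.pp dInv i x.top * t.core ⟨x, i⟩ * t.pp dInv i x.bot := by
  cases x <;> rfl

theorem upper_eq (j p : ℕ) :
    t.upper j p = if p = 0 then t.c j else t.u (j + 1) ^ (p - 1) := by
  induction p with
  | zero => rfl
  | succ p ih => rcases p with _ | p <;> simp_all [upper_succ, pow_succ, t.c_u_succ]

theorem lower_eq (j q : ℕ) :
    t.lower j q = if q = 0 then t.u j else t.c (j + 1) ^ (q - 1) := by
  induction q with
  | zero => rfl
  | succ q ih => rcases q with _ | q <;> simp_all [lower_succ, pow_succ', t.c_succ_u]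

theorem tangle_double (s : Slice Unit) : t.tangle (double s) = t.core s := by
  obtain ⟨x, i⟩ := s
  cases x with
  | cap => simp [double, core, dv, upper_zero]
  | cup => simp [double, core, dv, lower_zero]
  | crossing e => simp [double, core, xx]
  | vertex v p q =>
    simp only [double, core, dv, upper_eq, lower_eq, map_mul]
    split_ifs <;> simp

theorem evalWord_proj (j : ℕ) : evalWord t.tangle (proj j) = t.p dInv j := by
  simp [proj, p]

theorem evalWord_projAll (m : ℕ) : evalWord t.tangle (projAll m) = t.pp dInv 0 m := by
  induction m with
  | zero => simp [projAll]
  | succ m ih =>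
    simp only [projAll] at ih ⊢
    rw [List.range_succ, List.map_append, List.prod_append, map_mul, ih, pp_succ]
    simp [evalWord_proj]

theorem slides_core (x : Piece Unit) (i : ℕ) :
    t.Slides (t.core ⟨x, i⟩) (2 * i + 2 * x.top) (2 * i + 2 * x.bot) := by
  cases x with
  | cap => exact t.slides_dv _ 0 2
  | cup => exact t.slides_dv _ 2 0
  | crossing e => exact t.slides_xx _ _ _
  | vertex v p q => exact t.slides_dv _ p q

variable {t} in
theorem Slides.core {z : A} {m n : ℕ} (h : t.Slides z m n) (y : Piece Unit) {i j : ℕ} (k : ℕ)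
    (hi : 2 * i = n + k) (hj : 2 * j = m + k) :
    SemiconjBy z (t.core ⟨y, i⟩) (t.core ⟨y, j⟩) := by
  cases y with
  | cap => exact h.dv k hi hj 0 2
  | cup => exact h.dv k hi hj 2 0
  | crossing e => exact h.xx _ _ k hi hj
  | vertex v p q => exact h.dv k hi hj p q

theorem slides_loc (x : Piece Unit) (i : ℕ) :
    t.Slides (t.loc ⟨x, i⟩) (2 * i + 2 * x.top) (2 * i + 2 * x.bot) := by
  rw [loc_eq]
  exact (((t.slides_pp dInv i _).widen 0 (by omega) (by omega)).mul (t.slides_core x i)).mul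
    ((t.slides_pp dInv i _).widen 0 (by omega) (by omega))

variable {t} in
theorem Slides.loc {z : A} {m n : ℕ} (h : t.Slides z m n) (y : Piece Unit) {i j : ℕ} (k : ℕ)
    (hi : 2 * i = n + k) (hj : 2 * j = m + k) :
    SemiconjBy z (t.loc ⟨y, i⟩) (t.loc ⟨y, j⟩) := by
  rw [loc_eq, loc_eq]
  exact ((h.pp _ k hi hj _).mul_right (h.core y k hi hj)).mul_right (h.pp _ k hi hj _)

/-- A row of projectors splits into those on the legs of the piece and those on the strands beside
it. The latter slide past the piece, and idempotence merges what meets. -/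
theorem pp_mul_core_mul_pp {x : Piece Unit} {i a : ℕ} (h : i + x.top ≤ a) :
    t.pp dInv 0 a * t.core ⟨x, i⟩ * t.pp dInv 0 (a - x.top + x.bot) =
        t.pp dInv 0 a * t.loc ⟨x, i⟩ ∧
      t.pp dInv 0 a * t.loc ⟨x, i⟩ = t.loc ⟨x, i⟩ * t.pp dInv 0 (a - x.top + x.bot) := by
  obtain ⟨r, rfl⟩ := Nat.exists_eq_add_of_le h
  rw [show i + x.top + r - x.top + x.bot = i + x.bot + r by omega, loc_eq]
  have e (m) : t.pp dInv 0 (i + m + r) =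
      t.pp dInv 0 i * t.pp dInv (i + m) r * t.pp dInv i m := by
    rw [pp_add, pp_add, zero_add, zero_add, mul_assoc, (t.pp_comm dInv i m _ r).eq, mul_assoc]
  have hi (m) : t.pp dInv i m * t.pp dInv i m = t.pp dInv i m := pp_mul_pp dInv_mul_d _ _
  have hK (m) : t.pp dInv 0 i * t.pp dInv (i + m) r * (t.pp dInv 0 i * t.pp dInv (i + m) r) =
      t.pp dInv 0 i * t.pp dInv (i + m) r := by
    rw [mul_assoc, ← mul_assoc (t.pp dInv (i + m) r), (t.pp_comm dInv _ r 0 i).eq, mul_assoc,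
      pp_mul_pp dInv_mul_d, ← mul_assoc, pp_mul_pp dInv_mul_d]
  have hc (m) : t.pp dInv i m * (t.pp dInv 0 i * t.pp dInv (i + m) r) =
      t.pp dInv 0 i * t.pp dInv (i + m) r * t.pp dInv i m :=
    ((t.pp_comm dInv _ _ _ _).mul_right (t.pp_comm dInv _ _ _ _)).eq
  have hs : t.core ⟨x, i⟩ * (t.pp dInv 0 i * t.pp dInv (i + x.bot) r) =
      t.pp dInv 0 i * t.pp dInv (i + x.top) r * t.core ⟨x, i⟩ :=
    SemiconjBy.eq (SemiconjBy.mul_right (Commute.symm ((t.slides_pp dInv 0 i).core x (i := i)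
      (j := i) 0
      (by omega) (by omega)))
      ((t.slides_core x i).pp dInv (x := i + x.bot) (y := i + x.top) 0 (by omega) (by omega) r))
  rw [e, e]
  have hK₁ := hK x.top
  have hK₂ := hK x.bot
  have hc₁ := hc x.top
  have hc₂ := hc x.bot
  have hM₁ := hi x.top
  have hM₂ := hi x.bot
  -- `K`, `K'` are the projectors on the bystanders above and below the piece, and `M`, `M'` those
  -- on its legs.
  generalize t.pp dInv 0 i * t.pp dInv (i + x.bot) r = K' at *
  generalize t.pp dInv 0 i * t.pp dInv (i + x.top) r = K at *
  generalize t.pp dInv i x.top = M at *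
  generalize t.pp dInv i x.bot = M' at *
  generalize t.core ⟨x, i⟩ = z at *
  have h₁ : K * M * (M * z * M') = K * M * z * M' := by
    rw [mul_assoc K M, ← mul_assoc M, ← mul_assoc M, hM₁, mul_assoc K, mul_assoc K]
  constructor
  · rw [h₁, ← mul_assoc, mul_assoc _ z, hs, ← mul_assoc, mul_assoc K M K, hc₁, ← mul_assoc, hK₁]
  · rw [h₁, ← mul_assoc, mul_assoc (M * z), hc₂, ← mul_assoc, mul_assoc _ M' M', hM₂, mul_assoc M z,
      hs, ← mul_assoc, hc₁]

theorem pp_mul_ribbon {w : Word Unit} {a b : ℕ} (h : WFits a w b) :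
    t.pp dInv 0 a * t.ribbon w = t.ribbon w * t.pp dInv 0 b := by
  induction w using Word.induction generalizing a with
  | one => rw [wfits_one.1 h]; simp
  | mul x i w ih =>
    obtain ⟨hx, hw⟩ := wfits_sl_mul.1 h
    rw [map_mul, ← mul_assoc, ribbon_sl, (t.pp_mul_core_mul_pp hx).2, mul_assoc, ih hw, mul_assoc]

/-- The rows on the inner lines slide up and merge by idempotence, so only the top row and the
projectors on the legs of the pieces remain. -/
theorem evalWord_cable {w : Word Unit} {a b : ℕ} (h : WFits a w b) :
    evalWord t.tangle (cable a w.toList) = t.pp dInv 0 a * t.ribbon w := by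
  induction w using Word.induction generalizing a with
  | one => simp [cable, evalWord_projAll]
  | mul x i w ih =>
    obtain ⟨hx, hw⟩ := wfits_sl_mul.1 h
    change evalWord t.tangle (projAll a * word (double ⟨x, i⟩) *
      cable (a - x.top + x.bot) w.toList) = _
    rw [map_mul, map_mul, ih hw, evalWord_projAll, evalWord_word, tangle_double, ← mul_assoc,
      (t.pp_mul_core_mul_pp hx).1, mul_assoc, map_mul, ribbon_sl]

/-! ### Invariance -/

/-- The row contains the projector on ribbon `i` and absorbs a further copy of it. -/
theorem pp_mul_eq {a i : ℕ} {z w : A} (hi : i < a) (h : t.p dInv i * z = t.p dInv i * w) :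
    t.pp dInv 0 a * z = t.pp dInv 0 a * w := by
  rw [← pp_mul_p dInv_mul_d (Nat.zero_le i) (by omega : i < 0 + a), mul_assoc, h, mul_assoc]

theorem ribbon_pass (e : Bool) (k i : ℕ) :
    t.ribbon (pass e k i) = t.cpass dInv (pA (sgn e)) (pA (-sgn e)) i k := by
  induction k with
  | zero => rfl
  | succ k ih =>
    rw [pass] at ih ⊢
    rw [List.range_succ, List.map_append, List.prod_append, map_mul, ih, cpass]
    simp

/-- Straightening a strand or cancelling two crossings leaves projectors instead of `1`. The row on
top absorbs them, and `hl` guarantees that the row is long enough. -/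
theorem pp_mul_ribbon_move {l r : Word Unit} (h : Move l r) {a b : ℕ} (hl : WFits a l b) :
    t.pp dInv 0 a * t.ribbon l = t.pp dInv 0 a * t.ribbon r := by
  have hd := dInv_mul_d
  induction h with
  | interchange x y i k =>
    rw [map_mul, map_mul, ribbon_sl, ribbon_sl, ribbon_sl,
      ((t.slides_loc x i).loc y (j := i + x.top + k) (2 * k) (by omega) (by omega)).eq]
  | zigzag_right i =>
    have hi := (wfits_sl_mul.1 hl).1
    rw [Piece.top_cap] at hi
    rw [map_mul, ribbon_cap, ribbon_cup, vtx_zig_right hd, map_one]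
    exact t.pp_mul_eq (i := i) (by omega) (by rw [p_mul_p hd, mul_one])
  | zigzag_left i =>
    have hi := hl
    rw [wfits_sl_mul, wfits_sl, Piece.top_cap, Piece.bot_cap, Piece.top_cup] at hi
    rw [map_mul, ribbon_cap, ribbon_cup, vtx_zig_left hd, map_one]
    exact t.pp_mul_eq (i := i) (by omega) (by rw [p_mul_p hd, mul_one])
  | turnCrossing e i =>
    simp only [map_mul, ribbon_cap, ribbon_crossing, sgn_not, neg_neg]
    rw [vtx_mul_crs (kauffmanWeights e) hd]
  | turnVertex_left v p q i =>
    simp only [map_mul, ribbon_cap, ribbon_vertex, vtx_turn_left hd]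
  | turnVertex_right v p q i =>
    simp only [map_mul, ribbon_cap, ribbon_vertex, vtx_turn_right hd]
  | reidemeister_one e i =>
    simp only [map_mul, ribbon_cap, ribbon_cup, ribbon_crossing]
    rw [curl_eq (kauffmanWeights e) hd]
  | reidemeister_two e i =>
    have hi := (wfits_sl_mul.1 hl).1
    rw [Piece.top_crossing] at hi
    simp only [map_mul, ribbon_crossing, sgn_not, neg_neg, map_one, mul_one]
    rw [crs_mul_crs (kauffmanWeights e) hd, pp_mul_pp_of_le hd (Nat.zero_le i) (by omega)]
  | reidemeister_three e f i =>
    have hi : i < a := by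
      rw [wfits_mul] at hl
      obtain ⟨b, hl, -⟩ := hl
      have := (wfits_sl_mul.1 (show WFits a (sl (.crossing e) (i + 0) * _) b from hl)).1
      rw [Piece.top_crossing] at this
      omega
    simp only [map_mul, ribbon_crossing, ribbon_pass]
    exact t.pp_mul_eq hi (p_mul_cpass_mul_crs (kauffmanWeights e) (kauffmanWeights f) hd i)
  | slideVertex e v p q i =>
    have hi := (wfits_sl_mul.1 hl).1
    simp only [map_mul, ribbon_vertex, ribbon_pass]
    exact t.pp_mul_eq (i := i) (by omega) (p_mul_vtx_mul_cpass (kauffmanWeights e) hd i p q)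

theorem pp_mul_ribbon_yamadaRel {l : Word Unit} {r : Formal Unit} (h : YamadaRel l r) {a b : ℕ}
    (hl : WFits a l b) :
    t.pp dInv 0 a * t.ribbon l = t.pp dInv 0 a * evalWord t.ribbon r := by
  have hd := dInv_mul_d
  cases h with
  | crossing e i =>
    have hi := (wfits_sl.1 hl).1
    rw [Piece.top_crossing] at hi
    rw [ribbon_crossing, crs_eq (kauffmanWeights e) hd, pA_pow, pA_pow]
    simp only [map_sub, map_add, map_smul, map_one, evalWord_word, map_mul, ribbon_cup, ribbon_cap,
      ribbon_vertex, mul_sub, mul_add, mul_smul_comm, mul_one,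
      pp_mul_pp_of_le hd (Nat.zero_le i) (by omega : i + 2 ≤ 0 + a)]
    norm_num
  | edge p q i => simp [vtx_edge hd]
  | loop p i => simp [vtx_loop hd]
  | circle i => simp [vtx_circle hd]
  | valency_two i =>
    have hi := (wfits_sl.1 hl).1
    rw [Piece.top_vertex] at hi
    rw [ribbon_vertex, vtx_one_one hd, map_one]
    exact t.pp_mul_eq (i := i) (by omega) (by rw [p_mul_p hd, mul_one])
  | valency_one i => simp [vtx_one_zero hd]
  | valency_zero i => simp [vtx_zero_zero]

end CupCap

end

end RibbonGraph

/-! ### The stable embedding and the existence of the cabling homomorphism. -/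

namespace RibbonGraph

/-! ### The stable Temperley–Lieb algebra -/

theorem wfits_cup_cap {V : Type} {i a : ℕ} (h : i + 2 ≤ a) :
    WFits a (sl .cup i * sl .cap i : Word V) a := by
  rw [wfits_sl_mul, wfits_sl, Piece.top_cup, Piece.top_cap, Piece.bot_cup, Piece.bot_cap]; omega

theorem homogeneous_kauffmanRel : Homogeneous KauffmanRel := by
  rintro l r h a b hl
  cases h with
  | circle i =>
    rw [wfits_sl_mul, wfits_sl, Piece.top_cup, Piece.top_cap, Piece.bot_cup, Piece.bot_cap] at hl
    obtain rfl : a = b := by omega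
    exact Submodule.smul_mem _ _ (one_mem_hom _)
  | crossing e i =>
    rw [wfits_sl, Piece.top_crossing, Piece.bot_crossing] at hl
    obtain rfl : a = b := by omega
    exact add_mem (Submodule.smul_mem _ _ (one_mem_hom _))
      (Submodule.smul_mem _ _ (word_mem_hom (wfits_cup_cap hl.1)))

theorem homogeneous_yamadaRel : Homogeneous YamadaRel := by
  rintro l r h a b hl
  cases h with
  | crossing e i =>
    rw [wfits_sl, Piece.top_crossing, Piece.bot_crossing] at hl
    obtain rfl : a = b := by omega
    exact sub_mem (add_mem (Submodule.smul_mem _ _ (one_mem_hom _))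
      (Submodule.smul_mem _ _ (word_mem_hom (wfits_cup_cap hl.1))))
        (Submodule.smul_mem _ _ (word_mem_hom (wfits_sl.2 hl)))
  | edge p q i =>
    rw [wfits_sl_mul, wfits_sl] at hl
    simp only [Piece.top_vertex, Piece.bot_vertex] at hl
    refine sub_mem (word_mem_hom ?_) (Submodule.smul_mem _ _ (word_mem_hom ?_))
    · rw [wfits_sl, Piece.top_vertex, Piece.bot_vertex]; omega
    · rw [wfits_sl_mul, wfits_sl]; simp only [Piece.top_vertex, Piece.bot_vertex]; omega
  | loop p i =>
    rw [wfits_sl_mul, wfits_sl] at hl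
    simp only [Piece.top_vertex, Piece.bot_vertex, Piece.top_cup, Piece.bot_cup] at hl
    refine Submodule.smul_mem _ _ (word_mem_hom ?_)
    rw [wfits_sl, Piece.top_vertex, Piece.bot_vertex]; omega
  | circle i =>
    rw [wfits_sl_mul, wfits_sl, Piece.top_cup, Piece.top_cap, Piece.bot_cup, Piece.bot_cap] at hl
    obtain rfl : a = b := by omega
    exact Submodule.smul_mem _ _ (one_mem_hom _)
  | valency_two i =>
    rw [wfits_sl, Piece.top_vertex, Piece.bot_vertex] at hl
    obtain rfl : a = b := by omega
    exact one_mem_hom _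
  | valency_one i => exact zero_mem _
  | valency_zero i =>
    rw [wfits_sl, Piece.top_vertex, Piece.bot_vertex] at hl
    obtain rfl : a = b := by omega
    exact Submodule.smul_mem _ _ (one_mem_hom _)

/-- Two combinations of tangle words are stably equal if they are locally equal whenever there are
enough strands to their right. -/
def stableCon : RingCon (Formal Empty) where
  r x y := ∃ K, ∀ n a, K ≤ a → x - y ∈ locKer KauffmanRel n a
  iseqv :=
    { refl := fun x => ⟨0, fun n a _ => by rw [sub_self]; exact zero_mem _⟩
      symm := fun ⟨K, h⟩ => ⟨K, fun n a ha => by rw [← neg_sub]; exact neg_mem (h n a ha)⟩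
      trans := fun ⟨K, h⟩ ⟨K', h'⟩ => ⟨max K K', fun n a ha => by
        rw [← sub_add_sub_cancel]
        exact add_mem (h n a (le_of_max_le_left ha)) (h' n a (le_of_max_le_right ha))⟩ }
  add' := fun ⟨K, h⟩ ⟨K', h'⟩ => ⟨max K K', fun n a ha => by
    rw [add_sub_add_comm]
    exact add_mem (h n a (le_of_max_le_left ha)) (h' n a (le_of_max_le_right ha))⟩
  mul' := by
    rintro w x y z ⟨K, h⟩ ⟨K', h'⟩
    -- A left factor changes the number of strands; `exists_wfits` tells how many are needed on top
    -- for at least `K'` to arrive below it.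
    have key (v : Formal Empty) : ∃ L, ∀ n a, L ≤ a → v * (y - z) ∈ locKer KauffmanRel n a := by
      induction v using Formal.induction with
      | word u =>
        obtain ⟨L, hL⟩ := exists_wfits u K'
        refine ⟨L, fun n a ha => ?_⟩
        obtain ⟨b, hb, hu⟩ := hL a ha
        exact word_mul_mem_locKer hu (h' n b hb)
      | add v v' hv hv' =>
        obtain ⟨L, hL⟩ := hv
        obtain ⟨L', hL'⟩ := hv'
        refine ⟨max L L', fun n a ha => ?_⟩
        rw [add_mul]
        exact add_mem (hL n a (le_of_max_le_left ha)) (hL' n a (le_of_max_le_right ha))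
      | smul r v hv =>
        obtain ⟨L, hL⟩ := hv
        refine ⟨L, fun n a ha => ?_⟩
        rw [smul_mul_assoc]
        exact Submodule.smul_mem _ _ (hL n a ha)
    obtain ⟨L, hL⟩ := key x
    refine ⟨max K L, fun n a ha => ?_⟩
    rw [show w * y - x * z = (w - x) * y + x * (y - z) by rw [sub_mul, mul_sub]; abel]
    exact add_mem (mul_mem_locKer (h n a (le_of_max_le_left ha)) _) (hL n a (le_of_max_le_right ha))

/-- The algebra of tangles with infinitely many strands to the right. -/
abbrev StableTangle : Type := stableCon.Quotient

/-- The stable class of a combination of tangle words. -/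
def stable : Formal Empty →ₐ[Coeff] StableTangle where
  __ := stableCon.mk'
  commutes' _ := rfl

theorem stable_eq {x y : Formal Empty} (K : ℕ)
    (h : ∀ n a, K ≤ a → x - y ∈ locKer KauffmanRel n a) : stable x = stable y :=
  (RingCon.eq stableCon).2 ⟨K, h⟩

theorem stable_move {l r : Word Empty} (h : Move l r) (K : ℕ)
    (hf : ∀ a, K ≤ a → ∃ b, WFits a l b ∧ WFits a r b) : stable (word l) = stable (word r) :=
  stable_eq K fun _ a ha => by
    obtain ⟨b, hl, hr⟩ := hf a ha
    exact move_mem_locKer h hl hr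

/-- Cups and caps in the algebra of tangles with infinitely many strands to the right. -/
def stableCupCap : CupCap StableTangle d where
  c i := stable (word (sl .cap i))
  u i := stable (word (sl .cup i))
  c_succ_u i := by
    rw [← map_mul, ← word_mul, ← map_one stable, ← word_one]
    refine stable_move (.zigzag_right i) (i + 1) fun a ha => ⟨a, ?_, rfl⟩
    rw [wfits_sl_mul, wfits_sl, Piece.top_cup, Piece.top_cap, Piece.bot_cup, Piece.bot_cap]; omega
  c_u_succ i := by
    rw [← map_mul, ← word_mul, ← map_one stable, ← word_one]
    refine stable_move (.zigzag_left i) (i + 1) fun a ha => ⟨a, ?_, rfl⟩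
    rw [wfits_sl_mul, wfits_sl, Piece.top_cup, Piece.top_cap, Piece.bot_cup, Piece.bot_cap]; omega
  c_u i := by
    rw [← map_mul, ← word_mul, ← map_one stable, ← map_smul]
    refine stable_eq i fun n a ha => ?_
    have hl : WFits a (sl .cap i * sl .cup i : Word Empty) a := by
      rw [wfits_sl_mul, wfits_sl, Piece.top_cup, Piece.top_cap, Piece.bot_cup, Piece.bot_cap]; omega
    exact rel_mem_locKer (.circle i) hl (homogeneous_kauffmanRel _ _ (.circle i) _ _ hl)
  c_c i k := by
    rw [← map_mul, ← word_mul, ← map_mul, ← word_mul]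
    refine stable_move (.interchange .cap .cap i k) (i + k) fun a ha => ⟨a + 4, ?_, ?_⟩ <;>
    · rw [wfits_sl_mul, wfits_sl]
      simp only [Piece.top_cap, Piece.bot_cap]
      omega
  c_u_far i k := by
    rw [← map_mul, ← word_mul, ← map_mul, ← word_mul]
    refine stable_move (.interchange .cap .cup i k) (i + k + 2) fun a ha => ⟨a, ?_, ?_⟩ <;>
    · rw [wfits_sl_mul, wfits_sl]
      simp only [Piece.top_cup, Piece.top_cap, Piece.bot_cup, Piece.bot_cap]
      omega
  u_c_far i k := by
    rw [← map_mul, ← word_mul, ← map_mul, ← word_mul]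
    refine stable_move (.interchange .cup .cap i k) (i + k + 2) fun a ha => ⟨a, ?_, ?_⟩ <;>
    · rw [wfits_sl_mul, wfits_sl]
      simp only [Piece.top_cup, Piece.top_cap, Piece.bot_cup, Piece.bot_cap]
      omega
  u_u i k := by
    rw [← map_mul, ← word_mul, ← map_mul, ← word_mul]
    refine stable_move (.interchange .cup .cup i k) (i + k + 4) fun a ha => ⟨a - 4, ?_, ?_⟩ <;>
    · rw [wfits_sl_mul, wfits_sl]
      simp only [Piece.top_cup, Piece.bot_cup]
      omega

/-- The Kauffman relation determines the class of a crossing, so stable classes are evaluations on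
the stable cups and caps. Identities valid in every `CupCap` thus become identities of stable
classes. -/
theorem stable_word (w : Word Empty) : stable (word w) = stableCupCap.tangle w := by
  induction w using Word.induction with
  | one => rw [word_one, map_one, map_one]
  | mul x i w ih =>
    rw [word_mul, map_mul, ih, map_mul]
    congr 1
    cases x with
    | cap => rfl
    | cup => rfl
    | crossing e =>
      rw [CupCap.tangle_crossing, CupCap.x]
      change _ = _ • 1 + _ • (stable (word (sl .cup i)) * stable (word (sl .cap i)))
      rw [← map_mul, ← word_mul, ← map_one stable, ← map_smul, ← map_smul, ← map_add]
      refine stable_eq (i + 2) fun n a ha => ?_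
      have hl : WFits a (sl (.crossing e) i : Word Empty) a := by
        rw [wfits_sl, Piece.top_crossing, Piece.bot_crossing]; omega
      exact rel_mem_locKer (.crossing e i) hl
        (homogeneous_kauffmanRel _ _ (.crossing e i) _ _ hl)
    | vertex v => exact v.elim

theorem stable_apply (x : Formal Empty) : stable x = evalWord stableCupCap.tangle x := by
  induction x using Formal.induction with
  | word w => rw [stable_word, evalWord_word]
  | add x y hx hy => rw [map_add, hx, hy, map_add]
  | smul r x h => rw [map_smul, h, map_smul]

/-- Two strands to the right of a tangle may be removed: they can be closed up. -/
theorem mem_locKer_of_add_two {n a b : ℕ} {x : Formal Empty} (hx : x ∈ Hom Empty a b)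
    (h : x ∈ locKer KauffmanRel n (a + 2)) : x ∈ locKer KauffmanRel n a := by
  have hc : word (sl .cap a) * x - x * word (sl .cap b) ∈ locKer KauffmanRel n a := by
    clear h
    induction hx using Hom.induction with
    | word w hw => simpa only [word_mul] using cap_mul_word_mem_locKer hw
    | zero => simp
    | add x y _ _ hx hy => rw [mul_add, add_mul, add_sub_add_comm]; exact add_mem hx hy
    | smul r x _ h =>
      rw [mul_smul_comm, smul_mul_assoc, ← smul_sub]
      exact Submodule.smul_mem _ _ h
  have hd : x * (word (sl .cap b * sl .cup b) - d • 1) ∈ locKer KauffmanRel n a := by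
    clear hc h
    have hl : WFits b (sl .cap b * sl .cup b : Word Empty) b := by
      rw [wfits_sl_mul, wfits_sl, Piece.top_cup, Piece.top_cap, Piece.bot_cup, Piece.bot_cap]; omega
    induction hx using Hom.induction with
    | word w hw =>
      exact word_mul_mem_locKer hw (rel_mem_locKer (.circle b) hl
        (homogeneous_kauffmanRel _ _ (.circle b) _ _ hl))
    | zero => simp
    | add x y _ _ hx hy => rw [add_mul]; exact add_mem hx hy
    | smul r x _ h => rw [smul_mul_assoc]; exact Submodule.smul_mem _ _ h
  have h' : word (sl .cap a) * x * word (sl .cup b) ∈ locKer KauffmanRel n a :=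
    mul_mem_locKer (word_mul_mem_locKer (wfits_sl.2 ⟨by simp, by simp⟩) h) _
  -- The tangle with a cap above and a cup below, to its right, is locally the tangle followed by a
  -- circle, hence `d` times the tangle; the two subtracted terms are the local errors of these
  -- steps.
  have e : d • x = word (sl .cap a) * x * word (sl .cup b) -
      (word (sl .cap a) * x - x * word (sl .cap b)) * word (sl .cup b) -
      x * (word (sl .cap b * sl .cup b) - d • 1) := by
    rw [word_mul, sub_mul, mul_sub, mul_smul_comm, mul_one]
    simp only [mul_assoc]
    abel
  have hx' : d • x ∈ locKer KauffmanRel n a := by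
    rw [e]; exact sub_mem (sub_mem h' (mul_mem_locKer hc _)) hd
  rw [← one_smul Coeff x, ← dInv_mul_d, mul_smul]
  exact Submodule.smul_mem _ _ hx'

theorem WFits.add_right {V : Type} {a b : ℕ} {w : Word V} (h : WFits a w b) (k : ℕ) :
    WFits (a + k) w (b + k) := by
  induction w using Word.induction generalizing a with
  | one => rw [wfits_one.1 h]; rfl
  | mul x i w ih =>
    obtain ⟨hx, hw⟩ := wfits_sl_mul.1 h
    refine wfits_sl_mul.2 ⟨by omega, ?_⟩
    rw [show a + k - x.top + x.bot = a - x.top + x.bot + k by omega]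
    exact ih hw

theorem hom_add_right {V : Type} {a b : ℕ} (k : ℕ) : Hom V a b ≤ Hom V (a + k) (b + k) :=
  Submodule.span_mono fun _ ⟨w, hw, hx⟩ => ⟨w, hw.add_right k, hx⟩

theorem skeinLin_eq_zero_of_stable {n : ℕ} {x : Formal Empty} (hx : x ∈ Hom Empty n n)
    (h : ∃ K, ∀ m a, K ≤ a → x ∈ locKer KauffmanRel m a) : skeinLin KauffmanRel n x = 0 := by
  obtain ⟨K, hK⟩ := h
  have key (k : ℕ) : x ∈ locKer KauffmanRel n (n + 2 * k) → x ∈ locKer KauffmanRel n n := by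
    induction k with
    | zero => exact id
    | succ k ih => exact fun h => ih (mem_locKer_of_add_two (hom_add_right _ hx) h)
  exact skeinLin_eq_zero (key K (hK n _ (by omega)))

/-- The Temperley–Lieb algebra embeds into the algebra of tangles with infinitely many strands to
the right. -/
theorem exists_stableHom (n : ℕ) : ∃ f : TemperleyLieb n →ₐ[Coeff] StableTangle,
    Function.Injective f ∧ ∀ x ∈ Hom Empty n n, f (skeinLin KauffmanRel n x) = stable x := by
  obtain ⟨f, hf⟩ := exists_skeinLift homogeneous_kauffmanRel stableCupCap.tangle
    (fun _ _ => stableCupCap.tangle_move) (fun _ _ => stableCupCap.tangle_kauffmanRel) n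
  have hf' (x) (hx : x ∈ Hom Empty n n) : f (skeinLin KauffmanRel n x) = stable x := by
    rw [hf x hx, stable_apply]
  refine ⟨f, fun z z' hz => ?_, hf'⟩
  obtain ⟨x, hx, rfl⟩ := exists_skeinLin z
  obtain ⟨x', hx', rfl⟩ := exists_skeinLin z'
  rw [hf' x hx, hf' x' hx'] at hz
  exact skeinLin_eq_of_sub
    (skeinLin_eq_zero_of_stable (sub_mem hx hx') ((RingCon.eq stableCon).1 hz))

/-! ### The cabling homomorphism -/

theorem cable_mem_hom {w : Word Unit} {a b : ℕ} (h : WFits a w b) :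
    cable a w.toList ∈ Hom Empty (2 * a) (2 * b) := by
  have hp (m : ℕ) : projAll m ∈ Hom Empty (2 * m) (2 * m) := by
    have (k : ℕ) (hk : k ≤ m) :
        ((List.range k).map proj).prod ∈ Hom Empty (2 * m) (2 * m) := by
      induction k with
      | zero => exact one_mem_hom _
      | succ k ih =>
        rw [List.range_succ, List.map_append, List.prod_append, List.map_singleton,
          List.prod_singleton]
        exact mul_mem_hom (ih (by omega)) (sub_mem (one_mem_hom _)
          (Submodule.smul_mem _ _ (word_mem_hom (wfits_cup_cap (by omega)))))
    exact this m le_rfl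
  induction w using Word.induction generalizing a with
  | one => rw [wfits_one.1 h]; exact hp b
  | mul x i w ih =>
    obtain ⟨hx, hw⟩ := wfits_sl_mul.1 h
    refine mul_mem_hom (mul_mem_hom (hp a) (word_mem_hom ?_)) (ih hw)
    cases x with
    | cap =>
      simp only [double, wfits_sl_mul, wfits_sl, Piece.top_cap, Piece.bot_cap] at hx ⊢; omega
    | cup =>
      simp only [double, wfits_sl_mul, wfits_sl, Piece.top_cup, Piece.bot_cup] at hx ⊢; omega
    | crossing e =>
      simp only [Piece.top_crossing, Piece.bot_crossing] at hx ⊢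
      have (j : ℕ) (hj : j + 2 ≤ 2 * a) :
          WFits (2 * a) (sl (.crossing e) j : Word Empty) (2 * a) := by
        rw [wfits_sl, Piece.top_crossing, Piece.bot_crossing]; omega
      rw [show 2 * (a - 2 + 2) = 2 * a by omega]
      exact ((this _ (by omega)).mul ((this _ (by omega)).mul (this _ (by omega)))).mul
        (this _ (by omega))
    | vertex v p q =>
      simp only [Piece.top_vertex, Piece.bot_vertex] at hx ⊢
      obtain ⟨r, rfl⟩ := Nat.exists_eq_add_of_le hx
      have hu (k : ℕ) : WFits (2 * (i + 1 + k + r)) (sl .cup (2 * i + 1) ^ k : Word Empty)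
          (2 * (i + 1 + r)) := by
        induction k with
        | zero => rw [pow_zero]; exact wfits_one.2 (by omega)
        | succ k ih =>
          rw [pow_succ', wfits_sl_mul, Piece.top_cup, Piece.bot_cup]
          exact ⟨by omega, by convert ih using 1; omega⟩
      have hc (k : ℕ) : WFits (2 * (i + 1 + r)) (sl .cap (2 * i + 1) ^ k : Word Empty)
          (2 * (i + 1 + k + r)) := by
        induction k with
        | zero => rw [pow_zero]; exact wfits_one.2 (by omega)
        | succ k ih =>
          rw [pow_succ]
          refine ih.mul (wfits_sl.2 ?_)
          rw [Piece.top_cap, Piece.bot_cap]; omega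
      refine WFits.mul (b := 2 * (i + 1 + r)) ?_ ?_
      · split_ifs with h0
        · rw [wfits_sl, Piece.top_cap, Piece.bot_cap]; omega
        · convert hu (p - 1) using 1; omega
      · split_ifs with h0
        · rw [wfits_sl, Piece.top_cup, Piece.bot_cup]; omega
        · convert hc (q - 1) using 1; omega

theorem stable_cable {w : Word Unit} {a b : ℕ} (h : WFits a w b) :
    stable (cable a w.toList) = stableCupCap.pp dInv 0 a * stableCupCap.ribbon w := by
  rw [stable_apply, stableCupCap.evalWord_cable h]

theorem cabling_eq {n : ℕ} (D : Diagram Unit n) :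
    cabling D = skeinLin KauffmanRel (2 * n) (cable n (D : Word Unit).toList) := rfl

/-- The cabling map as a homomorphism on diagrams. -/
def cablingHom (n : ℕ) : Diagram Unit n →ₙ* TemperleyLieb (2 * n) where
  toFun := cabling
  map_mul' D E := by
    obtain ⟨f, hf, h⟩ := exists_stableHom (2 * n)
    have hD := mem_diagram.1 D.2
    have hE := mem_diagram.1 E.2
    -- After the embedding, the row between the two factors moves up through `D` and merges with the
    -- top row.
    refine hf ?_
    rw [map_mul, cabling_eq, cabling_eq, cabling_eq, h _ (cable_mem_hom hD), h _ (cable_mem_hom hE),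
      h _ (cable_mem_hom (mem_diagram.1 (D * E).2)), stable_cable hD, stable_cable hE,
      stable_cable (mem_diagram.1 (D * E).2), Submonoid.coe_mul, map_mul,
      ← mul_assoc (_ * _ : StableTangle) (CupCap.pp _ _ _ _),
      mul_assoc _ _ (CupCap.pp _ _ _ _), ← CupCap.pp_mul_ribbon _ hD,
      ← mul_assoc _ (CupCap.pp _ _ _ _), CupCap.pp_mul_pp dInv_mul_d, mul_assoc]

theorem cabling_eq_of_isotopy {n : ℕ} {D E : Diagram Unit n} (h : isotopy Unit n D E) :
    cabling D = cabling E := by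
  obtain ⟨f, hf, hs⟩ := exists_stableHom (2 * n)
  -- Isotopy is the least congruence containing the moves, and the kernel of a multiplicative map is
  -- a congruence.
  suffices isotopy Unit n ≤ Con.ker (cablingHom n) from this h
  refine Con.conGen_le.2 ?_
  rintro D E ⟨u, v, l, r, h, hD, hE⟩
  change cabling D = cabling E
  have hD' := mem_diagram.1 D.2
  have hE' := mem_diagram.1 E.2
  refine hf ?_
  rw [cabling_eq, cabling_eq, hs _ (cable_mem_hom hD'), hs _ (cable_mem_hom hE'),
    stable_cable hD', stable_cable hE', hD, hE]
  rw [hD] at hD'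
  obtain ⟨c, huc, -⟩ := wfits_mul.1 hD'
  obtain ⟨b, hu, hl⟩ := wfits_mul.1 huc
  simp only [map_mul, ← mul_assoc]
  rw [CupCap.pp_mul_ribbon _ hu, mul_assoc (stableCupCap.ribbon u),
    mul_assoc (stableCupCap.ribbon u), CupCap.pp_mul_ribbon_move _ h hl]
  simp only [mul_assoc]

/-- The cabling map on linear combinations of isotopy classes. -/
def isotopyCabling (n : ℕ) :
    MonoidAlgebra Coeff (IsotopyClass Unit n) →ₙₐ[Coeff] TemperleyLieb (2 * n) :=
  MonoidAlgebra.liftMagma Coeff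
    { toFun := fun D => Con.liftOn D cabling fun _ _ => cabling_eq_of_isotopy
      map_mul' := fun D E => by
        induction D using Con.induction_on
        induction E using Con.induction_on
        exact map_mul (cablingHom n) _ _ }

theorem isotopyCabling_single {n : ℕ} (D : Diagram Unit n) :
    isotopyCabling n (MonoidAlgebra.single (D : IsotopyClass Unit n) 1) = cabling D := by
  simp [isotopyCabling]

theorem isotopyCabling_linearize {n : ℕ} {x : Formal Unit} (hx : x ∈ Hom Unit n n)
    {f : TemperleyLieb (2 * n) →ₐ[Coeff] StableTangle}
    (hf : ∀ x ∈ Hom Empty (2 * n) (2 * n), f (skeinLin KauffmanRel (2 * n) x) = stable x) :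
    f (isotopyCabling n (linearize n x)) =
      stableCupCap.pp dInv 0 n * evalWord stableCupCap.ribbon x := by
  induction hx using Hom.induction with
  | word w hw =>
    rw [linearize_word (mem_diagram.2 hw), isotopyCabling_single, cabling_eq,
      hf _ (cable_mem_hom hw), stable_cable hw, evalWord_word]
  | zero => simp [linearize]
  | add x y _ _ hx hy => rw [linearize_add, map_add, map_add, hx, hy, map_add, mul_add]
  | smul r x _ h => rw [linearize_smul, map_smul, map_smul, h, map_smul, mul_smul_comm]

theorem isotopyCabling_eq_of_locally {n : ℕ} {x y : MonoidAlgebra Coeff (IsotopyClass Unit n)}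
    (h : Locally YamadaRel n x y) : isotopyCabling n x = isotopyCabling n y := by
  obtain ⟨f, hf, hs⟩ := exists_stableHom (2 * n)
  obtain ⟨u, v, l, r, h, hD, rfl, rfl⟩ := h
  obtain ⟨c, huc, hv⟩ := wfits_mul.1 (mem_diagram.1 hD)
  obtain ⟨b, hu, hl⟩ := wfits_mul.1 huc
  refine hf ?_
  rw [isotopyCabling_linearize (word_mem_hom hD) hs, isotopyCabling_linearize (mul_mem_hom
    (mul_mem_hom (word_mem_hom hu) (homogeneous_yamadaRel _ _ h _ _ hl)) (word_mem_hom hv)) hs]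
  simp only [map_mul, evalWord_word, ← mul_assoc]
  rw [CupCap.pp_mul_ribbon _ hu, mul_assoc (stableCupCap.ribbon u),
    mul_assoc (stableCupCap.ribbon u), CupCap.pp_mul_ribbon_yamadaRel _ h hl]
  simp only [mul_assoc]

/-- For `n ≥ 1` cabling does not preserve the unit, so it is not lifted as a unital algebra map.
Instead equality in the quotient is unfolded into a chain of elementary steps, each respected by a
linear multiplicative map. -/
theorem isotopyCabling_eq_of_mkAlgHom_eq {n : ℕ} {x y : MonoidAlgebra Coeff (IsotopyClass Unit n)}
    (h : RingQuot.mkAlgHom Coeff (Locally YamadaRel n) x =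
      RingQuot.mkAlgHom Coeff (Locally YamadaRel n) y) :
    isotopyCabling n x = isotopyCabling n y := by
  have hR {x y} (h : RingQuot.Rel (Locally YamadaRel n) x y) :
      isotopyCabling n x = isotopyCabling n y := by
    induction h with
    | of h => exact isotopyCabling_eq_of_locally h
    | add_left _ ih => rw [map_add, map_add, ih]
    | mul_left _ ih => rw [map_mul, map_mul, ih]
    | mul_right _ ih => rw [map_mul, map_mul, ih]
  replace h : RingQuot.mkRingHom (Locally YamadaRel n) x = RingQuot.mkRingHom _ y := by
    rw [← RingQuot.mkAlgHom_coe Coeff]; exact h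
  rw [RingQuot.mkRingHom_def] at h
  have h' := Quot.eqvGen_exact (RingQuot.mk.inj h)
  clear h
  induction h' with
  | rel x y h => exact hR h
  | refl => rfl
  | symm x y _ ih => exact ih.symm
  | trans x y z _ _ ih ih' => exact ih.trans ih'

/-- The homomorphism that is induced by the cabling map. -/
theorem exists_cablingHom (n : ℕ) : ∃ Φ : GraphAlgebra n →ₙₐ[Coeff] TemperleyLieb (2 * n),
    ∀ D : Diagram Unit n, Φ (graphClass D) = cabling D := by
  have hs := RingQuot.mkAlgHom_surjective Coeff (Locally (V := Unit) YamadaRel n)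
  let g := Function.surjInv hs
  have hg := Function.surjInv_eq hs
  -- The value does not depend on the representative chosen by `g`.
  have key (x) : isotopyCabling n (g (RingQuot.mkAlgHom Coeff _ x)) = isotopyCabling n x :=
    isotopyCabling_eq_of_mkAlgHom_eq (hg _)
  refine ⟨{ toFun := fun z => isotopyCabling n (g z)
            map_smul' := ?_
            map_zero' := ?_
            map_add' := ?_
            map_mul' := ?_ }, ?_⟩
  · intro r z
    obtain ⟨x, rfl⟩ := hs z
    rw [← map_smul, key, key, map_smul]; rfl
  · rw [← map_zero (RingQuot.mkAlgHom Coeff (Locally (V := Unit) YamadaRel n)), key, map_zero]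
  · intro z z'
    obtain ⟨x, rfl⟩ := hs z
    obtain ⟨x', rfl⟩ := hs z'
    rw [← map_add, key, key, key, map_add]
  · intro z z'
    obtain ⟨x, rfl⟩ := hs z
    obtain ⟨x', rfl⟩ := hs z'
    rw [← map_mul, key, key, key, map_mul]
  · intro D
    change isotopyCabling n (g (RingQuot.mkAlgHom Coeff _ _)) = _
    rw [key, linearize_word D.2, isotopyCabling_single]

end RibbonGraph

/-! ### The calculus of vertices up to local equality in the graph algebra. -/

namespace RibbonGraph

/-! ### Local equality of graph diagrams -/

/-- Two combinations of words are locally equal if they are interchangeable inside any diagram with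
`n` ends on top and `n` ends at the bottom. -/
def localCon (n : ℕ) : RingCon (Formal Unit) where
  r x y := ∀ a, x - y ∈ locKer YamadaRel n a
  iseqv :=
    { refl := fun x a => by rw [sub_self]; exact zero_mem _
      symm := fun h a => by rw [← neg_sub]; exact neg_mem (h a)
      trans := fun h h' a => by rw [← sub_add_sub_cancel]; exact add_mem (h a) (h' a) }
  add' := fun h h' a => by rw [add_sub_add_comm]; exact add_mem (h a) (h' a)
  mul' := by
    rintro w x y z h h' a
    have key (v : Formal Unit) : ∀ a, v * (y - z) ∈ locKer YamadaRel n a := by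
      induction v using Formal.induction with
      | word u =>
        intro a
        by_cases hu : ∃ b, WFits a u b
        · obtain ⟨b, hu⟩ := hu
          exact word_mul_mem_locKer hu (h' b)
        · exact mul_mem_locKer (mem_locKer_of_not_wfits (not_exists.1 hu)) _
      | add v v' hv hv' => intro a; rw [add_mul]; exact add_mem (hv a) (hv' a)
      | smul r v hv => intro a; rw [smul_mul_assoc]; exact Submodule.smul_mem _ _ (hv a)
    rw [show w * y - x * z = (w - x) * y + x * (y - z) by rw [sub_mul, mul_sub]; abel]
    exact add_mem (mul_mem_locKer (h a) _) (key x a)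

/-- The algebra of graph words up to local equality. -/
def LocalGraph (n : ℕ) : Type := (localCon n).Quotient

namespace LocalGraph

variable {n : ℕ}

instance : Ring (LocalGraph n) := inferInstanceAs (Ring (localCon n).Quotient)

instance : Algebra Coeff (LocalGraph n) := inferInstanceAs (Algebra Coeff (localCon n).Quotient)

/-- The class of a combination of graph words. -/
def mk (n : ℕ) : Formal Unit →ₐ[Coeff] LocalGraph n where
  __ := (localCon n).mk'
  commutes' _ := rfl

theorem mk_eq_mk {x y : Formal Unit} : mk n x = mk n y ↔ ∀ a, x - y ∈ locKer YamadaRel n a :=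
  RingCon.eq (localCon n)

theorem mk_eq_of_move {l r : Word Unit} (h : Move l r) (hf : ∀ a b, WFits a l b ↔ WFits a r b) :
    mk n (word l) = mk n (word r) :=
  mk_eq_mk.2 fun a => by
    by_cases hl : ∃ b, WFits a l b
    · obtain ⟨b, hl⟩ := hl
      exact move_mem_locKer h hl ((hf a b).1 hl)
    · rw [not_exists] at hl
      exact sub_mem (mem_locKer_of_not_wfits hl)
        (mem_locKer_of_not_wfits fun b hb => hl b ((hf a b).2 hb))

theorem mk_eq_of_rel {l : Word Unit} {r : Formal Unit} (h : YamadaRel l r)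
    (hr : ∀ a, (∀ b, ¬ WFits a l b) → r ∈ locKer YamadaRel n a) : mk n (word l) = mk n r :=
  mk_eq_mk.2 fun a => by
    by_cases hl : ∃ b, WFits a l b
    · obtain ⟨b, hl⟩ := hl
      exact rel_mem_locKer h hl (homogeneous_yamadaRel _ _ h _ _ hl)
    · rw [not_exists] at hl
      exact sub_mem (mem_locKer_of_not_wfits hl) (hr a hl)

variable (n)

/-- The class of a slice. -/
def S (x : Piece Unit) (i : ℕ) : LocalGraph n := mk n (word (sl x i))

/-- The class of a vertex. -/
abbrev V (p q i : ℕ) : LocalGraph n := S n (.vertex () p q) i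

/-- The idempotent which says that there are at least `k` strands. -/
def e (k : ℕ) : LocalGraph n := dInv • V n 0 0 k

variable {n}

theorem not_wfits_sl {x : Piece Unit} {i a : ℕ} (h : a < i + x.top) (b : ℕ) :
    ¬ WFits a (sl x i) b :=
  fun h' => by have := (wfits_sl.1 h').1; omega

theorem not_wfits_sl_mul_sl {x y : Piece Unit} {i j a : ℕ}
    (h : a < i + x.top ∨ a - x.top + x.bot < j + y.top)
    (b : ℕ) : ¬ WFits a (sl x i * sl y j) b :=
  fun h' => by rw [wfits_sl_mul, wfits_sl] at h'; omega

theorem mk_e (k : ℕ) : mk n (dInv • word (sl (.vertex () 0 0) k)) = e n k := map_smul _ _ _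

theorem e_sub_one_mem {a k : ℕ} (h : k ≤ a) :
    dInv • word (sl (.vertex () 0 0) k) - 1 ∈ locKer YamadaRel n a := by
  have hl : WFits a (sl (.vertex () 0 0) k) a := by
    rw [wfits_sl, Piece.top_vertex, Piece.bot_vertex]; omega
  have h := rel_mem_locKer (n := n) (YamadaRel.valency_zero k) hl
    (homogeneous_yamadaRel _ _ (.valency_zero k) _ _ hl)
  have := Submodule.smul_mem _ dInv h
  rwa [smul_sub, smul_smul, dInv_mul_d, one_smul] at this

/-- Words that do not fit are locally zero. Erasing a piece therefore yields the idempotent `e k`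
instead of `1`, because the piece demanded `k` strands. -/
theorem mk_eq_e {l : Word Unit} {k : ℕ} (h : ∀ a, k ≤ a → word l - 1 ∈ locKer YamadaRel n a)
    (h' : ∀ a, a < k → ∀ b, ¬ WFits a l b) : mk n (word l) = e n k := by
  rw [← mk_e, mk_eq_mk]
  intro a
  rcases le_or_gt k a with hk | hk
  · rw [← sub_sub_sub_cancel_right _ _ (1 : Formal Unit)]
    exact sub_mem (h a hk) (e_sub_one_mem hk)
  · exact sub_mem (mem_locKer_of_not_wfits (h' a hk)) (Submodule.smul_mem _ _
      (mem_locKer_of_not_wfits (not_wfits_sl (by simpa using hk))))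

theorem e_mul_S {x : Piece Unit} {i k : ℕ} (h : k ≤ i + x.top) : e n k * S n x i = S n x i := by
  rw [← mk_e, S, ← map_mul, mk_eq_mk]
  intro a
  rcases le_or_gt (i + x.top) a with hi | hi
  · have := mul_mem_locKer (e_sub_one_mem (n := n) (h.trans hi)) (word (sl x i))
    rwa [sub_mul, one_mul] at this
  · refine sub_mem ?_ (mem_locKer_of_not_wfits (not_wfits_sl hi))
    rw [smul_mul_assoc, ← word_mul]
    exact Submodule.smul_mem _ _ (mem_locKer_of_not_wfits (not_wfits_sl_mul_sl (.inr
      (by simpa using hi))))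

theorem e_mul_e {k l : ℕ} (h : k ≤ l) : e n k * e n l = e n l := by
  rw [e.eq_1 n l, mul_smul_comm, e_mul_S (by simpa using h)]

theorem S_mul_e {x : Piece Unit} {i k : ℕ} (h : k ≤ i + x.bot) : S n x i * e n k = S n x i := by
  rw [← mk_e, S, ← map_mul, mk_eq_mk]
  intro a
  rcases le_or_gt (i + x.top) a with hi | hi
  · have := word_mul_mem_locKer (wfits_sl.2 ⟨hi, rfl⟩)
      (e_sub_one_mem (n := n) (k := k) (a := a - x.top + x.bot) (by omega))
    rwa [mul_sub, mul_one] at this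
  · have := mem_locKer_of_not_wfits (rel := YamadaRel) (n := n) (not_wfits_sl hi)
    exact sub_mem (mul_mem_locKer this _) this

theorem interchange (x y : Piece Unit) (i k : ℕ) :
    S n x i * S n y (i + x.bot + k) = S n y (i + x.top + k) * S n x i := by
  simp only [S, ← map_mul, ← word_mul]
  refine mk_eq_of_move (.interchange x y i k) fun a b => ?_
  rw [wfits_sl_mul, wfits_sl, wfits_sl_mul, wfits_sl]
  omega

theorem S_mul_e_add (x : Piece Unit) (i k : ℕ) :
    S n x i * e n (i + x.bot + k) = e n (i + x.top + k) * S n x i := by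
  rw [e, e, mul_smul_comm, smul_mul_assoc, interchange]

theorem V_zero_zero (k : ℕ) : V n 0 0 k = d • e n k := by
  rw [e, smul_smul, mul_comm, dInv_mul_d, one_smul]

theorem V_one_one (k : ℕ) : V n 1 1 k = e n (k + 1) := by
  refine mk_eq_e (fun a ha => ?_) fun a ha => not_wfits_sl ha
  have hl : WFits a (sl (.vertex () 1 1) k) a := by
    rw [wfits_sl, Piece.top_vertex, Piece.bot_vertex]; omega
  exact rel_mem_locKer (.valency_two k) hl (one_mem_hom a)

theorem V_one_zero (k : ℕ) : V n 1 0 k = 0 := by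
  rw [← map_zero (mk n)]
  exact mk_eq_of_rel (.valency_one k) fun a _ => zero_mem _

theorem cap_succ_mul_cup (i : ℕ) : S n .cap (i + 1) * S n .cup i = e n (i + 1) := by
  simp only [S, ← map_mul, ← word_mul]
  refine mk_eq_e (fun a ha => ?_) fun a ha => not_wfits_sl_mul_sl (.inl ha)
  refine move_mem_locKer (.zigzag_right i) (b := a) ?_ rfl
  rw [wfits_sl_mul, wfits_sl, Piece.top_cup, Piece.top_cap, Piece.bot_cup, Piece.bot_cap]; omega

theorem cap_mul_cup_succ (i : ℕ) : S n .cap i * S n .cup (i + 1) = e n (i + 1) := by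
  simp only [S, ← map_mul, ← word_mul]
  refine mk_eq_e (fun a ha => ?_) fun a ha => not_wfits_sl_mul_sl (.inr ?_)
  · refine move_mem_locKer (.zigzag_left i) (b := a) ?_ rfl
    rw [wfits_sl_mul, wfits_sl, Piece.top_cup, Piece.top_cap, Piece.bot_cup, Piece.bot_cap]; omega
  · rw [Piece.top_cup, Piece.top_cap, Piece.bot_cap]; omega

/-! ### Turning vertices -/

theorem cap_mul_V (p q i : ℕ) : S n .cap i * V n (p + 1) q (i + 1) = V n p (q + 1) i := by
  simp only [V, S, ← map_mul, ← word_mul]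
  refine mk_eq_of_move (.turnVertex_left () p q i) fun a b => ?_
  rw [wfits_sl_mul, wfits_sl, wfits_sl]
  simp only [Piece.top_cap, Piece.bot_cap, Piece.top_vertex, Piece.bot_vertex]
  omega

theorem cap_add_mul_V (p q i : ℕ) : S n .cap (i + p) * V n (p + 1) q i = V n p (q + 1) i := by
  simp only [V, S, ← map_mul, ← word_mul]
  refine mk_eq_of_move (.turnVertex_right () p q i) fun a b => ?_
  rw [wfits_sl_mul, wfits_sl, wfits_sl]
  simp only [Piece.top_cap, Piece.bot_cap, Piece.top_vertex, Piece.bot_vertex]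
  omega

/-- Bending a leg up undoes bending it down: the cup moves up past the vertex and cancels the cap by
a zigzag. -/
theorem V_mul_cup_add (p q i : ℕ) : V n p (q + 1) i * S n .cup (i + q) = V n (p + 1) q i := by
  have h := interchange (n := n) (.vertex () (p + 1) q) .cup i 0
  simp only [Piece.top_vertex, Piece.bot_vertex, add_zero] at h
  rw [← cap_add_mul_V, mul_assoc, h, ← mul_assoc, ← add_assoc, cap_mul_cup_succ]
  exact e_mul_S (by simp [add_assoc])

theorem V_mul_cup (p q i : ℕ) : V n p (q + 1) (i + 1) * S n .cup i = V n (p + 1) q i := by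
  have h := interchange (n := n) .cup (.vertex () (p + 1) q) i 0
  simp only [Piece.top_cup, Piece.bot_cup, add_zero] at h
  rw [← cap_mul_V, mul_assoc, ← h, ← mul_assoc, cap_succ_mul_cup]
  exact e_mul_S (by simp)

theorem V_zero_one (k : ℕ) : V n 0 1 k = 0 := by rw [← cap_mul_V, V_one_zero, mul_zero]

/-- A cap is a turned two-valent vertex, so apart from crossings every slice can be treated as a
vertex. -/
theorem cap_eq_V (i : ℕ) : S n .cap i = V n 0 2 i := by
  rw [← cap_mul_V, V_one_one]
  exact (S_mul_e le_rfl).symm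

theorem cup_eq_V (i : ℕ) : S n .cup i = V n 2 0 i := by
  rw [← V_mul_cup_add, V_one_one]
  exact (e_mul_S (by simp)).symm

/-! ### Contracting edges -/

theorem V_mul_V_zero (p q k : ℕ) :
    V n p 1 k * V n 1 q k + dInv • (V n p 0 k * V n 0 q k) = V n p q k := by
  rw [← eq_sub_iff_add_eq]
  simp only [V, S, ← map_mul, ← word_mul, ← map_smul, ← map_sub]
  refine mk_eq_of_rel (.edge p q k) fun a h => ?_
  have h : a < k + p := by
    by_contra h'
    refine h (a - p + q) ?_
    rw [wfits_sl_mul, wfits_sl]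
    simp only [Piece.top_vertex, Piece.bot_vertex]
    omega
  exact sub_mem (mem_locKer_of_not_wfits (not_wfits_sl h)) (Submodule.smul_mem _ _
    (mem_locKer_of_not_wfits (not_wfits_sl_mul_sl (.inl h))))

/-- The contracted edge joins the last lower leg of the upper vertex to the first upper leg of the
lower one. Multiplying the basic relation by caps and cups bends the other legs into place: cups for
`c`, then caps for `b`. -/
theorem V_mul_V_add (a b c f k : ℕ) :
    V n a (b + 1) k * V n (c + 1) f (k + b) + dInv • (V n a b k * V n c f (k + b)) =
      V n (a + c) (b + f) k := by
  induction b generalizing a k with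
  | zero =>
    induction c generalizing f with
    | zero => simpa using V_mul_V_zero a f k
    | succ c ih =>
      have := congrArg (· * S n .cup (k + f)) (ih (f + 1))
      simpa only [add_mul, smul_mul_assoc, mul_assoc, V_mul_cup_add, zero_add, add_zero,
        ← add_assoc] using this
  | succ b ih =>
    have := congrArg (S n .cap k * ·) (ih (a + 1) (k + 1))
    simp only [mul_add, mul_smul_comm, ← mul_assoc, cap_mul_V] at this
    rw [show k + 1 + b = k + (b + 1) by omega, show a + 1 + c = a + c + 1 by omega, cap_mul_V,
      show b + f + 1 = b + 1 + f by omega] at this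
    exact this

theorem V_add_mul_V (a b c f k : ℕ) :
    V n a (b + 1) (k + c) * V n (c + 1) f k + dInv • (V n a b (k + c) * V n c f k) =
      V n (c + a) (f + b) k := by
  induction b generalizing a with
  | zero =>
    induction c generalizing f k with
    | zero => simpa using V_mul_V_zero a f k
    | succ c ih =>
      have := congrArg (· * S n .cup k) (ih (f + 1) (k + 1))
      simp only [add_mul, smul_mul_assoc, mul_assoc, V_mul_cup, add_zero] at this
      rw [show k + 1 + c = k + (c + 1) by omega, show c + a + 1 = c + 1 + a by omega] at this
      exact this
  | succ b ih =>
    have := congrArg (S n .cap (k + c + a) * ·) (ih (a + 1))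
    simp only [mul_add, mul_smul_comm, ← mul_assoc, cap_add_mul_V] at this
    rw [← add_assoc c a 1, add_assoc k c a, cap_add_mul_V] at this
    exact this

theorem V_mul_cup_self (p q k : ℕ) :
    V n p (q + 2) k * S n .cup (k + q) = (d - dInv) • V n p q k := by
  induction q generalizing p k with
  | zero =>
    simp only [V, S, ← map_mul, ← word_mul, ← map_smul]
    refine mk_eq_of_rel (.loop p k) fun a h => Submodule.smul_mem _ _ (mem_locKer_of_not_wfits
      (not_wfits_sl ?_))
    by_contra h'
    refine h (a - p) ?_
    rw [wfits_sl_mul, wfits_sl]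
    simp only [Piece.top_vertex, Piece.bot_vertex, Piece.top_cup, Piece.bot_cup] at h' ⊢
    omega
  | succ q ih =>
    have := congrArg (S n .cap k * ·) (ih (p + 1) (k + 1))
    simp only [mul_smul_comm, ← mul_assoc, cap_mul_V] at this
    rwa [show k + 1 + q = k + (q + 1) by omega] at this

/-- Of two parallel edges one is contracted or deleted; contraction turns the other edge into a
removable loop. -/
theorem V_two_mul_V_two (p q k : ℕ) :
    V n p 2 k * V n 2 q k = (d - dInv) • V n p q k - dInv • (V n p 1 k * V n 1 q k) := by
  have h := V_add_mul_V (n := n) p 1 0 (q + 1) k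
  rw [← eq_sub_iff_add_eq] at h
  have h' := congrArg (· * S n .cup (k + q)) h
  simp only [mul_assoc, V_mul_cup_add, sub_mul, smul_mul_assoc, add_zero, zero_add,
    V_mul_cup_self] at h'
  exact h'

/-- The factor `e n (i + 2)` is there for the scalar term, which alone would survive on fewer than
`i + 2` strands. -/
theorem S_crossing (c : Bool) (i : ℕ) : S n (.crossing c) i =
    e n (i + 2) * (pA (4 * sgn c) • 1 + pA (-(4 * sgn c)) • (S n .cup i * S n .cap i)
      - d • V n 2 2 i) := by
  simp only [← mk_e, V, S, ← map_mul, ← word_mul, ← map_one (mk n), ← map_smul, ← map_sub,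
    ← map_add]
  rw [mk_eq_mk]
  intro a
  rcases le_or_gt (i + 2) a with h | h
  · have hl : WFits a (sl (.crossing c) i : Word Unit) a := by
      rw [wfits_sl, Piece.top_crossing, Piece.bot_crossing]; omega
    have h₁ := rel_mem_locKer (n := n) (YamadaRel.crossing c i) hl
      (homogeneous_yamadaRel _ _ (.crossing c i) _ _ hl)
    have h₂ := sub_mem h₁ (mul_mem_locKer (e_sub_one_mem (n := n) h)
      (pA (4 * sgn c) • 1 + pA (-(4 * sgn c)) • word (sl .cup i * sl .cap i)
          - d • word (sl (.vertex () 2 2) i)))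
    rwa [sub_mul _ (1 : Formal Unit), one_mul, sub_sub_sub_cancel_right] at h₂
  · refine sub_mem (mem_locKer_of_not_wfits (not_wfits_sl h)) (mul_mem_locKer
      (Submodule.smul_mem _ _ (mem_locKer_of_not_wfits (not_wfits_sl ?_))) _)
    simpa using h

end LocalGraph

end RibbonGraph

/-! ### The representation on colourings that inverts cabling. -/

namespace RibbonGraph

/-! ### Cups and caps from vertices

A vertex with `p` upper and `q` lower legs is drawn as a fat region with `2 * p` strands on top of
its boundary and `2 * q` strands at the bottom. The regions between the fat strands are the other
colour class of the regions of a tangle diagram. -/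

/-- Fat vertices at all positions, subject to the contraction of edges. -/
structure FatVertices {R : Type*} [CommRing R] (A : Type*) [Ring A] [Algebra R A] (δ : R) where
  F : ℕ → ℕ → ℕ → A
  interchange (p q p' q' i k : ℕ) :
    F p q i * F p' q' (i + q + k) = F p' q' (i + p + k) * F p q i
  fuse_right (p q r t i : ℕ) : F p (q + 1) i * F (r + 1) t (i + q) = F (p + r) (q + t) i
  fuse_left (p q r t i : ℕ) : F p (q + 1) (i + r) * F (r + 1) t i = F (r + p) (t + q) i
  one_one (i : ℕ) : F 1 1 i = 1
  zero_zero (i : ℕ) : F 0 0 i = δ • 1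
  two_two (i : ℕ) : F 1 2 i * F 2 1 i = δ • 1

namespace FatVertices

variable {R : Type*} [CommRing R] {A : Type*} [Ring A] [Algebra R A] {δ : R} (t : FatVertices A δ)

/-- The elementary pieces: at an even position a fat vertex, at an odd position a vertex that
connects two adjacent fat strands. -/
def el (p q j : ℕ) : A := if j % 2 = 0 then t.F p q (j / 2) else t.F (p + 1) (q + 1) (j / 2)

theorem el_even (p q m : ℕ) : t.el p q (2 * m) = t.F p q m := by
  rw [el, if_pos (by omega), show 2 * m / 2 = m by omega]

theorem el_odd (p q m : ℕ) : t.el p q (2 * m + 1) = t.F (p + 1) (q + 1) m := by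
  rw [el, if_neg (by omega), show (2 * m + 1) / 2 = m by omega]

theorem el_mul_el (p q p' q' i k : ℕ) :
    t.el p q i * t.el p' q' (i + 2 * q + k) = t.el p' q' (i + 2 * p + k) * t.el p q i := by
  obtain ⟨m, rfl | rfl⟩ := Nat.even_or_odd' i <;> obtain ⟨l, rfl | rfl⟩ := Nat.even_or_odd' k
  · rw [show 2 * m + 2 * q + 2 * l = 2 * (m + q + l) by ring,
      show 2 * m + 2 * p + 2 * l = 2 * (m + p + l) by ring]
    simp only [el_even, t.interchange]
  · rw [show 2 * m + 2 * q + (2 * l + 1) = 2 * (m + q + l) + 1 by ring,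
      show 2 * m + 2 * p + (2 * l + 1) = 2 * (m + p + l) + 1 by ring]
    simp only [el_even, el_odd, t.interchange]
  · rw [show 2 * m + 1 + 2 * q + 2 * l = 2 * (m + q + l) + 1 by ring,
      show 2 * m + 1 + 2 * p + 2 * l = 2 * (m + p + l) + 1 by ring]
    simp only [el_odd]
    rcases l with _ | l
    -- Two adjacent pieces at odd positions share a fat strand, so they do not simply commute; both
    -- orders fuse to the same vertex.
    · rw [add_zero, add_zero, t.fuse_right, t.fuse_left]
      congr 1 <;> ring
    · rw [show m + q + (l + 1) = m + (q + 1) + l by ring,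
        show m + p + (l + 1) = m + (p + 1) + l by ring, t.interchange]
  · rw [show 2 * m + 1 + 2 * q + (2 * l + 1) = 2 * (m + (q + 1) + l) by ring,
      show 2 * m + 1 + 2 * p + (2 * l + 1) = 2 * (m + (p + 1) + l) by ring]
    simp only [el_even, el_odd, t.interchange]

/-- The cups and caps among the elementary pieces. -/
def cupCap : CupCap A δ where
  c := t.el 0 1
  u := t.el 1 0
  c_succ_u i := by
    obtain ⟨m, rfl | rfl⟩ := Nat.even_or_odd' i
    · rw [el_odd, el_even]
      exact (t.fuse_left 1 1 0 0 m).trans (t.one_one m)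
    · rw [show 2 * m + 1 + 1 = 2 * (m + 1) by ring, el_odd, el_even]
      exact (t.fuse_left 0 0 1 1 m).trans (t.one_one m)
  c_u_succ i := by
    obtain ⟨m, rfl | rfl⟩ := Nat.even_or_odd' i
    · rw [el_odd, el_even]
      exact (t.fuse_right 0 0 1 1 m).trans (t.one_one m)
    · rw [show 2 * m + 1 + 1 = 2 * (m + 1) by ring, el_odd, el_even]
      exact (t.fuse_right 1 1 0 0 m).trans (t.one_one m)
  c_u i := by
    obtain ⟨m, rfl | rfl⟩ := Nat.even_or_odd' i
    · rw [el_even, el_even]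
      exact (t.fuse_right 0 0 0 0 m).trans (t.zero_zero m)
    · rw [el_odd, el_odd]
      exact t.two_two m
  c_c i k := t.el_mul_el 0 1 0 1 i k
  c_u_far i k := t.el_mul_el 0 1 1 0 i k
  u_c_far i k := t.el_mul_el 1 0 0 1 i k
  u_u i k := t.el_mul_el 1 0 1 0 i k

theorem cupCap_c_even (m : ℕ) : t.cupCap.c (2 * m) = t.F 0 1 m := t.el_even 0 1 m
theorem cupCap_c_odd (m : ℕ) : t.cupCap.c (2 * m + 1) = t.F 1 2 m := t.el_odd 0 1 m
theorem cupCap_u_even (m : ℕ) : t.cupCap.u (2 * m) = t.F 1 0 m := t.el_even 1 0 m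
theorem cupCap_u_odd (m : ℕ) : t.cupCap.u (2 * m + 1) = t.F 2 1 m := t.el_odd 1 0 m

theorem cupCap_upper (p m : ℕ) : t.cupCap.upper (2 * m) p = t.F p 1 m := by
  induction p with
  | zero => rw [CupCap.upper_zero, cupCap_c_even]
  | succ p ih =>
    rw [CupCap.upper_succ, ih, cupCap_u_odd]
    exact (t.fuse_right p 0 1 1 m)

theorem cupCap_lower (q m : ℕ) : t.cupCap.lower (2 * m) q = t.F 1 q m := by
  induction q with
  | zero => rw [CupCap.lower_zero, cupCap_u_even]
  | succ q ih =>
    rw [CupCap.lower_succ, ih, cupCap_c_odd]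
    exact (t.fuse_left 1 1 0 q m)

/-- Its cups and caps fuse one after another into a single fat vertex; this identifies the cabling
of a vertex in the representation. -/
theorem cupCap_dv (p q m : ℕ) : t.cupCap.dv (2 * m) p q = t.F p q m := by
  rw [CupCap.dv, cupCap_upper, cupCap_lower]
  exact (t.fuse_right p 0 0 q m).trans (by rw [add_zero, zero_add])

end FatVertices

/-! ### Sums over colourings -/

section wsum

variable {M : Type*} [AddCommGroup M] [Module Coeff M]

/-- The sum of `f` over all lists of `q` Booleans, where each `false` has weight `d⁻¹`. -/
def wsum : ℕ → (List Bool → M) → M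
  | 0, f => f []
  | q + 1, f => wsum q (fun B => f (true :: B)) + dInv • wsum q fun B => f (false :: B)

theorem wsum_zero (f : List Bool → M) : wsum 0 f = f [] := rfl

theorem wsum_succ (q : ℕ) (f : List Bool → M) : wsum (q + 1) f =
    wsum q (fun B => f (true :: B)) + dInv • wsum q fun B => f (false :: B) := rfl

theorem wsum_congr {q : ℕ} {f g : List Bool → M} (h : ∀ B, B.length = q → f B = g B) :
    wsum q f = wsum q g := by
  induction q generalizing f g with
  | zero => exact h [] rfl
  | succ q ih =>
    rw [wsum_succ, wsum_succ, ih fun B hB => h _ (by simp [hB]), ih fun B hB => h _ (by simp [hB])]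

theorem wsum_add (q : ℕ) (f g : List Bool → M) :
    wsum q (fun B => f B + g B) = wsum q f + wsum q g := by
  induction q generalizing f g with
  | zero => rfl
  | succ q ih => rw [wsum_succ, wsum_succ, wsum_succ, ih, ih, smul_add]; abel

theorem wsum_smul (q : ℕ) (r : Coeff) (f : List Bool → M) :
    wsum q (fun B => r • f B) = r • wsum q f := by
  induction q generalizing f with
  | zero => rfl
  | succ q ih => rw [wsum_succ, wsum_succ, ih, ih, smul_add, smul_comm]

theorem mul_wsum {A : Type*} [Ring A] [Algebra Coeff A] (q : ℕ) (x : A) (f : List Bool → A) :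
    x * wsum q f = wsum q fun B => x * f B := by
  induction q generalizing f with
  | zero => rfl
  | succ q ih => rw [wsum_succ, wsum_succ, ← ih, ← ih, mul_add, mul_smul_comm]

theorem wsum_append (p q : ℕ) (f : List Bool → M) :
    wsum (p + q) f = wsum p fun B => wsum q fun C => f (B ++ C) := by
  induction p generalizing f with
  | zero => rw [zero_add]; rfl
  | succ p ih => rw [add_right_comm, wsum_succ, wsum_succ, ih, ih]; rfl

theorem wsum_comm (p q : ℕ) (f : List Bool → List Bool → M) :
    wsum p (fun B => wsum q fun C => f B C) = wsum q fun C => wsum p fun B => f B C := by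
  induction p generalizing f with
  | zero => rfl
  | succ p ih => simp only [wsum_succ, ih, wsum_add, wsum_smul]

theorem wsum_succ_last (q : ℕ) (f : List Bool → M) : wsum (q + 1) f =
    wsum q fun B => f (B ++ [true]) + dInv • f (B ++ [false]) :=
  wsum_append q 1 f

theorem wsum_succ_first (q : ℕ) (f : List Bool → M) : wsum (q + 1) f =
    wsum q fun B => f (true :: B) + dInv • f (false :: B) := by
  rw [wsum_add, wsum_smul, wsum_succ]

theorem wsum_eq_single (q : ℕ) (f : List Bool → M)
    (h : ∀ B, B.length = q → B ≠ List.replicate q true → f B = 0) :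
    wsum q f = f (List.replicate q true) := by
  induction q generalizing f with
  | zero => rfl
  | succ q ih =>
    have h0 : wsum q (fun B => f (false :: B)) = wsum q fun _ => (0 : Coeff) • (0 : M) :=
      wsum_congr fun B hB => by
        rw [smul_zero]
        exact h _ (by simp [hB]) (by simp [List.replicate_succ])
    rw [wsum_succ, h0, wsum_smul, zero_smul, smul_zero, add_zero, List.replicate_succ]
    exact ih _ fun B hB hB' => h _ (by simp [hB]) (by simpa [List.replicate_succ] using hB')

end wsum

/-! ### Fat vertices acting on coloured lines -/

theorem CupCap.pp_mul_ribbon_crossing {A : Type*} [Ring A] [Algebra Coeff A] (t : CupCap A d)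
    (c : Bool) {i a : ℕ} (h : i + 2 ≤ a) :
    t.pp dInv 0 a * t.ribbon (sl (.crossing c) i) = pA (4 * sgn c) • t.pp dInv 0 a +
      pA (-(4 * sgn c)) • (t.pp dInv 0 a * t.ribbon (sl .cup i * sl .cap i)) -
      d • (t.pp dInv 0 a * t.ribbon (sl (.vertex () 2 2) i)) := by
  rw [t.pp_mul_ribbon_yamadaRel (.crossing c i) (wfits_sl.2 ⟨h, rfl⟩)]
  simp only [map_sub, map_add, map_smul, map_one, evalWord_word, mul_sub, mul_add, mul_smul_comm,
    mul_one]

namespace LocalGraph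

variable {n : ℕ}

/-- The number of fat strands that are coloured by `true`. -/
abbrev cnt (L : List Bool) : ℕ := L.count true

theorem cnt_append (A B : List Bool) : cnt (A ++ B) = cnt A + cnt B := List.count_append

/-- The action of a fat vertex on functions on the colourings of the fat strands: a strand
coloured by `true` belongs to the graph, and a strand coloured by `false` is deleted. -/
def fatLin (n p q i : ℕ) :
    (Stream' Bool → LocalGraph n) →ₗ[Coeff] Stream' Bool → LocalGraph n where
  toFun G s := wsum q fun B => V n (cnt ((s.drop i).take p)) (cnt B) (cnt (s.take i)) *
    G (s.take i ++ₛ (B ++ₛ (s.drop i).drop p))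
  map_add' G G' := by
    ext s
    simp only [Pi.add_apply, mul_add, wsum_add]
  map_smul' r G := by
    ext s
    simp only [Pi.smul_apply, mul_smul_comm, wsum_smul, RingHom.id_apply]

theorem fatLin_apply {p q i : ℕ} {G : Stream' Bool → LocalGraph n} {L A : List Bool}
    {s : Stream' Bool}
    (hL : L.length = i) (hA : A.length = p) : fatLin n p q i G (L ++ₛ (A ++ₛ s)) =
      wsum q fun B => V n (cnt A) (cnt B) (cnt L) * G (L ++ₛ (B ++ₛ s)) := by
  subst hL hA
  simp only [fatLin, LinearMap.coe_mk, AddHom.coe_mk, Stream'.drop_append_stream]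
  have h (l : List Bool) (s : Stream' Bool) : (l ++ₛ s).take l.length = l := by
    rw [Stream'.take_append_of_le_length _ _ _ le_rfl, List.take_length]
  rw [h, h]

theorem exists_append (k : ℕ) (s : Stream' Bool) :
    ∃ L : List Bool, ∃ s', L.length = k ∧ s = L ++ₛ s' :=
  ⟨s.take k, s.drop k, Stream'.length_take .., (Stream'.append_take_drop k s).symm⟩

theorem fatLin_interchange (p q p' q' i k : ℕ) :
    fatLin n p q i * fatLin n p' q' (i + q + k) = fatLin n p' q' (i + p + k) * fatLin n p q i := by
  ext G s
  obtain ⟨L, s, hL, rfl⟩ := exists_append i s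
  obtain ⟨A, s, hA, rfl⟩ := exists_append p s
  obtain ⟨M, s, hM, rfl⟩ := exists_append k s
  obtain ⟨A', s, hA', rfl⟩ := exists_append p' s
  have h₁ : ∀ B : List Bool, B.length = q → fatLin n p' q' (i + q + k) G
      (L ++ₛ (B ++ₛ (M ++ₛ (A' ++ₛ s)))) = wsum q' fun C =>
        V n (cnt A') (cnt C) (cnt L + cnt B + cnt M) * G (L ++ₛ (B ++ₛ (M ++ₛ (C ++ₛ s)))) := by
    intro B hB
    have := fatLin_apply (n := n) (q := q') (G := G) (L := L ++ B ++ M) (A := A') (s := s) rfl rfl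
    simpa [hL, hB, hM, hA', add_assoc] using this
  have h₂ (G' : Stream' Bool → LocalGraph n) : fatLin n p' q' (i + p + k) G'
      (L ++ₛ (A ++ₛ (M ++ₛ (A' ++ₛ s)))) = wsum q' fun C =>
        V n (cnt A') (cnt C) (cnt L + cnt A + cnt M) * G' (L ++ₛ (A ++ₛ (M ++ₛ (C ++ₛ s)))) := by
    have := fatLin_apply (n := n) (q := q') (G := G') (L := L ++ A ++ M) (A := A') (s := s) rfl rfl
    simpa [hL, hA, hM, hA', add_assoc] using this
  rw [Module.End.mul_apply, Module.End.mul_apply, fatLin_apply hL hA, h₂]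
  simp only [fatLin_apply hL hA]
  rw [wsum_congr fun B hB => by rw [h₁ B hB, mul_wsum]]
  simp only [mul_wsum, ← mul_assoc]
  rw [wsum_comm]
  refine wsum_congr fun C _ => wsum_congr fun B _ => ?_
  rw [show cnt L + cnt B + cnt M = cnt L + (Piece.vertex () (cnt A) (cnt B)).bot + cnt M from rfl,
    V, V, LocalGraph.interchange]
  rfl

/-- The sum over the colour of the shared strand has two terms, an edge and `d⁻¹` times the deleted
edge. By `V_mul_V_add` they add up to the contracted vertex. -/
theorem fatLin_fuse_right (p q r t i : ℕ) :
    fatLin n p (q + 1) i * fatLin n (r + 1) t (i + q) = fatLin n (p + r) (q + t) i := by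
  ext G s
  obtain ⟨L, s, hL, rfl⟩ := exists_append i s
  obtain ⟨A, s, hA, rfl⟩ := exists_append p s
  obtain ⟨A', s, hA', rfl⟩ := exists_append r s
  have h₁ (b : Bool) : ∀ B : List Bool, B.length = q → fatLin n (r + 1) t (i + q) G
      (L ++ₛ (B ++ [b] ++ₛ (A' ++ₛ s))) = wsum t fun C =>
        V n (cnt (b :: A')) (cnt C) (cnt L + cnt B) * G (L ++ₛ (B ++ C ++ₛ s)) := by
    intro B hB
    have := fatLin_apply (n := n) (q := t) (G := G) (L := L ++ B) (A := b :: A') (s := s) rfl rfl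
    simpa [hL, hB, hA', add_assoc, Stream'.cons_append_stream] using this
  have h₂ := fatLin_apply (n := n) (q := q + t) (G := G) (L := L) (A := A ++ A') (s := s) rfl rfl
  rw [Stream'.append_append_stream, hL, List.length_append, hA, hA'] at h₂
  rw [Module.End.mul_apply, fatLin_apply hL hA, h₂, wsum_succ_last, wsum_append]
  refine wsum_congr fun B hB => ?_
  rw [h₁ _ B hB, h₁ _ B hB, mul_wsum, mul_wsum, ← wsum_smul, ← wsum_add]
  refine wsum_congr fun C _ => ?_
  simp only [List.count_append, List.count_cons_self, List.count_nil, ← mul_assoc,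
    ← smul_mul_assoc, ← add_mul, List.count_cons, beq_true]
  rw [← V_mul_V_add]
  simp

theorem fatLin_fuse_left (p q r t i : ℕ) :
    fatLin n p (q + 1) (i + r) * fatLin n (r + 1) t i = fatLin n (r + p) (t + q) i := by
  ext G s
  obtain ⟨L, s, hL, rfl⟩ := exists_append i s
  obtain ⟨A', s, hA', rfl⟩ := exists_append r s
  obtain ⟨A, s, hA, rfl⟩ := exists_append p s
  have h₁ (b : Bool) (B : List Bool) : fatLin n (r + 1) t i G
      (L ++ₛ (A' ++ₛ (b :: B ++ₛ s))) = wsum t fun C =>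
        V n (cnt (A' ++ [b])) (cnt C) (cnt L) * G (L ++ₛ (C ++ B ++ₛ s)) := by
    have := fatLin_apply (n := n) (q := t) (G := G) (L := L) (A := A' ++ [b]) (s := B ++ₛ s) rfl rfl
    simpa [hL, hA', Stream'.cons_append_stream] using this
  have h₂ := fatLin_apply (n := n) (q := t + q) (G := G) (L := L) (A := A' ++ A) (s := s) rfl rfl
  rw [Stream'.append_append_stream, hL, List.length_append, hA, hA'] at h₂
  have h₃ (G' : Stream' Bool → LocalGraph n) := fatLin_apply (n := n) (q := q + 1) (G := G')
    (L := L ++ A') (A := A) (s := s) rfl rfl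
  simp only [Stream'.append_append_stream, hL, List.length_append, hA, hA'] at h₃
  rw [Module.End.mul_apply, h₃, h₂, wsum_succ_first, wsum_append, wsum_comm]
  refine wsum_congr fun B hB => ?_
  rw [h₁ _ B, h₁ _ B, mul_wsum, mul_wsum, ← wsum_smul, ← wsum_add]
  refine wsum_congr fun C _ => ?_
  simp only [List.count_append, List.count_cons_self, List.count_nil, ← mul_assoc,
    ← smul_mul_assoc, ← add_mul, List.count_cons, beq_true]
  rw [← V_add_mul_V]
  simp

/-- Four colourings of the two shared strands contribute. After `V_two_mul_V_two` one copy of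
contraction–deletion with weight `d⁻¹` is left over, which raises the factor `d - d⁻¹` to `d`. -/
theorem fatLin_two_two (p q i : ℕ) :
    fatLin n p 2 i * fatLin n 2 q i = d • fatLin n p q i := by
  ext G s
  obtain ⟨L, s, hL, rfl⟩ := exists_append i s
  obtain ⟨A, s, hA, rfl⟩ := exists_append p s
  rw [Module.End.mul_apply, fatLin_apply hL hA, LinearMap.smul_apply, Pi.smul_apply,
    fatLin_apply hL hA]
  have h₁ (b c : Bool) : fatLin n 2 q i G (L ++ₛ ([b, c] ++ₛ s)) = _ := fatLin_apply hL rfl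
  simp only [wsum_succ, wsum_zero, h₁, mul_wsum, ← wsum_smul, ← wsum_add]
  refine wsum_congr fun C _ => ?_
  simp only [← mul_assoc, ← smul_mul_assoc, ← add_mul, List.count_cons, List.count_nil]
  congr 1
  simp
  rw [V_two_mul_V_two, ← V_mul_V_zero]
  simp only [sub_smul, smul_add, smul_smul, sub_mul]
  abel

/-- The functions on colourings whose value has at least as many strands as are coloured by
`true`. -/
def colored (n : ℕ) : Submodule Coeff (Stream' Bool → LocalGraph n) where
  carrier := {G | ∀ s j, e n (cnt (s.take j)) * G s = G s}
  zero_mem' s j := mul_zero _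
  add_mem' hG hG' s j := by rw [Pi.add_apply, mul_add, hG, hG']
  smul_mem' r G hG s j := by rw [Pi.smul_apply, mul_smul_comm, hG]

/-- Kept strands up to the legs of the vertex are demanded by the vertex itself; those further right
pass below it and are demanded by `G`. -/
theorem fatLin_mem (p q i : ℕ) {G : Stream' Bool → LocalGraph n} (hG : G ∈ colored n) :
    fatLin n p q i G ∈ colored n := by
  intro s j
  obtain ⟨L, s, hL, rfl⟩ := exists_append i s
  obtain ⟨A, s, hA, rfl⟩ := exists_append p s
  rw [fatLin_apply hL hA, mul_wsum]
  refine wsum_congr fun B _ => ?_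
  rw [← mul_assoc]
  rcases le_total j (L ++ A).length with hj | hj
  · rw [← Stream'.append_append_stream, Stream'.take_append_of_le_length _ _ _ hj, e_mul_S]
    simpa using (List.take_sublist j (L ++ A)).count_le true
  · obtain ⟨m, rfl⟩ := Nat.exists_eq_add_of_le hj
    have h := hG (L ++ B ++ₛ s) ((L ++ B).length + m)
    rw [← Stream'.append_take] at h
    rw [← Stream'.append_append_stream, ← Stream'.append_take, cnt_append, cnt_append]
    rw [cnt_append, cnt_append, Stream'.append_append_stream] at h
    rw [show e n (cnt L + cnt A + cnt (s.take m)) * V n (cnt A) (cnt B) (cnt L) =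
      V n (cnt A) (cnt B) (cnt L) * e n (cnt L + cnt B + cnt (s.take m)) from
      (S_mul_e_add (.vertex () (cnt A) (cnt B)) (cnt L) (cnt (s.take m))).symm, mul_assoc, h]

/-- A change of colour would create a one-valent vertex, so it contributes zero. A kept strand gives
an erasable two-valent vertex and a deleted one gives `d⁻¹ d`. Both leave an idempotent `e`, which
is why the identity holds only on `colored n`. -/
theorem fatLin_one_one (i : ℕ) {G : Stream' Bool → LocalGraph n} (hG : G ∈ colored n) :
    fatLin n 1 1 i G = G := by
  ext s
  obtain ⟨L, s, hL, rfl⟩ := exists_append i s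
  obtain ⟨A, s, hA, rfl⟩ := exists_append 1 s
  rw [fatLin_apply hL hA]
  obtain ⟨b, rfl⟩ := List.length_eq_one_iff.1 hA
  cases b
  · have := hG (L ++ₛ ([false] ++ₛ s)) L.length
    rw [Stream'.take_append_of_le_length _ _ _ le_rfl, List.take_length] at this
    simpa [wsum_succ, wsum_zero, V_zero_one, V_zero_zero, smul_smul, dInv_mul_d] using this
  · have := hG (L ++ [true] ++ₛ s) (L ++ [true]).length
    rw [Stream'.take_append_of_le_length _ _ _ le_rfl, List.take_length, cnt_append] at this
    simpa [wsum_succ, wsum_zero, V_one_zero, V_one_one, Stream'.cons_append_stream] using this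

/-- Fat vertices as endomorphisms. -/
def fatVertices (n : ℕ) : FatVertices (Module.End Coeff (colored n)) d where
  F p q i := (fatLin n p q i).restrict fun _ => fatLin_mem p q i
  interchange p q p' q' i k := LinearMap.ext fun G => Subtype.ext
    (LinearMap.congr_fun (fatLin_interchange p q p' q' i k) G.1)
  fuse_right p q r t i := LinearMap.ext fun G => Subtype.ext
    (LinearMap.congr_fun (fatLin_fuse_right p q r t i) G.1)
  fuse_left p q r t i := LinearMap.ext fun G => Subtype.ext
    (LinearMap.congr_fun (fatLin_fuse_left p q r t i) G.1)
  one_one i := LinearMap.ext fun G => Subtype.ext (fatLin_one_one i G.2)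
  zero_zero i := by
    refine LinearMap.ext fun G => Subtype.ext (funext fun s => ?_)
    obtain ⟨L, s, hL, rfl⟩ := exists_append i s
    refine (fatLin_apply (A := []) hL rfl).trans ?_
    have := G.2 (L ++ₛ s) L.length
    rw [Stream'.take_append_of_le_length _ _ _ le_rfl, List.take_length] at this
    simp [wsum_zero, V_zero_zero, this]
  two_two i := LinearMap.ext fun G => Subtype.ext
    ((LinearMap.congr_fun (fatLin_two_two 1 1 i) G.1).trans
      (congrArg (d • ·) (fatLin_one_one i G.2)))

theorem fatVertices_apply (p q i : ℕ) (G : colored n) (s : Stream' Bool) :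
    ((fatVertices n).F p q i G).1 s = fatLin n p q i G.1 s := rfl

/-- The cups and caps that act on functions on colourings. -/
abbrev cc (n : ℕ) : CupCap (Module.End Coeff (colored n)) d := (fatVertices n).cupCap

/-- The cup–cap term ends and restarts the strand: on a kept strand a one-valent vertex kills it,
and on a deleted strand it is the identity and cancels `1`. -/
theorem p_apply (G : colored n) (j : ℕ) (s : Stream' Bool) :
    ((cc n).p dInv j G).1 s = if s.get j then G.1 s else 0 := by
  have h : ((cc n).p dInv j G).1 s =
      G.1 s - dInv • fatLin n 1 0 j (fatLin n 0 1 j G.1) s := by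
    rw [CupCap.p, FatVertices.cupCap_c_even, FatVertices.cupCap_u_even]
    rfl
  obtain ⟨L, s, hL, rfl⟩ := exists_append j s
  obtain ⟨A, s, hA, rfl⟩ := exists_append 1 s
  obtain ⟨b, rfl⟩ := List.length_eq_one_iff.1 hA
  have hb : Stream'.get (L ++ₛ ([b] ++ₛ s)) j = b := by
    subst hL
    rw [← add_zero L.length, Stream'.get_append_right]
    rfl
  have h₁ : fatLin n 0 1 j G.1 (L ++ₛ s) = _ := fatLin_apply (A := []) hL rfl
  rw [h, hb, fatLin_apply hL hA, wsum_zero, Stream'.nil_append_stream, h₁]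
  cases b
  · have := G.2 (L ++ₛ ([false] ++ₛ s)) L.length
    rw [Stream'.take_append_of_le_length _ _ _ le_rfl, List.take_length] at this
    have h : e n (cnt L) * e n (cnt L) = e n (cnt L) := e_mul_e le_rfl
    simp [wsum_succ, wsum_zero, V_zero_one, V_zero_zero, smul_smul, dInv_mul_d, ← mul_assoc, h]
    exact sub_eq_zero.2 this.symm
  · simp [V_one_zero]

theorem pp_apply (G : colored n) (k : ℕ) (s : Stream' Bool) :
    ((cc n).pp dInv 0 k G).1 s = if s.take k = List.replicate k true then G.1 s else 0 := by
  induction k generalizing G with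
  | zero => simp
  | succ k ih =>
    have h : s.take (k + 1) = List.replicate (k + 1) true ↔
        s.take k = List.replicate k true ∧ s.get k = true := by
      rw [Stream'.take_succ', List.replicate_succ']
      refine ⟨fun h => ?_, fun ⟨h, h'⟩ => by rw [h, h']⟩
      have := List.append_inj' h rfl
      exact ⟨this.1, by simpa using this.2⟩
    rw [CupCap.pp_succ, Module.End.mul_apply, ih, p_apply, zero_add, ← ite_and]
    simp only [h]

/-- The colouring of exactly the first `a` fat strands by `true`. -/
def firstTrue (a : ℕ) : Stream' Bool := List.replicate a true ++ₛ Stream'.const false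

theorem take_firstTrue {k a : ℕ} (h : k ≤ a) : (firstTrue a).take k = List.replicate k true := by
  rw [firstTrue, Stream'.take_append_of_le_length _ _ _ (by simpa using h), List.take_replicate,
    min_eq_left h]

theorem e_mul_firstTrue (G : colored n) {k a : ℕ} (h : k ≤ a) :
    e n k * G.1 (firstTrue a) = G.1 (firstTrue a) := by
  simpa [take_firstTrue h] using G.2 (firstTrue a) k

theorem pp_firstTrue (G : colored n) (a : ℕ) :
    ((cc n).pp dInv 0 a G).1 (firstTrue a) = G.1 (firstTrue a) := by
  rw [pp_apply, if_pos (take_firstTrue le_rfl)]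

/-- The lower row of projectors annihilates every colouring of the outgoing strands except the one
that keeps all of them, so the weighted sum has a single term. -/
theorem pp_mul_F_mul_pp_firstTrue (G : colored n) (p q i r : ℕ) :
    (((cc n).pp dInv 0 (i + p + r) * (fatVertices n).F p q i * (cc n).pp dInv 0 (i + q + r)) G).1
      (firstTrue (i + p + r)) = V n p q i * G.1 (firstTrue (i + q + r)) := by
  have h (m : ℕ) : firstTrue (i + m + r) = List.replicate i true ++ₛ
      (List.replicate m true ++ₛ (List.replicate r true ++ₛ Stream'.const false)) := by
    rw [firstTrue, List.replicate_add, List.replicate_add, Stream'.append_append_stream,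
      Stream'.append_append_stream]
  rw [mul_assoc, Module.End.mul_apply, pp_firstTrue, Module.End.mul_apply, fatVertices_apply, h p,
    fatLin_apply (by simp) (by simp), wsum_eq_single, ← h q, pp_firstTrue]
  · simp
  · intro B hB hB'
    rw [pp_apply, if_neg, mul_zero]
    intro h'
    refine hB' (List.eq_replicate_iff.2 ⟨hB, fun b hb => ?_⟩)
    rw [← Stream'.append_append_stream, ← Stream'.append_append_stream,
      Stream'.take_append_of_le_length _ _ _ (by simp [hB, add_assoc]),
      List.take_of_length_le (by simp [hB, add_assoc])]
      at h'
    refine List.eq_of_mem_replicate (n := i + q + r) (h' ▸ ?_)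
    simp [hb]

theorem pp_mul_ribbon_vertex {x : Piece Unit} {i a p q : ℕ} (h : i + x.top ≤ a) (hp : x.top = p)
    (hq : x.bot = q) (hx : (cc n).core ⟨x, i⟩ = (cc n).dv (2 * i) p q) (G : colored n) :
    (((cc n).pp dInv 0 a * (cc n).ribbon (sl x i)) G).1 (firstTrue a) =
      V n p q i * G.1 (firstTrue (a - p + q)) := by
  subst hp hq
  rw [CupCap.ribbon_sl, ← (CupCap.pp_mul_core_mul_pp _ h).1, hx, FatVertices.cupCap_dv]
  obtain ⟨r, rfl⟩ := Nat.exists_eq_add_of_le h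
  rw [show i + x.top + r - x.top + x.bot = i + x.bot + r by omega, pp_mul_F_mul_pp_firstTrue]

theorem pp_mul_ribbon_cap {i a : ℕ} (h : i ≤ a) (G : colored n) :
    (((cc n).pp dInv 0 a * (cc n).ribbon (sl .cap i)) G).1 (firstTrue a) =
      S n .cap i * G.1 (firstTrue (a + 2)) := by
  rw [cap_eq_V]
  exact pp_mul_ribbon_vertex (x := .cap) h rfl rfl rfl G

theorem pp_mul_ribbon_cup {i a : ℕ} (h : i + 2 ≤ a) (G : colored n) :
    (((cc n).pp dInv 0 a * (cc n).ribbon (sl .cup i)) G).1 (firstTrue a) =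
      S n .cup i * G.1 (firstTrue (a - 2)) := by
  rw [cup_eq_V]
  exact pp_mul_ribbon_vertex (x := .cup) h rfl rfl rfl G

theorem pp_mul_ribbon_sl (x : Piece Unit) {i a : ℕ} (h : i + x.top ≤ a) (G : colored n) :
    (((cc n).pp dInv 0 a * (cc n).ribbon (sl x i)) G).1 (firstTrue a) =
      S n x i * G.1 (firstTrue (a - x.top + x.bot)) := by
  cases x with
  | cap => exact pp_mul_ribbon_cap h G
  | cup => exact pp_mul_ribbon_cup h G
  | vertex v p q => exact pp_mul_ribbon_vertex (x := .vertex v p q) h rfl rfl rfl G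
  -- The Yamada crossing relation holds on both sides and reduces a crossing to a cup, a cap and a
  -- vertex.
  | crossing c =>
    rw [Piece.top_crossing] at h
    have hc : (((cc n).pp dInv 0 a * (cc n).ribbon (sl .cup i * sl .cap i)) G).1 (firstTrue a) =
        S n .cup i * (S n .cap i * G.1 (firstTrue a)) := by
      rw [map_mul, ← mul_assoc, Module.End.mul_apply, pp_mul_ribbon_cup h, ← pp_firstTrue,
        ← Module.End.mul_apply, pp_mul_ribbon_cap (by omega), Nat.sub_add_cancel (by omega)]
    have hv := pp_mul_ribbon_vertex (n := n) (x := .vertex () 2 2) h rfl rfl rfl G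
    rw [CupCap.pp_mul_ribbon_crossing _ c h, S_crossing]
    rw [Piece.top_crossing, Piece.bot_crossing, Nat.sub_add_cancel (by omega)]
    rw [Piece.top_vertex, Piece.bot_vertex, Nat.sub_add_cancel (by omega)] at hv
    have hcup : e n (i + 2) * S n .cup i = S n .cup i := e_mul_S le_rfl
    have hvtx : e n (i + 2) * V n 2 2 i = V n 2 2 i := e_mul_S le_rfl
    rw [mul_sub, mul_add, sub_mul, add_mul]
    simp only [mul_smul_comm, smul_mul_assoc, mul_one, e_mul_firstTrue G h, ← mul_assoc,
      hcup, hvtx]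
    rw [mul_assoc, ← hc, ← hv, ← pp_firstTrue G]
    rfl

/-- Evaluation at `firstTrue` does not notice the row of projectors (`pp_firstTrue`), so the row can
be reinserted before every slice and the slices act in turn. -/
theorem pp_mul_ribbon_firstTrue {w : Word Unit} {a b : ℕ} (h : WFits a w b) (G : colored n) :
    (((cc n).pp dInv 0 a * (cc n).ribbon w) G).1 (firstTrue a) =
      mk n (word w) * G.1 (firstTrue b) := by
  induction w using Word.induction generalizing a with
  | one => rw [wfits_one.1 h, map_one, mul_one, pp_firstTrue, word_one, map_one, one_mul]
  | mul x i w ih =>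
    obtain ⟨hx, hw⟩ := wfits_sl_mul.1 h
    rw [map_mul, ← mul_assoc, Module.End.mul_apply, pp_mul_ribbon_sl x hx, ← pp_firstTrue,
      ← Module.End.mul_apply, ih hw, word_mul, map_mul, mul_assoc]
    rfl

end LocalGraph

/-! ### Injectivity -/

open LocalGraph in
theorem injective_of_graphClass {n : ℕ} (Φ : GraphAlgebra n →ₙₐ[Coeff] TemperleyLieb (2 * n))
    (hΦ : ∀ D : Diagram Unit n, Φ (graphClass D) = cabling D) : Function.Injective Φ := by
  obtain ⟨f, hf⟩ := exists_skeinLift homogeneous_kauffmanRel (cc n).tangle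
    (fun _ _ => (cc n).tangle_move) (fun _ _ => (cc n).tangle_kauffmanRel) (2 * n)
  classical
  -- The test function is concentrated at `firstTrue n`. Its value there is `e n n` instead of `1`
  -- because `colored n` requires the `n` kept strands to be present.
  have hG : (fun s => if s = firstTrue n then e n n else 0) ∈ colored n := by
    intro s j
    dsimp only
    split_ifs with hs
    · subst hs
      refine e_mul_e ?_
      rcases le_total j n with hj | hj
      · simpa [take_firstTrue hj] using hj
      · obtain ⟨m, rfl⟩ := Nat.exists_eq_add_of_le hj
        have := Stream'.append_take m (List.replicate n true) (Stream'.const false)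
        rw [List.length_replicate] at this
        rw [firstTrue, ← this]
        have h0 : cnt ((Stream'.const false).take m) = 0 := by
          clear this hj
          induction m with
          | zero => rfl
          | succ m ih => rwa [Stream'.take_succ]
        rw [cnt_append, h0]
        simp
    · exact mul_zero _
  have key (x) (hx : x ∈ Hom Unit n n) :
      (f (Φ (skeinLin YamadaRel n x)) ⟨_, hG⟩).1 (firstTrue n) = mk n x * e n n := by
    induction hx using Hom.induction with
    | word w hw =>
      have : Φ (skeinLin YamadaRel n (word w)) = skeinLin KauffmanRel (2 * n) (cable n w.toList) :=
        hΦ ⟨w, hw⟩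
      rw [this, hf _ (cable_mem_hom hw), CupCap.evalWord_cable _ hw, pp_mul_ribbon_firstTrue hw]
      simp
    | zero => simp
    | add x y _ _ hx hy => 
      simp only [map_add, LinearMap.add_apply, add_mul, Submodule.coe_add, Pi.add_apply, hx, hy]
    | smul r x _ h => 
      simp only [map_smul, LinearMap.smul_apply, Submodule.coe_smul, Pi.smul_apply, h,
        smul_mul_assoc]
  intro z z' h
  obtain ⟨x, hx, rfl⟩ := exists_skeinLin z
  obtain ⟨x', hx', rfl⟩ := exists_skeinLin z'
  have h₁ := (key x hx).symm.trans
    ((congrArg (fun z => (f z ⟨_, hG⟩).1 (firstTrue n)) h).trans (key x' hx'))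
  rw [← mk_e, ← map_mul, ← map_mul, mk_eq_mk] at h₁
  -- Local equality is used for the whole diagram, with `n` strands on top; there the factor `e n n`
  -- is `1` in the graph algebra.
  have h₂ := skeinLin_eq_of_sub (skeinLin_eq_zero (h₁ n))
  have h₃ : skeinLin YamadaRel n (dInv • word (sl (.vertex () 0 0) n)) = skeinLin YamadaRel n 1 :=
    skeinLin_eq_of_sub (skeinLin_eq_zero (e_sub_one_mem le_rfl))
  have h₄ : dInv • word (sl (.vertex () 0 0) n) ∈ Hom Unit n n :=
    Submodule.smul_mem _ _ (word_mem_hom (wfits_sl.2 ⟨by simp, by simp⟩))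
  rwa [skeinLin_mul hx h₄, skeinLin_mul hx' h₄, h₃, ← skeinLin_mul hx (one_mem_hom n),
    ← skeinLin_mul hx' (one_mem_hom n), mul_one, mul_one] at h₂

end RibbonGraph

end

theorem theorem5p1 (n : ℕ) :
    ∃ Φ : RibbonGraph.GraphAlgebra n →ₙₐ[RibbonGraph.Coeff] RibbonGraph.TemperleyLieb (2 * n),
      (∀ D : RibbonGraph.Diagram Unit n, Φ (RibbonGraph.graphClass D) = RibbonGraph.cabling D) ∧
      Function.Injective Φ := by
  obtain ⟨Φ, hΦ⟩ := RibbonGraph.exists_cablingHom n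
  exact ⟨Φ, hΦ, RibbonGraph.injective_of_graphClass Φ hΦ⟩
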